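/- Let $c_1,\dots,c_{2n}$ be Majorana operators on $n$ fermionic modes, i.e. Hermitian operators on a $2^n$-dimensional Hilbert space with $c_ic_j+c_jc_i=2\delta_{ij}\mathbb I$, and for $I=\{i_1<i_2<i_3<i_4\}\subseteq[2n]$ put $C_I=i^2c_{i_1}c_{i_2}c_{i_3}c_{i_4}$. For real $k>0$, the sparse SYK-4 model with expected degree $k$ is the random Hamiltonian $$H=\frac1{\sqrt{2kn}}\sum_{I\subseteq[2n],\,|I|=4}X_IJ_IC_I,$$ where all $X_I$ and $J_I$ are independent, the $X_I$ are Bernoulli variables with $\Pr(X_I=1)=k/\binom{2n-1}{3}$, and the $J_I$ are Gaussian with mean $0$ and variance $1$. Let $\lambda_{\max}(H)=\max_\rho \mathrm{Tr}(H\rho)$, the maximum being over all density matrices. A Gaussian state is a state of the form $\rho=2^{-n}\prod_{j=1}^n(\mathbb I+i\lambda_j\tilde c_{2j-1}\tilde c_{2j})$ with $\lambda_j\in[-1,1]$ and $\tilde c_i=\sum_jR_{ij}c_j$, $R\in SO(2n)$; it is determined by its correlation matrix $\Gamma_{ij}=\frac i2\mathrm{Tr}(\rho[c_i,c_j])$.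 **Theorem.** There are an algorithm (a program for a random access machine with real registers, unit-cost addition, subtraction and comparison) and a polynomial $T$ with the following properties for all integers $n$ and real $k>0$ with $n>120(k+1)$. The input is $n$, $k$ and the list of the coefficients of a strictly $4$-local Hamiltonian on $2n$ Majorana operators, and the algorithm stops after at most $T(n)$ steps on every such input. If the input is the sparse SYK-4 Hamiltonian $H$ with expected degree $k$, then with probability at least $$1-4\exp\left[-\frac{e^{-16(k+1)}k^3}{64(8k+7)}\,n\right]$$ one has $\lambda_{\max}(H)>0$ and the output is the correlation matrix of a Gaussian state $\rho$ with $$\frac{\mathrm{Tr}(H\rho)}{\lambda_{\max}(H)}\ \ge\ \frac1{1236+2752k+1536k^2}.$$ -/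

import Mathlib

open MeasureTheory ProbabilityTheory

namespace SparseSYK

noncomputable section

/-! ### Majorana operators, density matrices and Gaussian states -/

/-- Operators on the `2 ^ n`-dimensional Hilbert space of `n` fermionic modes, written as matrices
in the basis of the occupation numbers of the modes. -/
abbrev FockMatrix (n : ℕ) : Type := Matrix (Fin n → Bool) (Fin n → Bool) ℂ

/-- `c` is a system of `2 n` Majorana operators on `n` fermionic modes: the `c i` are Hermitian and
`c i * c j + c j * c i = 2 δ i j`. (In particular `c i ^ 2 = 1` and `c i` is traceless.) -/
structure IsMajoranaSystem (n : ℕ) (c : Fin (2 * n) → FockMatrix n) : Prop where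
  isHermitian : ∀ i, (c i).IsHermitian
  anticomm : ∀ i j, c i * c j + c j * c i = if i = j then 2 else 0

/-- The Hermitian Majorana monomial `C_I = i ^ (q / 2) c_{i_1} ⋯ c_{i_q}`, where
`I = {i_1 < ⋯ < i_q}` and `q = |I|` (used for even `q`). -/
def majoranaMonomial {n : ℕ} (c : Fin (2 * n) → FockMatrix n) (I : Finset (Fin (2 * n))) :
    FockMatrix n :=
  Complex.I ^ (I.card / 2) • ((I.sort (· ≤ ·)).map c).prod

open scoped ComplexOrder in
/-- Density matrices. -/
def IsDensityMatrix {n : ℕ} (ρ : FockMatrix n) : Prop :=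
  ρ.PosSemidef ∧ ρ.trace = 1

/-- The maximal energy `λ_max(H) = max_ρ Tr(H ρ)`, the maximum being over all density matrices;
for Hermitian `H` it is the largest eigenvalue of `H`. -/
def lambdaMax {n : ℕ} (H : FockMatrix n) : ℝ :=
  sSup {x : ℝ | ∃ ρ : FockMatrix n, IsDensityMatrix ρ ∧ x = (H * ρ).trace.re}

/-- The rotated Majorana operators `c̃_i = ∑_j R_{ij} c_j`. -/
def rotate {n : ℕ} (R : Matrix (Fin (2 * n)) (Fin (2 * n)) ℝ) (c : Fin (2 * n) → FockMatrix n)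
    (i : Fin (2 * n)) : FockMatrix n :=
  ∑ j, (R i j : ℂ) • c j

/-- Fermionic Gaussian states, mixed or pure:
`ρ = 2 ^ (-n) ∏_{j=1}^n (1 + i λ_j c̃_{2j-1} c̃_{2j})` with `λ_j ∈ [-1, 1]` and
`c̃ = R c` for some `R ∈ SO(2n)`. For `|λ_j| < 1` these are the states proportional to
`exp(-i ∑ β_{ij} c_i c_j)` with `β` real antisymmetric; the values `λ_j = ± 1` are their limits
and include the pure Gaussian states. -/
def IsGaussianState {n : ℕ} (c : Fin (2 * n) → FockMatrix n) (ρ : FockMatrix n) : Prop :=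
  ∃ R ∈ Matrix.specialOrthogonalGroup (Fin (2 * n)) ℝ, ∃ l : Fin n → ℝ,
    (∀ j, l j ∈ Set.Icc (-1 : ℝ) 1) ∧
    ρ = ((2 : ℂ) ^ n)⁻¹ • (List.ofFn fun j : Fin n =>
      (1 : FockMatrix n) + (Complex.I * (l j : ℂ)) •
        (rotate R c ⟨2 * j.val, by omega⟩ * rotate R c ⟨2 * j.val + 1, by omega⟩)).prod

/-- The entry `Γ_{ij} = (i / 2) Tr(ρ [c_i, c_j])` of the correlation matrix of a state. It is real,
and the correlation matrix determines a Gaussian state. -/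
def correlation {n : ℕ} (c : Fin (2 * n) → FockMatrix n) (ρ : FockMatrix n)
    (i j : Fin (2 * n)) : ℂ :=
  Complex.I / 2 * (ρ * (c i * c j - c j * c i)).trace

/-! ### The sparse SYK-4 model -/

/-- The 4-element sets of Majorana operators. -/
abbrev Interaction (n : ℕ) : Type := {I : Finset (Fin (2 * n)) // I.card = 4}

/-- The strictly 4-local Hamiltonian with coefficients `h`. -/
def hamiltonian {n : ℕ} (c : Fin (2 * n) → FockMatrix n) (h : Interaction n → ℝ) :
    FockMatrix n :=
  ∑ I, (h I : ℂ) • majoranaMonomial c I.1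

/-- The selection probability `k / binom(2n - 1, 3)`. (The projection to `[0, 1]` only serves to
have an element of the unit interval; it changes nothing if `0 ≤ k ≤ binom(2n - 1, 3)`.) -/
def selectionProb (n : ℕ) (k : ℝ) : unitInterval :=
  Set.projIcc 0 1 zero_le_one (k / ((2 * n - 1).choose 3 : ℝ))

/-- The joint law of the random variables `(X, J)` of the sparse SYK-4 model: all `X_I` and `J_I`
are independent, `X_I` is Bernoulli with `Pr(X_I = 1) = k / binom(2n - 1, 3)`, and `J_I` is a
standard Gaussian. -/
def ssykLaw (n : ℕ) (k : ℝ) : Measure ((Interaction n → ℝ) × (Interaction n → ℝ)) :=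
  (Measure.pi fun _ => bernoulliMeasure (1 : ℝ) 0 (selectionProb n k)).prod
    (Measure.pi fun _ => gaussianReal 0 1)

/-- The coefficients `X_I J_I / √(2 k n)` of the sparse SYK-4 Hamiltonian. -/
def ssykCoeff {n : ℕ} (k : ℝ) (ω : (Interaction n → ℝ) × (Interaction n → ℝ)) :
    Interaction n → ℝ :=
  fun I => (1 / Real.sqrt (2 * k * n)) * (ω.1 I * ω.2 I)

end

/-! ### Algorithms with real data and their running time

A random access machine with real registers. Its memory consists of arrays of natural numbers and
arrays of real numbers, addressed by tuples of natural numbers; a scalar variable is the entry of an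
array at the empty tuple. Natural and real numbers can be added, subtracted and compared (there is
no multiplication, so that the bit lengths of all numbers remain polynomial in the number of steps),
the only constants are natural numbers, and there is no conversion from real to natural numbers.
Control flow: sequence, branching, and loops with a counter. Every elementary operation and every
coordinate of an array access costs one step. -/

/-- Memory contents: `nat a idx` and `real a idx` are the entries at `idx` of the `a`-th array of
natural numbers and of the `a`-th array of real numbers. -/
structure State where
  nat : ℕ → List ℕ → ℕ
  real : ℕ → List ℕ → ℝ

namespace State

/-- The tuple of the values of the scalar variables `xs`. -/
def index (s : State) (xs : List ℕ) : List ℕ := xs.map fun x => s.nat x []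

/-- Write `v` to the natural array `a` at the tuple `idx`. -/
def setNat (s : State) (a : ℕ) (idx : List ℕ) (v : ℕ) : State :=
  { s with nat := fun b j => if b = a ∧ j = idx then v else s.nat b j }

/-- Write `v` to the real array `a` at the tuple `idx`. -/
noncomputable def setReal (s : State) (a : ℕ) (idx : List ℕ) (v : ℝ) : State :=
  { s with real := fun b j => if b = a ∧ j = idx then v else s.real b j }

end State

/-- Expressions for natural numbers. `get a [x, y, …]` is the entry of array `a` at the values of the
scalar variables `x, y, …`; subtraction is truncated. -/
inductive NatExpr where
  | const (m : ℕ)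
  | get (a : ℕ) (xs : List ℕ)
  | add (e f : NatExpr)
  | sub (e f : NatExpr)

/-- Expressions for real numbers. -/
inductive RealExpr where
  | ofNat (e : NatExpr)
  | get (a : ℕ) (xs : List ℕ)
  | add (e f : RealExpr)
  | sub (e f : RealExpr)

/-- Tests. -/
inductive Test where
  | natLt (e f : NatExpr)
  | natEq (e f : NatExpr)
  | realLt (e f : RealExpr)
  | not (t : Test)
  | and (t u : Test)

/-- Programs. `natSet a xs e` and `realSet a xs e` assign the value of `e` to the entry of array `a` at
the values of the scalar variables `xs`; `loop x e p` evaluates `e` once, to `N` say, and then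
executes `p` for `x = 0, …, N - 1`. -/
inductive Program where
  | skip
  | natSet (a : ℕ) (xs : List ℕ) (e : NatExpr)
  | realSet (a : ℕ) (xs : List ℕ) (e : RealExpr)
  | seq (p q : Program)
  | ite (t : Test) (p q : Program)
  | loop (x : ℕ) (e : NatExpr) (p : Program)

def NatExpr.eval (s : State) : NatExpr → ℕ
  | const m => m
  | get a xs => s.nat a (s.index xs)
  | add e f => e.eval s + f.eval s
  | sub e f => e.eval s - f.eval s

def NatExpr.cost : NatExpr → ℕ
  | const _ => 1
  | get _ xs => 1 + xs.length
  | add e f => 1 + e.cost + f.cost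
  | sub e f => 1 + e.cost + f.cost

noncomputable def RealExpr.eval (s : State) : RealExpr → ℝ
  | ofNat e => (e.eval s : ℝ)
  | get a xs => s.real a (s.index xs)
  | add e f => e.eval s + f.eval s
  | sub e f => e.eval s - f.eval s

def RealExpr.cost : RealExpr → ℕ
  | ofNat e => 1 + e.cost
  | get _ xs => 1 + xs.length
  | add e f => 1 + e.cost + f.cost
  | sub e f => 1 + e.cost + f.cost

def Test.Holds (s : State) : Test → Prop
  | natLt e f => e.eval s < f.eval s
  | natEq e f => e.eval s = f.eval s
  | realLt e f => e.eval s < f.eval s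
  | not t => ¬ t.Holds s
  | and t u => t.Holds s ∧ u.Holds s

def Test.cost : Test → ℕ
  | natLt e f => 1 + e.cost + f.cost
  | natEq e f => 1 + e.cost + f.cost
  | realLt e f => 1 + e.cost + f.cost
  | not t => 1 + t.cost
  | and t u => 1 + t.cost + u.cost

open Classical in
/-- Execution of a program: the final memory contents and the number of steps. -/
noncomputable def Program.exec : Program → State → State × ℕ
  | skip, s => (s, 1)
  | natSet a xs e, s => (s.setNat a (s.index xs) (e.eval s), 1 + xs.length + e.cost)
  | realSet a xs e, s => (s.setReal a (s.index xs) (e.eval s), 1 + xs.length + e.cost)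
  | seq p q, s =>
      let r := p.exec s
      let r' := q.exec r.1
      (r'.1, r.2 + r'.2)
  | ite t p q, s =>
      let r := if t.Holds s then p.exec s else q.exec s
      (r.1, 1 + t.cost + r.2)
  | loop x e p, s =>
      Nat.rec (motive := fun _ => State × ℕ) (s, 1 + e.cost)
        (fun i r =>
          let r' := p.exec (r.1.setNat x [] i)
          (r'.1, r.2 + 1 + r'.2))
        (e.eval s)

/-- The initial memory for the instance `(n, k, h)`: the scalar `n` is in natural array `0`, the
scalar `k` in real array `0`, the coefficient of `I = {a < b < c < d}` in real array `1` at
`[a, b, c, d]`, where the Majorana operators are numbered `0, …, 2n - 1`. Everything else is `0`. -/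
noncomputable def inputState (n : ℕ) (k : ℝ) (h : Interaction n → ℝ) : State where
  nat a idx := if a = 0 ∧ idx = [] then n else 0
  real a idx :=
    if a = 0 ∧ idx = [] then k
    else if a = 1 then
      ∑ I : Interaction n, if (I.1.sort (· ≤ ·)).map Fin.val = idx then h I else 0
    else 0

/-- The number of steps of program `p` on the instance `(n, k, h)`. -/
noncomputable def runtime (p : Program) (n : ℕ) (k : ℝ) (h : Interaction n → ℝ) : ℕ :=
  (p.exec (inputState n k h)).2

/-- The `2n × 2n` real matrix that program `p` has written to real array `2` when it stops. -/
noncomputable def output (p : Program) (n : ℕ) (k : ℝ) (h : Interaction n → ℝ)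
    (i j : Fin (2 * n)) : ℝ :=
  (p.exec (inputState n k h)).1.real 2 [i.val, j.val]

/-! ### Existence of Majorana operators: the Jordan–Wigner construction -/

noncomputable section

/-- The mode to which a Majorana operator belongs. -/
def mode {n : ℕ} (a : Fin (2 * n)) : Fin n := ⟨a.val / 2, by omega⟩

/-- The sign `(-1) ^ b`. -/
def sgn (b : Bool) : ℂ := if b then -1 else 1

/-- The matrix element of a Jordan–Wigner operator that flips one mode of `x`. -/
def jwPhase {n : ℕ} (a : Fin (2 * n)) (x : Fin n → Bool) : ℂ :=
  (∏ i, if i < mode a then sgn (x i) else 1) *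
    if a.val % 2 = 0 then 1 else Complex.I * sgn (x (mode a))

/-- The Jordan–Wigner operators. -/
def jordanWigner (n : ℕ) (a : Fin (2 * n)) : FockMatrix n :=
  Matrix.of fun x y =>
    if y = Function.update x (mode a) (!x (mode a)) then jwPhase a x else 0

end

lemma sgn_not (b : Bool) : sgn (!b) = - sgn b := by cases b <;> simp [sgn]

lemma sgn_mul_self (b : Bool) : sgn b * sgn b = 1 := by cases b <;> simp [sgn]

lemma star_sgn (b : Bool) : (starRingEnd ℂ) (sgn b) = sgn b := by cases b <;> simp [sgn]

lemma jwPhase_update_of_lt {n : ℕ} {a b : Fin (2 * n)} (h : mode a < mode b)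
    (x : Fin n → Bool) :
    jwPhase a (Function.update x (mode b) (!x (mode b))) = jwPhase a x := by
  unfold jwPhase
  rw [Function.update_of_ne h.ne]
  congr 1
  refine Finset.prod_congr rfl fun i _ => ?_
  split_ifs with hi
  · rw [Function.update_of_ne (hi.trans h).ne]
  · rfl

lemma jwPhase_update_of_gt {n : ℕ} {a b : Fin (2 * n)} (h : mode b < mode a)
    (x : Fin n → Bool) :
    jwPhase a (Function.update x (mode b) (!x (mode b))) = - jwPhase a x := by
  unfold jwPhase
  rw [Function.update_of_ne h.ne', ← neg_mul]
  congr 1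
  rw [← Finset.mul_prod_erase _ _ (Finset.mem_univ (mode b)),
    ← Finset.mul_prod_erase _ _ (Finset.mem_univ (mode b)), if_pos h, if_pos h,
    Function.update_self, sgn_not, neg_mul]
  congr 2
  refine Finset.prod_congr rfl fun i hi => ?_
  rw [Function.update_of_ne (Finset.ne_of_mem_erase hi)]

lemma jwPhase_update_of_eq {n : ℕ} {a b : Fin (2 * n)} (h : mode a = mode b)
    (x : Fin n → Bool) :
    jwPhase a (Function.update x (mode b) (!x (mode b))) =
      (if a.val % 2 = 0 then 1 else -1) * jwPhase a x := by
  unfold jwPhase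
  have hp : (∏ i, if i < mode a then sgn (Function.update x (mode b) (!x (mode b)) i) else 1) =
      ∏ i, if i < mode a then sgn (x i) else 1 := by
    refine Finset.prod_congr rfl fun i _ => ?_
    split_ifs with hi
    · rw [Function.update_of_ne (by rw [← h]; exact hi.ne)]
    · rfl
  rw [hp, h, Function.update_self, sgn_not]
  split_ifs <;> ring

lemma prod_sgn_mul_self {n : ℕ} (m : Fin n) (x : Fin n → Bool) :
    (∏ i, if i < m then sgn (x i) else 1) * (∏ i, if i < m then sgn (x i) else 1) = 1 := by
  rw [← Finset.prod_mul_distrib]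
  refine Finset.prod_eq_one fun i _ => ?_
  split_ifs
  · exact sgn_mul_self _
  · simp

lemma star_jwPhase {n : ℕ} (a : Fin (2 * n)) (x : Fin n → Bool) :
    (starRingEnd ℂ) (jwPhase a x) = (if a.val % 2 = 0 then 1 else -1) * jwPhase a x := by
  unfold jwPhase
  rw [map_mul, map_prod]
  have : ∀ i, (starRingEnd ℂ) (if i < mode a then sgn (x i) else 1) =
      if i < mode a then sgn (x i) else 1 := by
    intro i; split_ifs <;> simp [star_sgn]
  simp only [this]
  split_ifs <;> simp [star_sgn]

lemma jordanWigner_mul_apply {n : ℕ} (a b : Fin (2 * n)) (x z : Fin n → Bool) :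
    (jordanWigner n a * jordanWigner n b) x z =
      jwPhase a x * jordanWigner n b (Function.update x (mode a) (!x (mode a))) z := by
  rw [Matrix.mul_apply, Finset.sum_eq_single (Function.update x (mode a) (!x (mode a)))]
  · simp [jordanWigner]
  · intro y _ hy
    simp [jordanWigner, hy]
  · simp

/-- The Jordan–Wigner operators form a system of Majorana operators, so that such systems exist for
every `n`. -/
theorem isMajoranaSystem_jordanWigner (n : ℕ) : IsMajoranaSystem n (jordanWigner n) where
  isHermitian a := by
    ext x y
    simp only [Matrix.conjTranspose_apply, jordanWigner, Matrix.of_apply]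
    by_cases h : y = Function.update x (mode a) (!x (mode a))
    · subst h
      simp only [Function.update_self, Bool.not_not, Function.update_idem,
        Function.update_eq_self, if_true]
      rw [← starRingEnd_apply, star_jwPhase, jwPhase_update_of_eq rfl, ← mul_assoc]
      split_ifs <;> simp
    · have h' : ¬ x = Function.update y (mode a) (!y (mode a)) := by
        rintro h'
        apply h
        rw [h']
        simp
      simp [h, h']
  anticomm a b := by
    ext x z
    rw [Matrix.add_apply, jordanWigner_mul_apply, jordanWigner_mul_apply]
    simp only [jordanWigner, Matrix.of_apply]
    rcases lt_trichotomy (mode a) (mode b) with h | h | h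
    · have hne : a ≠ b := by rintro rfl; exact lt_irrefl _ h
      rw [Function.update_of_ne h.ne', Function.update_of_ne h.ne,
        Function.update_comm h.ne, jwPhase_update_of_gt h, jwPhase_update_of_lt h, if_neg hne]
      split_ifs
      · rw [Matrix.zero_apply]; ring
      · simp
    · rw [h]
      rw [Function.update_self, Function.update_idem, Bool.not_not, Function.update_eq_self]
      have e1 := jwPhase_update_of_eq h x
      have e2 := jwPhase_update_of_eq (a := b) rfl x
      rw [e1, e2]
      have hm : a.val / 2 = b.val / 2 := congrArg Fin.val h
      by_cases hz : z = x
      · subst hz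
        have hp := prod_sgn_mul_self (mode b) z
        have hs := sgn_mul_self (z (mode b))
        by_cases hab : a = b
        · subst hab
          simp only [if_true, jwPhase]
          rw [show (2 : FockMatrix n) z z = 2 by
            rw [show (2 : FockMatrix n) = (1 : FockMatrix n) + 1 by norm_num]
            rw [Matrix.add_apply, Matrix.one_apply_eq]; norm_num]
          split_ifs
          · linear_combination 2 * hp
          · linear_combination (2 * hp) +
              2 * (∏ i, if i < mode a then sgn (z i) else 1) *
                (∏ i, if i < mode a then sgn (z i) else 1) * (hs - (sgn (z (mode a)) ^ 2) *
                  Complex.I_sq)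
        · have hpar : (a.val % 2 = 0 ∧ ¬ b.val % 2 = 0) ∨ (¬ a.val % 2 = 0 ∧ b.val % 2 = 0) := by
            have : a.val ≠ b.val := fun h => hab (Fin.ext h)
            omega
          rcases hpar with ⟨h1, h2⟩ | ⟨h1, h2⟩
          · simp [hab, h1, h2]; ring
          · simp [hab, h1, h2]; ring
      · have hz' : (if a = b then (2 : FockMatrix n) else 0) x z = 0 := by
          split_ifs
          · rw [show (2 : FockMatrix n) = (1 : FockMatrix n) + 1 by norm_num,
              Matrix.add_apply, Matrix.one_apply_ne (Ne.symm hz)]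
            simp
          · rfl
        simp [hz, hz']
    · have hne : a ≠ b := by rintro rfl; exact lt_irrefl _ h
      rw [Function.update_of_ne h.ne', Function.update_of_ne h.ne,
        Function.update_comm h.ne, jwPhase_update_of_gt h, jwPhase_update_of_lt h, if_neg hne]
      split_ifs
      · rw [Matrix.zero_apply]; ring
      · simp

end SparseSYK

open SparseSYK

/-! The proof compares two sums of absolute couplings. Every `C_I` is Hermitian with square `1`, so
`λ_max(H)` is at most the sum of `|h_I|` over the present interactions (`lambdaMax_le`). Conversely,
the algorithm greedily picks pairwise disjoint present interactions and builds a Gaussian state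
whose energy is at least the sum of `|h_I|` over the picked ones (`exists_gaussianState_output`). It
remains to show that, before the common normalization, the total is below `x = 5nk/4` and the picked
part above `x / D`, where `D = 1236 + 2752k + 1536k²`.

Energy. For the Gaussian state of a weighted partial matching, Wick's formula
(`trace_matchingState_four`) makes the energy `E(Γ) = ∑ h_I Pf_I(Γ)`, a quadratic form in the
correlation matrix. A picked `{i < a < b < c}` contributes a matrix `Δ` with the edges `ia` of
weight `1` and `bc` of weight `sign h_I`, and `E(Δ) = |h_I|` (`energy_two_edges`). By the
parallelogram law (`energy_add_add_energy_sub`) one of `Γ ± Δ` has energy at least `E(Γ) + |h_I|`,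
whatever the other interactions contribute. Trying both signs is a deterministic step. As all matrix
entries are `0` or `±1`, energies are computed with additions, subtractions and comparisons only.

Probability. When no coupling vanishes, which is almost sure, the picked set depends only on the set
of present interactions, so a Chernoff bound with `φ = E exp(-2|J|) ≤ 7/10` reduces the lower tail
to `E φ^N`, where `N` counts the picked items. Candidates have their first vertex among the first `m
= ⌈n/8⌉` and the other three outside, so they split into `m` blocks by first vertex, each yielding
at most one pick. When a block is reached, at most `3(m-1)` of the outside vertices are used, hence
at least `binom(w,3) ≥ binom(2n-1,3)/4` of its items are still available, and it yields nothing with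
probability at most `exp(-k/4)`. Multiplying over blocks gives `greedyVal_quads_le`. The total is
controlled by a Chernoff bound with `E exp|J| ≤ 33/10`. -/

namespace SparseSYK

/-! ### Greedy selection of disjoint items -/

section Greedy

variable {α : Type*}

open Classical in
/-- Go through a list of items and pick those that satisfy `sel` and are disjoint from `U` and from
the items picked before. -/
noncomputable def greedy (verts : α → Finset ℕ) (sel : α → Prop) : List α → Finset ℕ → List α
  | [], _ => []
  | q :: L, U =>
    if sel q ∧ Disjoint (verts q) U then q :: greedy verts sel L (U ∪ verts q)
    else greedy verts sel L U

/-- The vertices covered by a list of items. -/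
def cover (verts : α → Finset ℕ) (L : List α) : Finset ℕ := L.foldr (fun q U => verts q ∪ U) ∅

@[simp] lemma cover_nil (verts : α → Finset ℕ) : cover verts [] = ∅ := rfl

@[simp] lemma cover_cons (verts : α → Finset ℕ) (q : α) (L : List α) :
    cover verts (q :: L) = verts q ∪ cover verts L := rfl

lemma cover_append (verts : α → Finset ℕ) (L L' : List α) :
    cover verts (L ++ L') = cover verts L ∪ cover verts L' := by
  induction L with
  | nil => simp
  | cons q L ih => simp [ih, Finset.union_assoc]

open Classical in
-- The recursion consumes the list from its head, while the program remembers only what it has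
-- picked so far. This is the online form of the selection, as the loop invariant needs it.
lemma greedy_append_singleton (verts : α → Finset ℕ) (sel : α → Prop) (L : List α) (q : α)
    (U : Finset ℕ) :
    greedy verts sel (L ++ [q]) U = greedy verts sel L U ++
      if sel q ∧ Disjoint (verts q) (U ∪ cover verts (greedy verts sel L U)) then [q] else [] := by
  induction L generalizing U with
  | nil => simp [greedy]
  | cons r L ih =>
    by_cases h : sel r ∧ Disjoint (verts r) U
    · simp only [List.cons_append, greedy, if_pos h, ih, cover_cons, Finset.union_assoc]
    · simp only [List.cons_append, greedy, if_neg h, ih]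

lemma mem_of_mem_greedy {verts : α → Finset ℕ} {sel : α → Prop} {L : List α} {U : Finset ℕ} {q : α}
    (h : q ∈ greedy verts sel L U) : sel q ∧ q ∈ L ∧ Disjoint (verts q) U := by
  induction L generalizing U with
  | nil => simp [greedy] at h
  | cons r L ih =>
    by_cases hr : sel r ∧ Disjoint (verts r) U
    · simp only [greedy, if_pos hr, List.mem_cons] at h
      rcases h with rfl | h
      · exact ⟨hr.1, by simp, hr.2⟩
      · obtain ⟨h1, h2, h3⟩ := ih h
        exact ⟨h1, by simp [h2], Finset.disjoint_of_subset_right Finset.subset_union_left h3⟩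
    · simp only [greedy, if_neg hr] at h
      obtain ⟨h1, h2, h3⟩ := ih h
      exact ⟨h1, by simp [h2], h3⟩

lemma nodup_greedy {verts : α → Finset ℕ} (hv : ∀ q, (verts q).Nonempty) (sel : α → Prop)
    (L : List α) (U : Finset ℕ) : (greedy verts sel L U).Nodup := by
  induction L generalizing U with
  | nil => simp [greedy]
  | cons r L ih =>
    by_cases hr : sel r ∧ Disjoint (verts r) U
    · simp only [greedy, if_pos hr, List.nodup_cons]
      refine ⟨fun h => ?_, ih _⟩
      have h3 := (mem_of_mem_greedy h).2.2
      obtain ⟨v, hv⟩ := hv r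
      exact Finset.disjoint_left.1 h3 hv (Finset.mem_union_right _ hv)
    · simpa only [greedy, if_neg hr] using ih _

open Classical in
lemma greedy_congr {verts : α → Finset ℕ} {sel sel' : α → Prop} {L : List α} (U : Finset ℕ)
    (h : ∀ q ∈ L, sel q ↔ sel' q) : greedy verts sel L U = greedy verts sel' L U := by
  induction L generalizing U with
  | nil => rfl
  | cons r L ih =>
    have hr := h r (by simp)
    rw [greedy, greedy, ih _ fun q hq => h q (by simp [hq]), ih _ fun q hq => h q (by simp [hq])]
    exact if_congr (and_congr_left' hr) rfl rfl

open Classical in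
-- Separates the deterministic restriction to candidates from the random presence, so that
-- expectations only involve the list of candidates.
lemma greedy_and (verts : α → Finset ℕ) (cand sel : α → Prop) (L : List α) (U : Finset ℕ) :
    greedy verts (fun q => cand q ∧ sel q) L U =
      greedy verts sel (L.filter (fun q => cand q)) U := by
  induction L generalizing U with
  | nil => rfl
  | cons r L ih =>
    by_cases hr : cand r
    · simp only [greedy, hr, true_and, ih, decide_true, List.filter_cons_of_pos]
    · simp only [greedy, hr, false_and, if_false, ih, decide_false, Bool.false_eq_true,
        not_false_eq_true, List.filter_cons_of_neg]

end Greedy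

/-! ### Random subsets -/

section RandomSubset

variable {α : Type*}

/-- The expectation of `F A` for a random subset `A` of `s` that contains every element
independently with probability `p`. -/
def subsetExp (p : ℝ) (s : Finset α) (F : Finset α → ℝ) : ℝ :=
  ∑ A ∈ s.powerset, p ^ A.card * (1 - p) ^ (s.card - A.card) * F A

lemma subsetExp_empty (p : ℝ) (F : Finset α → ℝ) : subsetExp p ∅ F = F ∅ := by
  simp [subsetExp]

lemma subsetExp_congr (p : ℝ) {s : Finset α} {F G : Finset α → ℝ} (h : ∀ A ⊆ s, F A = G A) :
    subsetExp p s F = subsetExp p s G :=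
  Finset.sum_congr rfl fun A hA => by rw [h A (Finset.mem_powerset.1 hA)]

lemma subsetExp_pow_card (p x : ℝ) (s : Finset α) :
    subsetExp p s (fun A => x ^ A.card) = (p * x + (1 - p)) ^ s.card := by
  rw [← Finset.sum_pow_mul_eq_add_pow]
  refine Finset.sum_congr rfl fun A _ => ?_
  rw [mul_pow]; ring

variable [DecidableEq α]

lemma subsetExp_insert (p : ℝ) {a : α} {s : Finset α} (ha : a ∉ s) (F : Finset α → ℝ) :
    subsetExp p (insert a s) F =
      (1 - p) * subsetExp p s F + p * subsetExp p s fun A => F (insert a A) := by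
  unfold subsetExp
  rw [Finset.sum_powerset_insert ha, Finset.mul_sum, Finset.mul_sum]
  congr 1
  · refine Finset.sum_congr rfl fun A hA => ?_
    have hc := Finset.card_le_card (Finset.mem_powerset.1 hA)
    rw [Finset.card_insert_of_notMem ha, Nat.succ_sub hc, pow_succ]
    ring
  · refine Finset.sum_congr rfl fun A hA => ?_
    have haA : a ∉ A := fun h => ha (Finset.mem_powerset.1 hA h)
    rw [Finset.card_insert_of_notMem ha, Finset.card_insert_of_notMem haA, Nat.add_sub_add_right,
      pow_succ]
    ring

/-- An element that does not influence `F` contributes the factor `(1 - p) + p = 1`, so such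
elements can be removed one at a time. -/
lemma subsetExp_mono_set (p : ℝ) {s t : Finset α} (hst : s ⊆ t) {F : Finset α → ℝ}
    (h : ∀ a ∉ s, ∀ A, F (insert a A) = F A) : subsetExp p t F = subsetExp p s F := by
  have key : ∀ r : Finset α, Disjoint r s → subsetExp p (r ∪ s) F = subsetExp p s F := by
    intro r
    induction r using Finset.induction_on with
    | empty => simp
    | insert a r ha ih =>
      intro hr
      rw [Finset.disjoint_insert_left] at hr
      rw [Finset.insert_union, subsetExp_insert p (by simp [ha, hr.1]), ih hr.2]
      simp only [h a hr.1, ih hr.2]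
      ring
  rw [← key (t \ s) Finset.sdiff_disjoint, Finset.sdiff_union_of_subset hst]

lemma subsetExp_image {β : Type*} [DecidableEq β] (p : ℝ) (s : Finset α) {f : α → β}
    (hf : Function.Injective f) (F : Finset β → ℝ) :
    subsetExp p (s.image f) F = subsetExp p s fun A => F (A.image f) := by
  induction s using Finset.induction_on generalizing F with
  | empty => simp [subsetExp_empty]
  | insert a s ha ih =>
    rw [Finset.image_insert, subsetExp_insert p (by simpa [hf.eq_iff] using ha), ih, ih,
      subsetExp_insert p ha]
    simp only [Finset.image_insert]

end RandomSubset

/-! ### The number of items picked from a random subset -/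

section GreedyVal

variable {α : Type*}

/-- The expectation of `φ ^ N` for the number `N` of items of `L` that the greedy selection picks
if every item is present independently with probability `p`. -/
noncomputable def greedyVal (verts : α → Finset ℕ) (p φ : ℝ) : List α → Finset ℕ → ℝ
  | [], _ => 1
  | q :: L, U =>
    if Disjoint (verts q) U then
      (1 - p) * greedyVal verts p φ L U + p * φ * greedyVal verts p φ L (U ∪ verts q)
    else greedyVal verts p φ L U

/-- Items are exposed in the order of the list: the presence of the next one is independent of all
later ones, and the past matters only through the used vertices `U`. The expectation thus becomes a
recursion and no conditioning is needed. -/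
lemma subsetExp_greedy [DecidableEq α] (verts : α → Finset ℕ) (p φ : ℝ) {L : List α}
    (hL : L.Nodup) (U : Finset ℕ) :
    subsetExp p L.toFinset (fun A => φ ^ (greedy verts (· ∈ A) L U).length) =
      greedyVal verts p φ L U := by
  induction L generalizing U with
  | nil => simp [subsetExp_empty, greedy, greedyVal]
  | cons q L ih =>
    rw [List.nodup_cons] at hL
    have hq : q ∉ L.toFinset := by simpa using hL.1
    rw [List.toFinset_cons, subsetExp_insert p hq]
    have hne : ∀ r ∈ L, r ≠ q := by rintro r hr rfl; exact hL.1 hr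
    have hins : ∀ (A : Finset α) (V : Finset ℕ), greedy verts (· ∈ insert q A) L V = greedy verts (· ∈ A) L V :=
      fun A V => greedy_congr V fun r hr => by
        simp [hne r hr]
    have h0 : subsetExp p L.toFinset
        (fun A => φ ^ (greedy verts (· ∈ A) (q :: L) U).length) = greedyVal verts p φ L U := by
      rw [← ih hL.2]
      refine subsetExp_congr p fun A hA => ?_
      have : q ∉ A := fun h => hq (hA h)
      simp [greedy, this]
    rw [h0]
    by_cases hd : Disjoint (verts q) U
    · have h1 : subsetExp p L.toFinset
          (fun A => φ ^ (greedy verts (· ∈ insert q A) (q :: L) U).length) =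
            φ * greedyVal verts p φ L (U ∪ verts q) := by
        rw [← ih hL.2, subsetExp, subsetExp, Finset.mul_sum]
        refine Finset.sum_congr rfl fun A _ => ?_
        rw [greedy, if_pos ⟨Finset.mem_insert_self q A, hd⟩, List.length_cons, hins, pow_succ]
        ring
      rw [h1, greedyVal, if_pos hd]
      ring
    · have h1 : subsetExp p L.toFinset
          (fun A => φ ^ (greedy verts (· ∈ insert q A) (q :: L) U).length) =
            greedyVal verts p φ L U := by
        rw [← ih hL.2]
        refine subsetExp_congr p fun A _ => ?_
        rw [greedy, if_neg fun h => hd h.2, hins]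
      rw [h1, greedyVal, if_neg hd]
      ring

variable {verts : α → Finset ℕ} {p φ : ℝ}

lemma greedyVal_le_one (hp : 0 ≤ p) (hp1 : p ≤ 1) (hφ : 0 ≤ φ) (hφ1 : φ ≤ 1) (L : List α)
    (U : Finset ℕ) : greedyVal verts p φ L U ≤ 1 := by
  induction L generalizing U with
  | nil => simp [greedyVal]
  | cons q L ih =>
    rw [greedyVal]
    split_ifs
    · have h1 := mul_le_mul_of_nonneg_left (ih U) (sub_nonneg.2 hp1)
      have h2 := mul_le_mul_of_nonneg_left (ih (U ∪ verts q)) (mul_nonneg hp hφ)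
      nlinarith
    · exact ih U

lemma greedyVal_append_of_not_disjoint {B R : List α} {U : Finset ℕ}
    (h : ∀ q ∈ B, ¬ Disjoint (verts q) U) :
    greedyVal verts p φ (B ++ R) U = greedyVal verts p φ R U := by
  induction B with
  | nil => rfl
  | cons q B ih =>
    rw [List.cons_append, greedyVal, if_neg (h q (by simp)), ih fun r hr => h r (by simp [hr])]

/-- At most one item can be picked among items that have a vertex in common. -/
lemma greedyVal_block_le (hp : 0 ≤ p) (hp1 : p ≤ 1) (hφ : 0 ≤ φ)
    {i : ℕ} {B R : List α} {U : Finset ℕ} {C : ℝ} (hB : ∀ q ∈ B, i ∈ verts q)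
    (h0 : greedyVal verts p φ R U ≤ C)
    (h1 : ∀ q ∈ B, Disjoint (verts q) U → greedyVal verts p φ R (U ∪ verts q) ≤ C) :
    greedyVal verts p φ (B ++ R) U ≤
      (φ + (1 - φ) * (1 - p) ^ (B.filter (fun q => Disjoint (verts q) U)).length) * C := by
  induction B with
  | nil => simpa using h0
  | cons q B ih =>
    have ih' := ih (fun r hr => hB r (by simp [hr])) fun r hr => h1 r (by simp [hr])
    by_cases hd : Disjoint (verts q) U
    · rw [List.cons_append, greedyVal, if_pos hd, List.filter_cons_of_pos (by simpa using hd),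
        List.length_cons,
        greedyVal_append_of_not_disjoint (U := U ∪ verts q)]
      · have a1 := mul_le_mul_of_nonneg_left ih' (sub_nonneg.2 hp1)
        have a2 := mul_le_mul_of_nonneg_left (h1 q (by simp) hd) (mul_nonneg hp hφ)
        refine (add_le_add a1 a2).trans (le_of_eq ?_)
        rw [pow_succ]; ring
      · intro r hr
        exact Finset.not_disjoint_iff.2 ⟨i, hB r (by simp [hr]),
          Finset.mem_union_right _ (hB q (by simp))⟩
    · rw [List.cons_append, greedyVal, if_neg hd, List.filter_cons_of_neg (by simpa using hd)]
      exact ih'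

end GreedyVal

/-! ### Quadruples of vertices -/

abbrev Quad : Type := ℕ × ℕ × ℕ × ℕ

/-- The vertices of a quadruple. -/
def quadVerts (q : Quad) : Finset ℕ := {q.1, q.2.1, q.2.2.1, q.2.2.2}

lemma quadVerts_nonempty (q : Quad) : (quadVerts q).Nonempty := ⟨q.1, by simp [quadVerts]⟩

/-- The quadruples with first entry `i`, in lexicographic order. -/
def quadsFrom (n i : ℕ) : List Quad :=
  (List.range (2 * n)).flatMap fun a => (List.range (2 * n)).flatMap fun b =>
    (List.range (2 * n)).flatMap fun c => [(i, a, b, c)]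

/-- All quadruples, in lexicographic order. -/
def quads (n : ℕ) : List Quad := (List.range (2 * n)).flatMap (quadsFrom n)

/-- The quadruples considered by the algorithm: the first vertex is taken from the first sixteenth
of all vertices, and the others are not. -/
def IsCandidate (n : ℕ) (q : Quad) : Prop :=
  8 * q.1 < n ∧ n ≤ 8 * q.2.1 ∧ q.2.1 < q.2.2.1 ∧ q.2.2.1 < q.2.2.2 ∧ q.2.2.2 < 2 * n

lemma mem_quadsFrom {n i : ℕ} {q : Quad} : q ∈ quadsFrom n i ↔
    q.1 = i ∧ q.2.1 < 2 * n ∧ q.2.2.1 < 2 * n ∧ q.2.2.2 < 2 * n := by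
  obtain ⟨x, a, b, c⟩ := q
  simp only [quadsFrom, List.mem_flatMap, List.mem_range, List.mem_singleton, Prod.mk.injEq]
  constructor
  · rintro ⟨a', ha, b', hb, c', hc, rfl, rfl, rfl, rfl⟩
    exact ⟨rfl, ha, hb, hc⟩
  · rintro ⟨rfl, ha, hb, hc⟩
    exact ⟨a, ha, b, hb, c, hc, rfl, rfl, rfl, rfl⟩

lemma nodup_quads (n : ℕ) : (quads n).Nodup := by
  have key : ∀ {β : Type} (f : ℕ → List β) (g : β → ℕ) (N : ℕ), (∀ i, (f i).Nodup) →
      (∀ i, ∀ x ∈ f i, g x = i) → ((List.range N).flatMap f).Nodup := by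
    intro β f g N h1 h2
    rw [List.nodup_flatMap]
    refine ⟨fun i _ => h1 i, List.nodup_range.imp fun {i j} hij => ?_⟩
    intro x hx hx'
    exact hij ((h2 i x hx).symm.trans (h2 j x hx'))
  refine key _ (fun q => q.1) _ (fun i => ?_) fun i q hq => (mem_quadsFrom.1 hq).1
  refine key _ (fun q => q.2.1) _ (fun a => ?_) fun a q hq => ?_
  · refine key _ (fun q => q.2.2.1) _ (fun b => ?_) fun b q hq => ?_
    · refine key _ (fun q => q.2.2.2) _ (fun c => by simp) fun c q hq => ?_
      simp only [List.mem_singleton] at hq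
      rw [hq]
    · simp only [List.mem_flatMap, List.mem_singleton] at hq
      obtain ⟨_, _, rfl⟩ := hq
      rfl
  · simp only [List.mem_flatMap, List.mem_singleton] at hq
    obtain ⟨_, _, _, _, rfl⟩ := hq
    rfl

open Classical in
-- Any three unused vertices `v` with `n ≤ 8 v`, put in increasing order, complete `i` to an
-- available candidate. The number `(n + 7) / 8` counts the excluded vertices with `8 v < n`.
lemma choose_le_length_filter {n i w : ℕ} {U : Finset ℕ} (hi : 8 * i < n) (hiU : i ∉ U)
    (hU : w + ((n + 7) / 8 + (U.filter fun v => n ≤ 8 * v).card) ≤ 2 * n) :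
    w.choose 3 ≤ ((((quadsFrom n i).filter fun q => IsCandidate n q)).filter
      (fun q => Disjoint (quadVerts q) U)).length := by
  set W := (Finset.range (2 * n)).filter fun v => n ≤ 8 * v ∧ v ∉ U with hW
  have hWcard : w ≤ W.card := by
    have h1 : Finset.range (2 * n) ⊆
        W ∪ (Finset.range ((n + 7) / 8) ∪ U.filter fun v => n ≤ 8 * v) := by
      intro v hv
      simp only [hW, Finset.mem_union, Finset.mem_filter, Finset.mem_range] at hv ⊢
      by_cases hvU : v ∈ U <;> by_cases hvn : n ≤ 8 * v <;> simp [hvU, hvn, hv] <;> omega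
    have h2 := (Finset.card_le_card h1).trans ((Finset.card_union_le _ _).trans
      (Nat.add_le_add_left (Finset.card_union_le _ _) _))
    simp only [Finset.card_range] at h2
    omega
  refine (Nat.choose_le_choose 3 hWcard).trans ?_
  rw [← Finset.card_powersetCard]
  set l := ((quadsFrom n i).filter fun q => IsCandidate n q).filter
    (fun q => Disjoint (quadVerts q) U)
  refine le_trans (Finset.card_le_card (t := l.toFinset.image
    fun q : Quad => ({q.2.1, q.2.2.1, q.2.2.2} : Finset ℕ)) ?_)
    (Finset.card_image_le.trans (List.toFinset_card_le l))
  intro s hs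
  rw [Finset.mem_powersetCard] at hs
  obtain ⟨hsW, hs3⟩ := hs
  set e := s.orderEmbOfFin hs3
  have hlt : e 0 < e 1 ∧ e 1 < e 2 := ⟨e.strictMono (by decide), e.strictMono (by decide)⟩
  have hmem : ∀ j, e j ∈ W := fun j => hsW (Finset.orderEmbOfFin_mem s hs3 j)
  have hsq : s = {e 0, e 1, e 2} := by
    have : (s : Set ℕ) = Set.range e := (Finset.range_orderEmbOfFin s hs3).symm
    ext x
    rw [← Finset.mem_coe, this]
    simp only [Set.mem_range, Fin.exists_fin_succ, Finset.mem_insert, Finset.mem_singleton]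
    simp [eq_comm]
  rw [Finset.mem_image]
  refine ⟨(i, e 0, e 1, e 2), ?_, hsq.symm⟩
  have h0 := hmem 0
  have h1 := hmem 1
  have h2 := hmem 2
  simp only [hW, Finset.mem_filter, Finset.mem_range] at h0 h1 h2
  simp only [l, List.mem_toFinset, List.mem_filter, decide_eq_true_eq, mem_quadsFrom]
  refine ⟨⟨⟨trivial, h0.1, h1.1, h2.1⟩, hi, h0.2.1, hlt.1, hlt.2, h2.1⟩, ?_⟩
  simp [quadVerts, hiU, h0.2.2, h1.2.2, h2.2.2]

open Classical in
/-- The greedy selection of candidates from a random set of quadruples picks many of them. -/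
lemma greedyVal_quads_le {p φ : ℝ} (hp : 0 ≤ p) (hp1 : p ≤ 1) (hφ : 0 ≤ φ) (hφ1 : φ ≤ 1)
    {n m w : ℕ} (hm : m = (n + 7) / 8) (hw : w + 4 * m ≤ 2 * n + 3) :
    greedyVal quadVerts p φ ((quads n).filter fun q => IsCandidate n q) ∅ ≤
      (φ + (1 - φ) * (1 - p) ^ w.choose 3) ^ m := by
  set f : ℕ → List Quad := fun i => (quadsFrom n i).filter fun q => IsCandidate n q with hf
  set r := φ + (1 - φ) * (1 - p) ^ w.choose 3 with hr
  have h1p : 0 ≤ 1 - p := by linarith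
  have h1φ : 0 ≤ 1 - φ := by linarith
  have hr0 : 0 ≤ r := by positivity
  -- Induction on the number `j` of blocks still to come, the next one having first vertex `m - j`.
  -- Used small vertices belong to earlier blocks, and each earlier block used at most three large
  -- ones. The tail `R` is bounded trivially by `1`.
  have key : ∀ (R : List Quad) (j : ℕ), j ≤ m → ∀ U : Finset ℕ,
      (∀ v ∈ U, 8 * v < n → v < m - j) → (U.filter fun v => n ≤ 8 * v).card ≤ 3 * (m - j) →
      greedyVal quadVerts p φ ((List.range' (m - j) j).flatMap f ++ R) U ≤ r ^ j := by
    intro R j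
    induction j with
    | zero =>
      intro _ U _ _
      simpa using greedyVal_le_one hp hp1 hφ hφ1 R U
    | succ j ih =>
      intro hj U hU1 hU2
      have hi : 8 * (m - (j + 1)) < n := by omega
      rw [List.range'_succ, List.flatMap_cons, List.append_assoc,
        show m - (j + 1) + 1 = m - j by omega]
      refine (greedyVal_block_le hp hp1 hφ (i := m - (j + 1)) (C := r ^ j) ?_ ?_ ?_).trans ?_
      · intro q hq
        simp only [hf, List.mem_filter, mem_quadsFrom] at hq
        simp [quadVerts, hq.1.1]
      · exact ih (by omega) U (fun v hv h => (hU1 v hv h).trans_le (by omega)) (by omega)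
      · intro q hq _
        simp only [hf, List.mem_filter, mem_quadsFrom, decide_eq_true_eq] at hq
        obtain ⟨⟨hq0, -⟩, hq1, hq2, hq3, hq4, hq5⟩ := hq
        refine ih (by omega) _ ?_ ?_
        · intro v hv hvn
          rcases Finset.mem_union.1 hv with hv | hv
          · exact (hU1 v hv hvn).trans_le (by omega)
          · simp only [quadVerts, Finset.mem_insert, Finset.mem_singleton] at hv
            omega
        · have hsub : ((U ∪ quadVerts q).filter fun v => n ≤ 8 * v) ⊆
              (U.filter fun v => n ≤ 8 * v) ∪ {q.2.1, q.2.2.1, q.2.2.2} := by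
            intro v hv
            simp only [quadVerts, Finset.mem_filter, Finset.mem_union, Finset.mem_insert,
              Finset.mem_singleton] at hv ⊢
            obtain ⟨h1 | h1, h2⟩ := hv
            · exact Or.inl ⟨h1, h2⟩
            · omega
          have h3 : ({q.2.1, q.2.2.1, q.2.2.2} : Finset ℕ).card ≤ 3 := Finset.card_le_three
          have := (Finset.card_le_card hsub).trans (Finset.card_union_le _ _)
          omega
      · rw [pow_succ', hr]
        refine mul_le_mul_of_nonneg_right ?_ (by positivity)
        refine add_le_add_right (mul_le_mul_of_nonneg_left ?_ h1φ) φ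
        refine pow_le_pow_of_le_one h1p (by linarith) ?_
        -- At most `3 (m - 1)` large vertices are used here; with the `m` small ones this excludes
        -- `4 m - 3` vertices, which explains the `+ 3` in `hw`.
        refine choose_le_length_filter hi (fun h => ?_) (by omega)
        exact lt_irrefl _ (hU1 _ h hi)
  have hsplit : (quads n).filter (fun q => IsCandidate n q) =
      (List.range' 0 m).flatMap f ++ (List.range' m (2 * n - m)).flatMap f := by
    rw [quads, List.filter_flatMap, ← List.flatMap_append, List.range_eq_range',
      show 2 * n = m + (2 * n - m) by omega, ← List.range'_append_1]
    simp [hf]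
  rw [hsplit]
  have := key ((List.range' m (2 * n - m)).flatMap f) m le_rfl ∅ (by simp) (by simp)
  simpa using this

/-! ### Sums of absolute values of Gaussian variables -/

noncomputable section

/-- The moment generating function of `|J|` for a standard Gaussian `J`. -/
def absMgf (t : ℝ) : ℝ := mgf (fun x : ℝ => |x|) (gaussianReal 0 1) t

lemma integrable_exp_abs_gaussianReal (t : ℝ) :
    Integrable (fun x : ℝ => Real.exp (t * |x|)) (gaussianReal 0 1) :=
  integrable_exp_mul_abs (integrable_exp_mul_gaussianReal t) (integrable_exp_mul_gaussianReal (-t))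

/-- From `exp |x| ≤ exp x + exp (-x)` one gets the bound `2 √e`. -/
lemma absMgf_one_le : absMgf 1 ≤ 33 / 10 := by
  have h1 : absMgf 1 ≤ ∫ x, (Real.exp (1 * x) + Real.exp (-1 * x)) ∂gaussianReal 0 1 := by
    refine integral_mono (integrable_exp_abs_gaussianReal 1)
      ((integrable_exp_mul_gaussianReal 1).add (integrable_exp_mul_gaussianReal (-1))) fun x => ?_
    rcases abs_cases x with ⟨h, _⟩ | ⟨h, _⟩
    · simp only [h]
      linarith [Real.exp_pos (-1 * x)]
    · simp only [h, mul_neg, neg_mul]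
      linarith [Real.exp_pos (1 * x)]
  rw [integral_add (integrable_exp_mul_gaussianReal 1) (integrable_exp_mul_gaussianReal (-1))] at h1
  have h2 : ∀ t : ℝ, ∫ x, Real.exp (t * x) ∂gaussianReal 0 1 = Real.exp (t ^ 2 / 2) := by
    intro t
    have := congrFun (mgf_id_gaussianReal (μ := 0) (v := 1)) t
    simpa [mgf] using this
  rw [h2, h2] at h1
  have h3 : Real.exp (1 / 2) ≤ 33 / 20 := by
    have h4 : Real.exp (1 / 2) ^ 2 = Real.exp 1 := by rw [← Real.exp_nat_mul]; norm_num
    have h5 := Real.exp_one_lt_d9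
    nlinarith [Real.exp_pos (1 / 2 : ℝ)]
  norm_num at h1 h3 ⊢
  linarith

/-- The density is at most `1 / √(2π) ≤ 1/2` and the interval has length `1`. -/
lemma gaussianReal_Icc_le : (gaussianReal 0 1).real (Set.Icc (-(1 / 2)) (1 / 2)) ≤ 1 / 2 := by
  rw [Measure.real, gaussianReal_apply_eq_integral _ one_ne_zero,
    ENNReal.toReal_ofReal (integral_nonneg fun x => gaussianPDFReal_nonneg _ _ _)]
  have h1 : ∀ x, gaussianPDFReal 0 1 x ≤ 1 / 2 := by
    intro x
    rw [gaussianPDFReal]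
    have h2 : Real.exp (-(x - 0) ^ 2 / (2 * ((1 : NNReal) : ℝ))) ≤ 1 := by
      rw [Real.exp_le_one_iff]
      exact div_nonpos_of_nonpos_of_nonneg (neg_nonpos.2 (sq_nonneg _)) (by positivity)
    have h3 : (√(2 * Real.pi * ((1 : NNReal) : ℝ)))⁻¹ ≤ 1 / 2 := by
      rw [inv_le_comm₀ (by positivity) (by norm_num)]
      refine Real.le_sqrt_of_sq_le ?_
      have := Real.pi_gt_three
      norm_num
      linarith
    calc _ ≤ (1 / 2 : ℝ) * 1 := by gcongr
      _ = 1 / 2 := by norm_num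
  calc ∫ x in Set.Icc (-(1 / 2)) (1 / 2), gaussianPDFReal 0 1 x
      ≤ ∫ x in Set.Icc (-(1 / 2) : ℝ) (1 / 2), (1 / 2 : ℝ) :=
        integral_mono (integrable_gaussianPDFReal 0 1).integrableOn (by simp) h1
    _ = 1 / 2 := by simp; norm_num

/-- Bound `exp (-2|x|)` by `1` for `|x| ≤ 1/2` and by `exp (-1) ≤ 2/5` elsewhere; this gives `2/5 +
(3/5)(1/2)`. -/
lemma absMgf_neg_two_le : absMgf (-2) ≤ 7 / 10 := by
  have he : Real.exp (-1) ≤ 2 / 5 := by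
    have := Real.exp_one_gt_d9
    rw [Real.exp_neg, inv_le_comm₀ (Real.exp_pos _) (by norm_num)]
    linarith
  have hS : MeasurableSet (Set.Icc (-(1 / 2)) (1 / 2) : Set ℝ) := measurableSet_Icc
  have h1 : absMgf (-2) ≤ ∫ x, (2 / 5 + (Set.Icc (-(1 / 2)) (1 / 2)).indicator
      (fun _ => (3 / 5 : ℝ)) x) ∂gaussianReal 0 1 := by
    refine integral_mono (integrable_exp_abs_gaussianReal (-2))
      ((integrable_const _).add ((integrable_const _).indicator hS)) fun x => ?_
    by_cases hx : x ∈ Set.Icc (-(1 / 2) : ℝ) (1 / 2)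
    · simp only [Set.indicator_of_mem hx]
      have : Real.exp (-2 * |x|) ≤ 1 := Real.exp_le_one_iff.2 (by linarith [abs_nonneg x])
      linarith
    · simp only [Set.indicator_of_notMem hx]
      have : 1 / 2 < |x| := by
        by_contra h
        exact hx (abs_le.1 (not_lt.1 h))
      have : Real.exp (-2 * |x|) ≤ Real.exp (-1) := Real.exp_le_exp.2 (by linarith)
      linarith
  rw [integral_add (integrable_const _) ((integrable_const _).indicator hS),
    integral_indicator_const _ hS] at h1
  have := gaussianReal_Icc_le
  simp only [integral_const, probReal_univ, smul_eq_mul] at h1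
  linarith

lemma absMgf_nonneg (t : ℝ) : 0 ≤ absMgf t := mgf_nonneg

variable {ι : Type*} [Fintype ι]

lemma mgf_sum_abs_gaussianReal (A : Finset ι) (t : ℝ) :
    mgf (fun J : ι → ℝ => ∑ I ∈ A, |J I|) (Measure.pi fun _ => gaussianReal 0 1) t =
      absMgf t ^ A.card := by
  have hind : iIndepFun (fun (I : ι) (J : ι → ℝ) => |J I|)
      (Measure.pi fun _ => gaussianReal 0 1) :=
    iIndepFun_pi (X := fun _ x => |x|) fun _ => (continuous_abs.measurable).aemeasurable
  have h1 := hind.mgf_sum (t := t) (fun I => by fun_prop) A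
  have h2 : ∀ I : ι, mgf (fun J : ι → ℝ => |J I|) (Measure.pi fun _ => gaussianReal 0 1) t =
      absMgf t := by
    intro I
    have hmp := measurePreserving_eval (fun _ : ι => gaussianReal 0 1) I
    rw [absMgf, mgf, mgf]
    nth_rw 2 [← hmp.map_eq]
    rw [integral_map hmp.measurable.aemeasurable (by fun_prop)]
  rw [Finset.prod_congr rfl fun I _ => h2 I, Finset.prod_const] at h1
  rw [← h1]
  congr 1
  ext J
  simp

lemma integrable_exp_sum_abs (A : Finset ι) (t : ℝ) :
    Integrable (fun J : ι → ℝ => Real.exp (t * ∑ I ∈ A, |J I|))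
      (Measure.pi fun _ => gaussianReal 0 1) := by
  classical
  have h := Integrable.fintype_prod (μ := fun _ : ι => gaussianReal 0 1)
    (f := fun I x => if I ∈ A then Real.exp (t * |x|) else 1) fun I => by
      by_cases hI : I ∈ A
      · simpa [hI] using integrable_exp_abs_gaussianReal t
      · simp [hI]
  refine h.congr (Filter.Eventually.of_forall fun J => ?_)
  simp only [Finset.mul_sum, Real.exp_sum]
  rw [Finset.prod_ite_mem, Finset.univ_inter]

lemma gaussian_lower_tail (A : Finset ι) (y : ℝ) :
    (Measure.pi fun _ : ι => gaussianReal 0 1).real {J | ∑ I ∈ A, |J I| ≤ y} ≤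
      Real.exp (2 * y) * absMgf (-2) ^ A.card := by
  have := measure_le_le_exp_mul_mgf y (by norm_num : (-2 : ℝ) ≤ 0) (integrable_exp_sum_abs A (-2))
  rwa [mgf_sum_abs_gaussianReal, neg_neg] at this

lemma gaussian_upper_tail (A : Finset ι) (x : ℝ) :
    (Measure.pi fun _ : ι => gaussianReal 0 1).real {J | x ≤ ∑ I ∈ A, |J I|} ≤
      Real.exp (-x) * absMgf 1 ^ A.card := by
  have := measure_ge_le_exp_mul_mgf x (zero_le_one) (integrable_exp_sum_abs A 1)
  rwa [mgf_sum_abs_gaussianReal, neg_one_mul] at this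

/-! ### Events for the joint law of selections and couplings -/

/-- The couplings are nonzero, their sum over `M` is larger than `y`, and their sum over `A` is
smaller than `x`. -/
def goodCouplings (y x : ℝ) (M A : Finset ι) : Set (ι → ℝ) :=
  {J | (∀ I, J I ≠ 0) ∧ y < ∑ I ∈ M, |J I| ∧ ∑ I ∈ A, |J I| < x}

lemma measurableSet_goodCouplings (y x : ℝ) (M A : Finset ι) :
    MeasurableSet (goodCouplings y x M A) := by
  have h1 : MeasurableSet {J : ι → ℝ | ∀ I, J I ≠ 0} := by
    rw [Set.ofPred_forall]
    exact MeasurableSet.iInter fun I => (measurable_pi_apply I (measurableSet_singleton 0)).compl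
  have h2 : ∀ B : Finset ι, Measurable fun J : ι → ℝ => ∑ I ∈ B, |J I| := fun B => by fun_prop
  exact h1.inter ((measurableSet_lt measurable_const (h2 M)).inter
    (measurableSet_lt (h2 A) measurable_const))

/-- A union bound over the two Chernoff tails; the event that some coupling vanishes is null. -/
lemma le_measure_goodCouplings (y x : ℝ) (M A : Finset ι) :
    1 - Real.exp (2 * y) * absMgf (-2) ^ M.card - Real.exp (-x) * absMgf 1 ^ A.card ≤
      (Measure.pi fun _ : ι => gaussianReal 0 1).real (goodCouplings y x M A) := by
  set ν := Measure.pi fun _ : ι => gaussianReal 0 1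
  have h0 : ν.real {J | ∃ I, J I = 0} = 0 := by
    rw [Measure.real, Set.ofPred_exists, measure_iUnion_null, ENNReal.toReal_zero]
    intro I
    have hmp := measurePreserving_eval (fun _ : ι => gaussianReal 0 1) I
    have := hmp.measure_preimage (measurableSet_singleton (0 : ℝ)).nullMeasurableSet
    have hat : NullSingletonClass (gaussianReal 0 1) :=
      nullSingletonClass_gaussianReal one_ne_zero
    rw [measure_singleton] at this
    exact this
  have hc : (goodCouplings y x M A)ᶜ ⊆ {J | ∃ I, J I = 0} ∪ ({J | ∑ I ∈ M, |J I| ≤ y} ∪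
      {J | x ≤ ∑ I ∈ A, |J I|}) := by
    intro J hJ
    simp only [goodCouplings, Set.mem_compl_iff, Set.mem_ofPred_eq, not_and_or, not_forall, not_not,
      not_lt] at hJ
    exact hJ
  have h1 := (measureReal_mono (μ := ν) hc).trans ((measureReal_union_le _ _).trans
    (add_le_add_right (measureReal_union_le _ _) _))
  rw [probReal_compl_eq_one_sub (measurableSet_goodCouplings y x M A), h0] at h1
  have h2 := gaussian_lower_tail M y
  have h3 := gaussian_upper_tail A x
  linarith

open Classical in
/-- The selection variables if the selected set is `A`. -/
def presence {ι : Type*} (A : Finset ι) : ι → ℝ := fun I => if I ∈ A then 1 else 0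

/-- The selected set is `A` for some `A` and the couplings are in `G A`. -/
def jointEvent (G : Finset ι → Set (ι → ℝ)) : Set ((ι → ℝ) × (ι → ℝ)) :=
  ⋃ A : Finset ι, {presence A} ×ˢ G A

lemma measurableSet_jointEvent {G : Finset ι → Set (ι → ℝ)} (hG : ∀ A, MeasurableSet (G A)) :
    MeasurableSet (jointEvent G) :=
  MeasurableSet.iUnion fun A => (measurableSet_singleton _).prod (hG A)

open Classical in
-- Distinct sets have distinct indicator vectors, so the union is disjoint, and the product
-- Bernoulli law gives the vector of `A` the mass `p ^ |A| (1 - p) ^ (N - |A|)`.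
lemma measure_jointEvent {G : Finset ι → Set (ι → ℝ)} (hG : ∀ A, MeasurableSet (G A))
    (p : unitInterval) (ν : Measure (ι → ℝ)) [IsProbabilityMeasure ν] :
    ((Measure.pi fun _ : ι => bernoulliMeasure (1 : ℝ) 0 p).prod ν).real (jointEvent G) =
      subsetExp (p : ℝ) Finset.univ fun A => ν.real (G A) := by
  have hU : jointEvent G = ⋃ A ∈ (Finset.univ : Finset (Finset ι)),
      {presence A} ×ˢ G A := by
    simp [jointEvent]
  rw [hU, measureReal_biUnion_finset, subsetExp, Finset.powerset_univ]
  · refine Finset.sum_congr rfl fun A _ => ?_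
    rw [measureReal_prod_prod]
    congr 1
    rw [Measure.real, Measure.pi_singleton, ENNReal.toReal_prod]
    have hterm : ∀ I, (bernoulliMeasure (1 : ℝ) 0 p {presence A I}).toReal =
        if I ∈ A then (p : ℝ) else 1 - p := by
      intro I
      rw [← Measure.real, bernoulliMeasure_real_apply _ (measurableSet_singleton _)]
      by_cases hI : I ∈ A <;> simp [presence, hI]
    rw [Finset.prod_congr rfl fun I _ => hterm I, Finset.prod_ite]
    simp only [Finset.prod_const, Finset.filter_mem_eq_inter, Finset.univ_inter]
    congr 2
    rw [Finset.filter_not, Finset.filter_mem_eq_inter, Finset.univ_inter,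
      Finset.card_univ_sdiff, Finset.card_univ]
  · intro A _ B _ hAB
    refine Set.disjoint_left.2 ?_
    rintro ⟨X, J⟩ ⟨h1, -⟩ ⟨h2, -⟩
    simp only [Set.mem_singleton_iff] at h1 h2
    apply hAB
    ext I
    have := congrFun (h1.symm.trans h2) I
    by_cases hA : I ∈ A <;> by_cases hB : I ∈ B <;> simp_all [presence]
  · intro A _
    exact (measurableSet_singleton _).prod (hG A)

open Classical in
-- Averages `le_measure_goodCouplings` over `A`. Because `M` is a function of `A` alone, the
-- couplings on `M A` are still independent Gaussians for fixed `A`. The upper tail averages in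
-- closed form by the binomial theorem; the lower tail is left as an expectation for the greedy
-- analysis.
lemma le_measure_jointEvent (p : unitInterval) (y x : ℝ) (M : Finset ι → Finset ι) :
    1 - Real.exp (2 * y) * subsetExp (p : ℝ) Finset.univ (fun A => absMgf (-2) ^ (M A).card) -
        Real.exp (-x) * (p * absMgf 1 + (1 - p)) ^ Fintype.card ι ≤
      ((Measure.pi fun _ : ι => bernoulliMeasure (1 : ℝ) 0 p).prod
        (Measure.pi fun _ : ι => gaussianReal 0 1)).real
          (jointEvent fun A => goodCouplings y x (M A) A) := by
  rw [measure_jointEvent fun A => measurableSet_goodCouplings y x (M A) A]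
  have h1 : subsetExp (p : ℝ) (Finset.univ : Finset ι) (fun A => (1 : ℝ) ^ A.card) = 1 := by
    rw [subsetExp_pow_card]; simp
  have h2 := subsetExp_pow_card (p : ℝ) (absMgf 1) (Finset.univ : Finset ι)
  rw [Finset.card_univ] at h2
  rw [← h2]
  nth_rw 1 [← h1]
  simp only [subsetExp, Finset.mul_sum, ← Finset.sum_sub_distrib]
  refine Finset.sum_le_sum fun A _ => ?_
  have h3 := le_measure_goodCouplings y x (M A) A
  have h4 : 0 ≤ (p : ℝ) ^ A.card * (1 - (p : ℝ)) ^ ((Finset.univ : Finset ι).card - A.card) :=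
    mul_nonneg (pow_nonneg p.2.1 _) (pow_nonneg (sub_nonneg.2 p.2.2) _)
  refine le_trans (le_of_eq ?_) (mul_le_mul_of_nonneg_left h3 h4)
  rw [one_pow]
  ring

end

/-! ### Numerical estimates -/

/-- Yields the expected number `binom(2n,4) p = nk/2` of present interactions. -/
lemma four_mul_choose {n : ℕ} (hn : 0 < n) :
    4 * ((2 * n).choose 4 : ℝ) = 2 * n * ((2 * n - 1).choose 3 : ℝ) := by
  obtain ⟨N, hN⟩ : ∃ N, 2 * n = N + 1 := ⟨2 * n - 1, by omega⟩
  have h := Nat.add_one_mul_choose_eq N 3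
  rw [hN, Nat.add_sub_cancel]
  have h2 : (2 * n : ℝ) = N + 1 := by exact_mod_cast hN
  have h3 : ((N : ℝ) + 1) * (N.choose 3 : ℝ) = ((N + 1).choose 4 : ℝ) * 4 := by exact_mod_cast h
  rw [h2]
  linarith

lemma six_mul_choose_three (N : ℕ) (hN : 2 ≤ N) :
    6 * (N.choose 3 : ℝ) = N * (N - 1) * (N - 2) := by
  obtain ⟨M, rfl⟩ := Nat.exists_eq_add_of_le' hN
  have h : 6 * (M + 2).choose 3 = (M + 2) * (M + 1) * M := by
    have e1 := Nat.add_one_mul_choose_eq (M + 1) 2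
    have e2 := Nat.add_one_mul_choose_eq M 1
    simp only [Nat.choose_one_right] at e1 e2
    have e3 : 6 * (M + 2).choose 3 = 2 * ((M + 1 + 1).choose (2 + 1) * (2 + 1)) := by ring_nf
    rw [e3, ← e1, show 2 * ((M + 1 + 1) * (M + 1).choose 2) =
      (M + 2) * ((M + 1).choose (1 + 1) * (1 + 1)) by ring_nf, ← e2]
    ring
  have h' : (6 : ℝ) * ((M + 2).choose 3 : ℝ) = (M + 2) * (M + 1) * M := by exact_mod_cast h
  rw [h']
  push_cast
  ring

/-- Each of the three factors of the falling factorial shrinks at most by `7/10`, and `(7/10)³ >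
1/4`. -/
lemma choose_three_ratio {n m w : ℕ} (hn : 120 < n) (hm : m = (n + 7) / 8)
    (hw : w = 2 * n + 3 - 4 * m) :
    ((2 * n - 1).choose 3 : ℝ) ≤ 4 * (w.choose 3 : ℝ) := by
  have h1 := six_mul_choose_three (2 * n - 1) (by omega)
  have h2 := six_mul_choose_three w (by omega)
  have h3 : 3 * (n : ℝ) ≤ 2 * w + 1 := by
    have : 3 * n ≤ 2 * w + 1 := by omega
    exact_mod_cast this
  have h4 : ((2 * n - 1 : ℕ) : ℝ) = 2 * n - 1 := by
    rw [Nat.cast_sub (by omega)]; push_cast; ring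
  have h5 : (121 : ℝ) ≤ n := by exact_mod_cast hn
  rw [h4] at h1
  have a1 : 7 / 10 * (2 * (n : ℝ) - 1) ≤ w := by linarith
  have a2 : 7 / 10 * (2 * (n : ℝ) - 1 - 1) ≤ w - 1 := by linarith
  have a3 : 7 / 10 * (2 * (n : ℝ) - 1 - 2) ≤ w - 2 := by linarith
  have b1 : 0 ≤ 7 / 10 * (2 * (n : ℝ) - 1) := by linarith
  have b2 : 0 ≤ 7 / 10 * (2 * (n : ℝ) - 1 - 1) := by linarith
  have b3 : 0 ≤ 7 / 10 * (2 * (n : ℝ) - 1 - 2) := by linarith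
  have key := mul_le_mul (mul_le_mul a1 a2 b2 (by linarith)) a3 b3
    (mul_nonneg (by linarith) (by linarith))
  rw [← h2] at key
  have h6 : 0 ≤ ((2 * n - 1).choose 3 : ℝ) := by positivity
  nlinarith

lemma choose_three_ge {n : ℕ} (hn : 120 < n) : (n : ℝ) ≤ ((2 * n - 1).choose 3 : ℝ) := by
  have h1 := six_mul_choose_three (2 * n - 1) (by omega)
  have h4 : ((2 * n - 1 : ℕ) : ℝ) = 2 * n - 1 := by
    rw [Nat.cast_sub (by omega)]; push_cast; ring
  have h5 : (121 : ℝ) ≤ n := by exact_mod_cast hn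
  rw [h4] at h1
  have : (n : ℝ) * 6 ≤ (2 * n - 1) * (2 * n - 1 - 1) * (2 * n - 1 - 2) := by
    calc (n : ℝ) * 6 ≤ n * 6 * 1 := by linarith
      _ ≤ (2 * n - 1) * (2 * n - 1 - 1) * (2 * n - 1 - 2) := by
        have a1 : (n : ℝ) * 6 ≤ (2 * n - 1) * (2 * n - 1 - 1) := by nlinarith
        exact mul_le_mul a1 (by linarith) zero_le_one (by nlinarith)
  linarith

lemma coe_selectionProb {n : ℕ} {k : ℝ} (hk : 0 < k) (hn : 120 * (k + 1) < n) :
    (selectionProb n k : ℝ) = k / ((2 * n - 1).choose 3 : ℝ) := by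
  have h1 : 120 < n := by
    have : (120 : ℝ) < n := by linarith
    exact_mod_cast this
  have h2 := choose_three_ge h1
  have h3 : (0 : ℝ) < ((2 * n - 1).choose 3 : ℝ) := lt_of_lt_of_le (by linarith) h2
  rw [selectionProb, Set.coe_projIcc, min_eq_right, max_eq_right]
  · positivity
  · rw [div_le_one h3]; linarith

/-- Both tails are shown to decay at least at the simpler rate on the right, so this single
comparison serves for both. The exponential factor on the left absorbs `k²`, as `k² ≤ exp (2k)`. -/
lemma exponent_le {k : ℝ} (hk : 0 < k) :
    Real.exp (-16 * (k + 1)) * k ^ 3 / (64 * (8 * k + 7)) ≤ k / (40 * (4 + k)) := by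
  have h1 : k ^ 2 * Real.exp (-16 * (k + 1)) ≤ 1 := by
    have h2 : k ≤ Real.exp k := by linarith [Real.add_one_le_exp k]
    have h3 : k ^ 2 ≤ Real.exp (16 * (k + 1)) :=
      calc k ^ 2 ≤ Real.exp k ^ 2 := by gcongr
        _ = Real.exp (2 * k) := by rw [← Real.exp_nat_mul]; norm_num
        _ ≤ Real.exp (16 * (k + 1)) := Real.exp_le_exp.2 (by linarith)
    rw [neg_mul, Real.exp_neg, ← div_eq_mul_inv, div_le_one (Real.exp_pos _)]
    exact h3
  rw [div_le_div_iff₀ (by positivity) (by positivity)]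
  calc Real.exp (-16 * (k + 1)) * k ^ 3 * (40 * (4 + k))
      = (k ^ 2 * Real.exp (-16 * (k + 1))) * (k * (40 * (4 + k))) := by ring
    _ ≤ 1 * (k * (40 * (4 + k))) := by gcongr
    _ ≤ k * (64 * (8 * k + 7)) := by nlinarith

/-- Probability that the couplings of the selected interactions have a large sum. -/
lemma upper_tail_le {n : ℕ} {k p ψ : ℝ} (hk : 0 < k) (hn : 120 * (k + 1) < n)
    (hp : p = k / ((2 * n - 1).choose 3 : ℝ)) (hψ0 : 0 ≤ ψ) (hψ : ψ ≤ 33 / 10) :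
    Real.exp (-(5 / 4 * (n * k))) * (p * ψ + (1 - p)) ^ ((2 * n).choose 4) ≤
      Real.exp (-(Real.exp (-16 * (k + 1)) * k ^ 3 / (64 * (8 * k + 7)) * n)) := by
  have h120 : 120 < n := by
    have : (120 : ℝ) < n := by linarith
    exact_mod_cast this
  have hC := choose_three_ge h120
  have hn0 : (0 : ℝ) < n := by linarith
  have hC0 : (0 : ℝ) < ((2 * n - 1).choose 3 : ℝ) := by linarith
  have hp0 : 0 ≤ p := by rw [hp]; positivity
  have hp1 : p ≤ 1 := by rw [hp, div_le_one hC0]; linarith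
  have h4 := four_mul_choose (n := n) (by omega)
  have hN : ((2 * n).choose 4 : ℝ) * p = n * k / 2 := by
    rw [hp]
    field_simp
    linarith
  -- Here `1 + p(ψ - 1) ≤ exp (23p/10)`, and the mean number `nk/2` of items gives `23/20 nk`. The
  -- threshold `5/4 nk` exceeds this by `nk/10`.
  have h1 : (p * ψ + (1 - p)) ^ ((2 * n).choose 4) ≤ Real.exp (23 / 20 * (n * k)) := by
    calc (p * ψ + (1 - p)) ^ ((2 * n).choose 4)
        ≤ Real.exp (p * (23 / 10)) ^ ((2 * n).choose 4) := by
          refine pow_le_pow_left₀ (by nlinarith) ?_ _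
          have := Real.add_one_le_exp (p * (23 / 10))
          nlinarith
      _ = Real.exp (23 / 20 * (n * k)) := by
          rw [← Real.exp_nat_mul]
          congr 1
          linear_combination (23 / 10) * hN
  refine (mul_le_mul_of_nonneg_left h1 (Real.exp_pos _).le).trans ?_
  rw [← Real.exp_add, Real.exp_le_exp]
  have h2 := exponent_le hk
  have h3 : k / (40 * (4 + k)) ≤ k / 10 := by
    apply div_le_div_of_nonneg_left hk.le (by norm_num); linarith
  have := mul_le_mul_of_nonneg_right (h2.trans h3) hn0.le
  linarith

/-- Probability that the couplings of the picked interactions have a small sum. -/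
lemma lower_tail_le {n m w : ℕ} {k p φ : ℝ} (hk : 0 < k) (hn : 120 * (k + 1) < n)
    (hp : p = k / ((2 * n - 1).choose 3 : ℝ)) (hφ0 : 0 ≤ φ) (hφ : φ ≤ 7 / 10)
    (hm : m = (n + 7) / 8) (hw : w = 2 * n + 3 - 4 * m) :
    Real.exp (2 * (5 / 4 * (n * k) / (1236 + 2752 * k + 1536 * k ^ 2))) *
        (φ + (1 - φ) * (1 - p) ^ w.choose 3) ^ m ≤
      Real.exp (-(Real.exp (-16 * (k + 1)) * k ^ 3 / (64 * (8 * k + 7)) * n)) := by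
  have h120 : 120 < n := by
    have : (120 : ℝ) < n := by linarith
    exact_mod_cast this
  have hC := choose_three_ge h120
  have hn0 : (0 : ℝ) < n := by linarith
  have hC0 : (0 : ℝ) < ((2 * n - 1).choose 3 : ℝ) := by linarith
  have hp0 : 0 ≤ p := by rw [hp]; positivity
  have hp1 : p ≤ 1 := by rw [hp, div_le_one hC0]; linarith
  have hpw : k / 4 ≤ (w.choose 3 : ℝ) * p := by
    have := choose_three_ratio h120 hm hw
    rw [hp, ← mul_div_assoc, div_le_div_iff₀ (by norm_num) hC0]
    nlinarith
  -- A block has at least `k/4` available items in expectation. The exponential is weakened to a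
  -- rational function to make it comparable with `D`.
  have h1 : (1 - p) ^ w.choose 3 ≤ 4 / (4 + k) := by
    calc (1 - p) ^ w.choose 3 ≤ Real.exp (-p) ^ w.choose 3 :=
          pow_le_pow_left₀ (by linarith) (Real.one_sub_le_exp_neg p) _
      _ = Real.exp (-((w.choose 3 : ℝ) * p)) := by rw [← Real.exp_nat_mul]; congr 1; ring
      _ ≤ Real.exp (-(k / 4)) := Real.exp_le_exp.2 (by linarith)
      _ ≤ (1 + k / 4)⁻¹ := by
          rw [Real.exp_neg]
          exact inv_anti₀ (by positivity) (by linarith [Real.add_one_le_exp (k / 4)])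
      _ = 4 / (4 + k) := by field_simp
  have h1' : 0 ≤ (1 - p) ^ w.choose 3 := pow_nonneg (by linarith) _
  set u := 3 / 10 * (k / (4 + k)) with hu
  have hu0 : 0 ≤ u := by positivity
  have h2 : φ + (1 - φ) * (1 - p) ^ w.choose 3 ≤ Real.exp (-u) := by
    have h3 : 4 / (4 + k) = 1 - k / (4 + k) := by field_simp; ring
    have h4 := Real.one_sub_le_exp_neg u
    have h5 : 0 ≤ k / (4 + k) := by positivity
    have h6 := mul_le_mul_of_nonneg_left h1 (by linarith : 0 ≤ 1 - φ)
    rw [h3] at h6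
    nlinarith
  have h7 : (φ + (1 - φ) * (1 - p) ^ w.choose 3) ^ m ≤ Real.exp (-(n / 8 * u)) := by
    have hmn : (n : ℝ) / 8 ≤ m := by
      have : n ≤ 8 * m := by omega
      have : (n : ℝ) ≤ 8 * m := by exact_mod_cast this
      linarith
    calc _ ≤ Real.exp (-u) ^ m :=
          pow_le_pow_left₀ (add_nonneg hφ0 (mul_nonneg (by linarith) h1')) h2 m
      _ = Real.exp (-(m * u)) := by rw [← Real.exp_nat_mul]; congr 1; ring
      _ ≤ _ := Real.exp_le_exp.2 (neg_le_neg (mul_le_mul_of_nonneg_right hmn hu0))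
  refine (mul_le_mul_of_nonneg_left h7 (Real.exp_pos _).le).trans ?_
  rw [← Real.exp_add, Real.exp_le_exp]
  have h8 := mul_le_mul_of_nonneg_right (exponent_le hk) hn0.le
  -- The only place where the size of `D` matters; `D ≥ 300 (4 + k)` is enough. In units of `n k /
  -- (4 + k)`, the blocks gain `3/80` and the threshold costs at most `1/120`, which leaves `7/240 ≥
  -- 1/40`.
  have h9 : 5 / 4 * (n * k) / (1236 + 2752 * k + 1536 * k ^ 2) ≤ n * (k / (4 + k)) / 240 := by
    rw [← mul_div_assoc, div_div, div_le_div_iff₀ (by positivity) (by positivity)]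
    have : 0 < n * k := by positivity
    have h10 : 5 / 4 * ((4 + k) * 240) ≤ 1236 + 2752 * k + 1536 * k ^ 2 := by nlinarith
    nlinarith
  have h11 : k / (40 * (4 + k)) = k / (4 + k) / 40 := by rw [mul_comm, div_div]
  rw [h11] at h8
  have h12 : 0 ≤ n * (k / (4 + k)) := by positivity
  rw [hu]
  nlinarith

/-! ### Algebra of Majorana operators -/

section Majorana

variable {n : ℕ} {c : Fin (2 * n) → FockMatrix n}

lemma IsMajoranaSystem.mul_self (hc : IsMajoranaSystem n c) (x : Fin (2 * n)) :
    c x * c x = 1 := by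
  have h := hc.anticomm x x
  rw [if_pos rfl, ← two_mul] at h
  have h2 : (2 : ℂ) • (c x * c x) = (2 : ℂ) • (1 : FockMatrix n) := by
    rw [two_smul, two_smul, ← two_mul, h]; norm_num
  exact smul_right_injective _ (two_ne_zero) h2

lemma IsMajoranaSystem.anti (hc : IsMajoranaSystem n c) {x y : Fin (2 * n)} (h : x ≠ y) :
    c x * c y = -(c y * c x) := by
  have := hc.anticomm x y
  rw [if_neg h] at this
  exact eq_neg_of_add_eq_zero_left this

lemma IsMajoranaSystem.commute_pair (hc : IsMajoranaSystem n c) {x u v : Fin (2 * n)} (hu : x ≠ u)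
    (hv : x ≠ v) : Commute (c x) (c u * c v) := by
  rw [commute_iff_eq, ← mul_assoc, hc.anti hu, neg_mul, mul_assoc, hc.anti hv, mul_neg, neg_neg,
    mul_assoc]

lemma IsMajoranaSystem.anti_triple (hc : IsMajoranaSystem n c) {x u v w : Fin (2 * n)} (hu : x ≠ u)
    (hv : x ≠ v) (hw : x ≠ w) : c x * (c u * (c v * c w)) = -(c u * (c v * c w) * c x) := by
  rw [← mul_assoc, hc.anti hu, neg_mul, mul_assoc, (hc.commute_pair hv hw).eq]
  simp only [mul_assoc]

/-- Conjugation by `g` preserves the trace and sends `X` to `-X`. -/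
lemma trace_eq_zero_of_anticomm {g X : FockMatrix n} (hg : g * g = 1) (h : g * X = -(X * g)) :
    X.trace = 0 := by
  have h1 : X.trace = -X.trace := by
    calc X.trace = (g * (g * X)).trace := by rw [← mul_assoc, hg, one_mul]
      _ = -(g * (X * g)).trace := by rw [h, mul_neg, Matrix.trace_neg]
      _ = -X.trace := by rw [Matrix.trace_mul_comm, mul_assoc, hg, mul_one]
  exact self_eq_neg.1 h1

/-- The Hermitian operator `i c_x c_y`. -/
noncomputable def edgeOp (c : Fin (2 * n) → FockMatrix n) (x y : Fin (2 * n)) : FockMatrix n :=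
  Complex.I • (c x * c y)

lemma edgeOp_mul_edgeOp (c : Fin (2 * n) → FockMatrix n) (x y u v : Fin (2 * n)) :
    edgeOp c x y * edgeOp c u v = -(c x * (c y * (c u * c v))) := by
  rw [edgeOp, edgeOp, smul_mul_smul_comm, Complex.I_mul_I, neg_one_smul, mul_assoc]

lemma edgeOp_mul_self (hc : IsMajoranaSystem n c) {x y : Fin (2 * n)} (h : x ≠ y) :
    edgeOp c x y * edgeOp c x y = 1 := by
  rw [edgeOp_mul_edgeOp, ← mul_assoc (c y), hc.anti h.symm, neg_mul, mul_neg, neg_neg, mul_assoc,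
    hc.mul_self, mul_one, hc.mul_self]

lemma edgeOp_swap (hc : IsMajoranaSystem n c) {x y : Fin (2 * n)} (h : x ≠ y) :
    edgeOp c y x = -edgeOp c x y := by
  rw [edgeOp, edgeOp, hc.anti h.symm, smul_neg]

lemma edgeOp_isHermitian (hc : IsMajoranaSystem n c) {x y : Fin (2 * n)} (h : x ≠ y) :
    (edgeOp c x y).IsHermitian := by
  rw [Matrix.IsHermitian, edgeOp, Matrix.conjTranspose_smul, Matrix.conjTranspose_mul,
    (hc.isHermitian x).eq, (hc.isHermitian y).eq, hc.anti h.symm]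
  simp

lemma commute_edgeOp (hc : IsMajoranaSystem n c) {x u v : Fin (2 * n)} (hu : x ≠ u) (hv : x ≠ v) :
    Commute (c x) (edgeOp c u v) :=
  (hc.commute_pair hu hv).smul_right _

lemma edgeOp_commute_edgeOp (hc : IsMajoranaSystem n c) {x y u v : Fin (2 * n)} (h1 : x ≠ u)
    (h2 : x ≠ v) (h3 : y ≠ u) (h4 : y ≠ v) : Commute (edgeOp c x y) (edgeOp c u v) :=
  ((commute_edgeOp hc h1 h2).mul_left (commute_edgeOp hc h3 h4)).smul_left _

lemma left_anti_edgeOp (hc : IsMajoranaSystem n c) {x y : Fin (2 * n)} (h : x ≠ y) :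
    c x * edgeOp c x y = -(edgeOp c x y * c x) := by
  rw [edgeOp, mul_smul_comm, smul_mul_assoc, mul_assoc, hc.anti h.symm, mul_neg, smul_neg, neg_neg]

lemma right_anti_edgeOp (hc : IsMajoranaSystem n c) {x y : Fin (2 * n)} (h : x ≠ y) :
    c y * edgeOp c x y = -(edgeOp c x y * c y) := by
  rw [edgeOp, mul_smul_comm, smul_mul_assoc, ← mul_assoc, hc.anti h.symm, neg_mul, smul_neg]

end Majorana

/-! ### Gaussian states of perfect matchings -/

section Matching

variable {n : ℕ}

/-- The first Majorana operator of a mode. -/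
def evenIdx (j : Fin n) : Fin (2 * n) := ⟨2 * j.val, by omega⟩

/-- The second Majorana operator of a mode. -/
def oddIdx (j : Fin n) : Fin (2 * n) := ⟨2 * j.val + 1, by omega⟩

lemma evenIdx_ne_oddIdx (i j : Fin n) : evenIdx i ≠ oddIdx j := by
  simp only [evenIdx, oddIdx, ne_eq, Fin.mk.injEq]; omega

lemma evenIdx_injective : Function.Injective (evenIdx (n := n)) := fun i j h => by
  simp only [evenIdx, Fin.mk.injEq] at h; omega

lemma oddIdx_injective : Function.Injective (oddIdx (n := n)) := fun i j h => by
  simp only [oddIdx, Fin.mk.injEq] at h; omega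

lemma exists_idx (x : Fin (2 * n)) : ∃ j : Fin n, x = evenIdx j ∨ x = oddIdx j := by
  refine ⟨⟨x.val / 2, by omega⟩, ?_⟩
  simp only [evenIdx, oddIdx, Fin.ext_iff]
  omega

noncomputable section

/-- The operator `i c_x c_y` of the `j`-th pair of a perfect matching. -/
def pairOp (c : Fin (2 * n) → FockMatrix n) (σ : Equiv.Perm (Fin (2 * n))) (j : Fin n) :
    FockMatrix n := edgeOp c (σ (evenIdx j)) (σ (oddIdx j))

/-- The product of the factors `1 + l_j P_j` for the pairs `j` in a list. -/
def pairProd (c : Fin (2 * n) → FockMatrix n) (σ : Equiv.Perm (Fin (2 * n))) (l : Fin n → ℝ)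
    (L : List (Fin n)) : FockMatrix n :=
  (L.map fun j => 1 + (l j : ℂ) • pairOp c σ j).prod

/-- The Gaussian state of a perfect matching with weights `l`. -/
def matchingState (c : Fin (2 * n) → FockMatrix n) (σ : Equiv.Perm (Fin (2 * n)))
    (l : Fin n → ℝ) : FockMatrix n :=
  ((2 : ℂ) ^ n)⁻¹ • pairProd c σ l (List.finRange n)

/-- The correlation matrix of the Gaussian state of a perfect matching. -/
def matchingCorr (σ : Equiv.Perm (Fin (2 * n))) (l : Fin n → ℝ) (x y : Fin (2 * n)) : ℝ :=
  ∑ j, l j * ((if x = σ (evenIdx j) ∧ y = σ (oddIdx j) then 1 else 0) -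
    (if x = σ (oddIdx j) ∧ y = σ (evenIdx j) then 1 else 0))

variable {c : Fin (2 * n) → FockMatrix n} (hc : IsMajoranaSystem n c)
  (σ : Equiv.Perm (Fin (2 * n))) (l : Fin n → ℝ)

lemma perm_ne (j : Fin n) : σ (evenIdx j) ≠ σ (oddIdx j) :=
  fun h => evenIdx_ne_oddIdx j j (σ.injective h)

include hc in
lemma pairOp_mul_self (j : Fin n) : pairOp c σ j * pairOp c σ j = 1 :=
  edgeOp_mul_self hc (perm_ne σ j)

lemma commute_pairProd {g : FockMatrix n} {L : List (Fin n)}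
    (h : ∀ j ∈ L, Commute g (pairOp c σ j)) : Commute g (pairProd c σ l L) := by
  refine Commute.list_prod_right _ _ fun X hX => ?_
  obtain ⟨j, hj, rfl⟩ := List.mem_map.1 hX
  exact (Commute.one_right g).add_right ((h j hj).smul_right _)

include hc in
lemma even_commute_pairOp {i j : Fin n} (h : i ≠ j) :
    Commute (c (σ (evenIdx i))) (pairOp c σ j) :=
  commute_edgeOp hc (fun e => h (evenIdx_injective (σ.injective e)))
    fun e => evenIdx_ne_oddIdx _ _ (σ.injective e)

include hc in
lemma odd_commute_pairOp {i j : Fin n} (h : i ≠ j) :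
    Commute (c (σ (oddIdx i))) (pairOp c σ j) :=
  commute_edgeOp hc (fun e => evenIdx_ne_oddIdx _ _ (σ.injective e).symm)
    fun e => h (oddIdx_injective (σ.injective e))

include hc in
lemma pairOp_commute (i j : Fin n) : Commute (pairOp c σ i) (pairOp c σ j) := by
  by_cases h : i = j
  · rw [h]
  · exact ((even_commute_pairOp hc σ h).mul_left (odd_commute_pairOp hc σ h)).smul_left _

include hc in
-- Expanding the first factor, the term with `P_j` is traceless: an endpoint of the pair `j`
-- anticommutes with `P_j` and commutes with all other factors.
lemma trace_pairProd {L : List (Fin n)} (hL : L.Nodup) : (pairProd c σ l L).trace = 2 ^ n := by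
  induction L with
  | nil => simp [pairProd, Matrix.trace_one]
  | cons j L ih =>
    rw [List.nodup_cons] at hL
    have h0 : (pairOp c σ j * pairProd c σ l L).trace = 0 := by
      refine trace_eq_zero_of_anticomm (hc.mul_self (σ (evenIdx j))) ?_
      have h1 : Commute (c (σ (evenIdx j))) (pairProd c σ l L) :=
        commute_pairProd σ l fun i hi => even_commute_pairOp hc σ (by rintro rfl; exact hL.1 hi)
      rw [← mul_assoc, pairOp, left_anti_edgeOp hc (perm_ne σ j), neg_mul, mul_assoc, h1.eq,
        ← mul_assoc]
    rw [pairProd, List.map_cons, List.prod_cons, add_mul, one_mul, Matrix.trace_add,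
      smul_mul_assoc, Matrix.trace_smul, ← pairProd, h0, ih hL.2, smul_zero, add_zero]

include hc in
lemma trace_matchingState : (matchingState c σ l).trace = 1 := by
  rw [matchingState, Matrix.trace_smul, trace_pairProd hc σ l (List.nodup_finRange n), smul_eq_mul,
    inv_mul_cancel₀ (pow_ne_zero _ two_ne_zero)]

include hc in
-- The factors commute, so any one can be brought to the front; the remaining ones do not involve
-- the two Majorana operators of the pair `j`.
lemma matchingState_eq (j : Fin n) : ∃ ρ' : FockMatrix n,
    matchingState c σ l = (1 + (l j : ℂ) • pairOp c σ j) * ρ' ∧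
    Commute (c (σ (evenIdx j))) ρ' ∧ Commute (c (σ (oddIdx j))) ρ' := by
  set L := (List.finRange n).erase j
  have hn : (List.finRange n).Nodup := List.nodup_finRange n
  have hj : ∀ i ∈ L, j ≠ i := by
    rintro i hi rfl
    exact hn.not_mem_erase hi
  refine ⟨((2 : ℂ) ^ n)⁻¹ • pairProd c σ l L, ?_, ?_, ?_⟩
  · rw [mul_smul_comm, matchingState]
    congr 1
    have hperm : ((List.finRange n).map fun j => 1 + (l j : ℂ) • pairOp c σ j).Perm
        ((j :: L).map fun j => 1 + (l j : ℂ) • pairOp c σ j) :=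
      (List.perm_cons_erase (List.mem_finRange j)).map _
    rw [pairProd, hperm.prod_eq' ?_]
    · rfl
    · rw [List.pairwise_map]
      refine List.pairwise_of_forall fun a b => ?_
      exact ((Commute.one_left _).add_left (((Commute.one_right _).add_right
        ((pairOp_commute hc σ a b).smul_right _)).smul_left _))
  · exact (commute_pairProd σ l fun i hi => even_commute_pairOp hc σ (hj i hi)).smul_right _
  · exact (commute_pairProd σ l fun i hi => odd_commute_pairOp hc σ (hj i hi)).smul_right _

include hc in
-- Since `P² = 1`, `(1 + l P) P = P + l`, and the term with a single `P` is traceless, as `c x`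
-- anticommutes with `P` and commutes with everything else. It suffices that one endpoint of the
-- pair commutes with `Y`.
lemma trace_matchingState_pairOp (j : Fin n) {x : Fin (2 * n)}
    (hx : x = σ (evenIdx j) ∨ x = σ (oddIdx j)) {Y : FockMatrix n} (hY : Commute (c x) Y) :
    (matchingState c σ l * (pairOp c σ j * Y)).trace = l j * (matchingState c σ l * Y).trace := by
  obtain ⟨ρ', hρ, h1, h2⟩ := matchingState_eq hc σ l j
  have hP : Commute (pairOp c σ j) ρ' := (h1.mul_left h2).smul_left _
  have hgρ : Commute (c x) ρ' := by rcases hx with rfl | rfl <;> assumption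
  have hgP : c x * pairOp c σ j = -(pairOp c σ j * c x) := by
    rcases hx with rfl | rfl
    · exact left_anti_edgeOp hc (perm_ne σ j)
    · exact right_anti_edgeOp hc (perm_ne σ j)
  have h0 : (pairOp c σ j * (ρ' * Y)).trace = 0 := by
    refine trace_eq_zero_of_anticomm (hc.mul_self x) ?_
    rw [← mul_assoc, hgP, neg_mul, mul_assoc, (hgρ.mul_right hY).eq, ← mul_assoc]
  have e1 : (1 + (l j : ℂ) • pairOp c σ j) * ρ' * Y =
      ρ' * Y + (l j : ℂ) • (pairOp c σ j * (ρ' * Y)) := by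
    rw [add_mul, add_mul, one_mul, smul_mul_assoc, smul_mul_assoc, mul_assoc (pairOp c σ j)]
  have e2 : (1 + (l j : ℂ) • pairOp c σ j) * ρ' * (pairOp c σ j * Y) =
      pairOp c σ j * (ρ' * Y) + (l j : ℂ) • (ρ' * Y) := by
    rw [mul_assoc, ← mul_assoc ρ', ← hP.eq, mul_assoc, add_mul, one_mul, smul_mul_assoc,
      ← mul_assoc (pairOp c σ j) (pairOp c σ j), pairOp_mul_self hc, one_mul]
  rw [hρ, e1, e2, Matrix.trace_add, Matrix.trace_add, Matrix.trace_smul, Matrix.trace_smul, h0]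
  simp

include hc in
lemma trace_matchingState_eq_zero (j : Fin n) {X : FockMatrix n}
    (hX : pairOp c σ j * X = -(X * pairOp c σ j)) : (matchingState c σ l * X).trace = 0 := by
  have hP : Commute (pairOp c σ j) (matchingState c σ l) :=
    (commute_pairProd σ l fun i _ => pairOp_commute hc σ j i).smul_right _
  refine trace_eq_zero_of_anticomm (pairOp_mul_self hc σ j) ?_
  rw [← mul_assoc, hP.eq, mul_assoc, hX, mul_neg, mul_assoc]

include hc in
/-- Every vertex has a partner in the matching; the expectation of a product that contains the
operator of the pair factorizes, and operators that anticommute with it have expectation `0`. -/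
lemma exists_partner (x : Fin (2 * n)) : ∃ y, x ≠ y ∧ (∀ z, z ≠ y → matchingCorr σ l x z = 0) ∧
    (∀ Y, Commute (c x) Y → (matchingState c σ l * (edgeOp c x y * Y)).trace =
      matchingCorr σ l x y * (matchingState c σ l * Y).trace) ∧
    (∀ X, edgeOp c x y * X = -(X * edgeOp c x y) → (matchingState c σ l * X).trace = 0) := by
  obtain ⟨j, hj⟩ := exists_idx (σ.symm x)
  rcases hj with hj | hj
  · obtain rfl : x = σ (evenIdx j) := by rw [← hj, Equiv.apply_symm_apply]
    have hcorr : ∀ z, matchingCorr σ l (σ (evenIdx j)) z = if z = σ (oddIdx j) then l j else 0 := by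
      intro z
      rw [matchingCorr, Finset.sum_eq_single j]
      · simp [evenIdx_ne_oddIdx]
      · intro i _ hi
        simp [evenIdx_ne_oddIdx, evenIdx_injective.eq_iff, hi.symm]
      · simp
    refine ⟨σ (oddIdx j), perm_ne σ j, fun z hz => by rw [hcorr, if_neg hz], fun Y hY => ?_,
      fun X hX => trace_matchingState_eq_zero hc σ l j hX⟩
    rw [hcorr, if_pos rfl]
    exact trace_matchingState_pairOp hc σ l j (Or.inl rfl) hY
  · obtain rfl : x = σ (oddIdx j) := by rw [← hj, Equiv.apply_symm_apply]
    have hcorr : ∀ z, matchingCorr σ l (σ (oddIdx j)) z =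
        if z = σ (evenIdx j) then -l j else 0 := by
      intro z
      rw [matchingCorr, Finset.sum_eq_single j]
      · by_cases hz : z = σ (evenIdx j) <;> simp [(evenIdx_ne_oddIdx _ _).symm, hz]
      · intro i _ hi
        simp [(evenIdx_ne_oddIdx _ _).symm, oddIdx_injective.eq_iff, hi.symm]
      · simp
    refine ⟨σ (evenIdx j), (perm_ne σ j).symm, fun z hz => by rw [hcorr, if_neg hz],
      fun Y hY => ?_, fun X hX => trace_matchingState_eq_zero hc σ l j ?_⟩
    · rw [hcorr, if_pos rfl, edgeOp_swap hc (perm_ne σ j), neg_mul, mul_neg, Matrix.trace_neg]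
      have := trace_matchingState_pairOp hc σ l j (Or.inr rfl) hY
      rw [pairOp] at this
      rw [this]
      push_cast
      ring
    · rw [edgeOp_swap hc (perm_ne σ j), neg_mul, mul_neg] at hX
      exact neg_injective hX

include hc in
lemma trace_matchingState_edgeOp {x y : Fin (2 * n)} (h : x ≠ y) :
    (matchingState c σ l * edgeOp c x y).trace = matchingCorr σ l x y := by
  obtain ⟨z, hz, h0, h1, h2⟩ := exists_partner hc σ l x
  by_cases hyz : y = z
  · subst hyz
    have := h1 1 (Commute.one_right _)
    rwa [mul_one, mul_one, trace_matchingState hc, mul_one] at this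
  · rw [h0 y hyz, h2 _ ?_, Complex.ofReal_zero]
    -- If `y` is not the partner `z` of `x`, the edges `xz` and `xy` share exactly one vertex, so
    -- their operators anticommute.
    have e : ∀ u v, x ≠ u → edgeOp c x u * edgeOp c x v = c u * c v := by
      intro u v hu
      rw [edgeOp_mul_edgeOp, ← mul_assoc (c u), hc.anti hu.symm, neg_mul, mul_neg, neg_neg,
        mul_assoc, ← mul_assoc (c x), hc.mul_self, one_mul]
    rw [e z y hz, e y z h, hc.anti (Ne.symm hyz)]

/-- The Pfaffian of the `4 × 4` submatrix with rows and columns `a, b, c, d`. -/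
def pf {V : Type*} (Γ : V → V → ℝ) (a b c d : V) : ℝ :=
  Γ a b * Γ c d - Γ a c * Γ b d + Γ a d * Γ b c

include hc in
-- Wick's formula for matchings. If the partner of `x` is one of the other three operators, only the
-- Pfaffian term with this pair survives, with the sign of moving the partner next to `x`. Otherwise
-- the pair operator of `x` shares one operator with the monomial and anticommutes with it, while
-- all three Pfaffian terms vanish.
lemma trace_matchingState_four {x y z w : Fin (2 * n)} (hxy : x ≠ y) (hxz : x ≠ z) (hxw : x ≠ w)
    (hyz : y ≠ z) (hyw : y ≠ w) (hzw : z ≠ w) :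
    (matchingState c σ l * -(c x * (c y * (c z * c w)))).trace =
      pf (matchingCorr σ l) x y z w := by
  obtain ⟨u, hu, h0, h1, h2⟩ := exists_partner hc σ l x
  rw [pf]
  by_cases hyu : y = u
  · subst hyu
    rw [h0 z hyz.symm, h0 w hyw.symm, ← edgeOp_mul_edgeOp, h1 _ (commute_edgeOp hc hxz hxw),
      trace_matchingState_edgeOp hc σ l hzw]
    push_cast; ring
  by_cases hzu : z = u
  · subst hzu
    have e : -(c x * (c y * (c z * c w))) = -(edgeOp c x z * edgeOp c y w) := by
      rw [edgeOp_mul_edgeOp, ← mul_assoc (c y), hc.anti hyz, neg_mul, mul_neg, mul_assoc]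
    rw [h0 y hyz, h0 w hzw.symm, e, mul_neg, Matrix.trace_neg, h1 _ (commute_edgeOp hc hxy hxw),
      trace_matchingState_edgeOp hc σ l hyw]
    push_cast; ring
  by_cases hwu : w = u
  · subst hwu
    have e : -(c x * (c y * (c z * c w))) = edgeOp c x w * edgeOp c y z := by
      rw [edgeOp_mul_edgeOp, (hc.commute_pair hyw.symm hzw.symm).eq, mul_assoc]
    rw [h0 y hyw, h0 z hzw, e, h1 _ (commute_edgeOp hc hxy hxz),
      trace_matchingState_edgeOp hc σ l hyz]
    push_cast; ring
  rw [h0 y hyu, h0 z hzu, h0 w hwu, h2]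
  · simp
  · set W := c y * (c z * c w) with hW
    have a1 : c x * W = -(W * c x) := hc.anti_triple hxy hxz hxw
    have a2 : c u * W = -(W * c u) := hc.anti_triple (Ne.symm hyu) (Ne.symm hzu) (Ne.symm hwu)
    have b1 : c x * c u * (c x * W) = -(c u * W) := by
      rw [hc.anti hu, neg_mul, mul_assoc, ← mul_assoc (c x), hc.mul_self, one_mul]
    have b2 : c x * W * (c x * c u) = -(W * c u) := by
      rw [a1, neg_mul, mul_assoc, ← mul_assoc (c x), hc.mul_self, one_mul]
    rw [edgeOp, mul_neg, neg_mul, neg_neg, smul_mul_assoc, mul_smul_comm, b1, b2, a2]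
    simp

include hc in
lemma correlation_matchingState (x y : Fin (2 * n)) :
    correlation c (matchingState c σ l) x y = matchingCorr σ l x y := by
  rw [correlation]
  by_cases h : x = y
  · subst h
    obtain ⟨z, hz, h0, -⟩ := exists_partner hc σ l x
    rw [h0 x hz]
    simp
  · have e : (matchingState c σ l * edgeOp c x y).trace =
        Complex.I * (matchingState c σ l * (c x * c y)).trace := by
      rw [edgeOp, mul_smul_comm, Matrix.trace_smul, smul_eq_mul]
    rw [← trace_matchingState_edgeOp hc σ l h, e, hc.anti (Ne.symm h), sub_neg_eq_add, mul_add,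
      Matrix.trace_add]
    ring

end

end Matching

/-! ### Matching states are Gaussian states and density matrices -/

section Gaussian

variable {n : ℕ} {c : Fin (2 * n) → FockMatrix n}

/-- The relabelling `σ` is realized by a permutation matrix. To get determinant `1`, row `0` is
multiplied by the sign of `σ`, and this sign is undone in the weight of the pair that contains index
`0`. -/
lemma isGaussianState_matchingState (c : Fin (2 * n) → FockMatrix n)
    (σ : Equiv.Perm (Fin (2 * n))) {l : Fin n → ℝ} (hl : ∀ j, l j ∈ Set.Icc (-1 : ℝ) 1) :
    IsGaussianState c (matchingState c σ l) := by
  set ε : ℝ := ((Equiv.Perm.sign σ : ℤ) : ℝ) with hε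
  have hε2 : ε * ε = 1 := by
    rw [hε, ← Int.cast_mul, ← Units.val_mul, Int.units_mul_self]; simp
  set s : Fin (2 * n) → ℝ := fun i => if i.val = 0 then ε else 1 with hs
  have hs2 : ∀ i, s i * s i = 1 := by
    intro i; simp only [hs]; split_ifs <;> simp [hε2]
  have hs1 : ∀ i, |s i| = 1 := fun i => by
    rw [← Real.sqrt_mul_self_eq_abs, hs2, Real.sqrt_one]
  set R : Matrix (Fin (2 * n)) (Fin (2 * n)) ℝ := Matrix.diagonal s * σ.permMatrix ℝ with hR
  have hRij : ∀ i j, R i j = if σ i = j then s i else 0 := by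
    intro i j
    rw [hR, Matrix.diagonal_mul]
    simp [Equiv.Perm.permMatrix, PEquiv.toMatrix_apply, eq_comm]
  have hdet : R.det = 1 := by
    rw [hR, Matrix.det_mul, Matrix.det_diagonal, Matrix.det_permutation]
    rcases Nat.eq_zero_or_pos n with rfl | hn
    -- For `n = 0` there is no row to correct, but then `σ` is trivial.
    · have : σ = 1 := Equiv.ext fun i => absurd i.isLt (by omega)
      simp [this]
    · rw [Finset.prod_eq_single (⟨0, by omega⟩ : Fin (2 * n))]
      · simpa [hs] using hε2
      · intro i _ hi
        have : i.val ≠ 0 := fun h => hi (Fin.ext h)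
        simp [hs, this]
      · simp
  have hRot : ∀ i, rotate R c i = (s i : ℂ) • c (σ i) := by
    intro i
    rw [rotate, Finset.sum_eq_single (σ i)]
    · rw [hRij, if_pos rfl]
    · intro j _ hj
      rw [hRij, if_neg hj.symm]; simp
    · simp
  refine ⟨R, ?_, fun j => l j * (s (evenIdx j) * s (oddIdx j)), fun j => ?_, ?_⟩
  · rw [Matrix.mem_specialOrthogonalGroup_iff, Matrix.mem_orthogonalGroup_iff]
    refine ⟨?_, hdet⟩
    ext i j
    rw [Matrix.mul_apply, Finset.sum_eq_single (σ i)]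
    · change R i (σ i) * R j (σ i) = _
      rw [hRij, hRij, if_pos rfl, Matrix.one_apply]
      by_cases hij : i = j
      · subst hij; simp [hs2]
      · have : σ j ≠ σ i := fun h => hij (σ.injective h).symm
        simp [hij, this]
    · intro k _ hk
      rw [hRij, if_neg hk.symm, zero_mul]
    · simp
  · rw [Set.mem_Icc, ← abs_le, abs_mul, abs_mul, hs1, hs1, mul_one, mul_one]
    exact abs_le.2 (hl j)
  · rw [matchingState, pairProd, List.ofFn_eq_map]
    congr 2
    refine List.map_congr_left fun j _ => ?_
    congr 1
    change _ = (Complex.I * _) • (rotate R c (evenIdx j) * rotate R c (oddIdx j))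
    rw [hRot, hRot, smul_mul_smul_comm, smul_smul, pairOp, edgeOp, smul_smul]
    congr 1
    have h1 : ((s (evenIdx j) * s (evenIdx j) : ℝ) : ℂ) = 1 := by rw [hs2]; simp
    have h2 : ((s (oddIdx j) * s (oddIdx j) : ℝ) : ℂ) = 1 := by rw [hs2]; simp
    push_cast at h1 h2 ⊢
    linear_combination (-(l j : ℂ) * Complex.I * (s (oddIdx j) * s (oddIdx j))) * h1 -
      (l j : ℂ) * Complex.I * h2

open scoped ComplexOrder in
-- Each factor `1 + l P` is the square of a Hermitian `B`, which has the values `√(1 ± l)` where `P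
-- = ±1` and commutes with the other factors. Multiplying by the factor is therefore conjugation by
-- `B`.
lemma posSemidef_pairProd (hc : IsMajoranaSystem n c) (σ : Equiv.Perm (Fin (2 * n)))
    {l : Fin n → ℝ} (hl : ∀ j, l j ∈ Set.Icc (-1 : ℝ) 1) (L : List (Fin n)) :
    (pairProd c σ l L).PosSemidef := by
  induction L with
  | nil => simpa [pairProd] using Matrix.PosSemidef.one
  | cons j L ih =>
    set P := pairOp c σ j with hP
    have hPL : Commute P (pairProd c σ l L) :=
      commute_pairProd σ l fun i _ => pairOp_commute hc σ j i
    set u := √(1 + l j)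
    set v := √(1 - l j)
    have hu : u * u = 1 + l j := Real.mul_self_sqrt (by linarith [(hl j).1])
    have hv : v * v = 1 - l j := Real.mul_self_sqrt (by linarith [(hl j).2])
    set B : FockMatrix n := (((u + v) / 2 : ℝ) : ℂ) • 1 + (((u - v) / 2 : ℝ) : ℂ) • P with hB
    have hBH : B.conjTranspose = B := by
      rw [hB, Matrix.conjTranspose_add, Matrix.conjTranspose_smul, Matrix.conjTranspose_smul,
        Matrix.conjTranspose_one, hP, pairOp, (edgeOp_isHermitian hc (perm_ne σ j)).eq]
      simp
    have hBB : B * B = 1 + (l j : ℂ) • P := by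
      have hPP : P * P = 1 := pairOp_mul_self hc σ j
      rw [hB, add_mul, mul_add, mul_add, smul_mul_smul_comm, smul_mul_smul_comm,
        smul_mul_smul_comm, smul_mul_smul_comm, hPP, one_mul, mul_one, one_mul]
      have h1 : (((u + v) / 2 : ℝ) : ℂ) * (((u + v) / 2 : ℝ) : ℂ) +
          (((u - v) / 2 : ℝ) : ℂ) * (((u - v) / 2 : ℝ) : ℂ) = 1 := by
        rw [← Complex.ofReal_mul, ← Complex.ofReal_mul, ← Complex.ofReal_add, ← Complex.ofReal_one]
        congr 1
        linarith
      have h2 : (((u + v) / 2 : ℝ) : ℂ) * (((u - v) / 2 : ℝ) : ℂ) +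
          (((u - v) / 2 : ℝ) : ℂ) * (((u + v) / 2 : ℝ) : ℂ) = (l j : ℂ) := by
        rw [← Complex.ofReal_mul, ← Complex.ofReal_mul, ← Complex.ofReal_add]
        congr 1
        linarith
      rw [← h2]
      conv_rhs => rw [← one_smul ℂ (1 : FockMatrix n), ← h1, add_smul, add_smul]
      abel
    have hBL : Commute B (pairProd c σ l L) :=
      ((Commute.one_left _).smul_left _).add_left (hPL.smul_left _)
    have := ih.mul_mul_conjTranspose_same B
    rw [hBH, hBL.eq, mul_assoc, hBB, ← (show Commute (1 + (l j : ℂ) • P) (pairProd c σ l L) from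
      (Commute.one_left _).add_left (hPL.smul_left _)).eq] at this
    exact this

open scoped ComplexOrder in
lemma isDensityMatrix_matchingState (hc : IsMajoranaSystem n c) (σ : Equiv.Perm (Fin (2 * n)))
    {l : Fin n → ℝ} (hl : ∀ j, l j ∈ Set.Icc (-1 : ℝ) 1) :
    IsDensityMatrix (matchingState c σ l) := by
  refine ⟨(posSemidef_pairProd hc σ hl _).smul ?_, trace_matchingState hc σ l⟩
  rw [← Complex.ofReal_ofNat, ← Complex.ofReal_pow, ← Complex.ofReal_inv, Complex.zero_le_real]
  positivity

/-! ### Energies -/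

lemma exists_sort_eq (I : Interaction n) : ∃ x y z w : Fin (2 * n),
    x < y ∧ y < z ∧ z < w ∧ I.1.sort (· ≤ ·) = [x, y, z, w] := by
  have hlen : (I.1.sort (· ≤ ·)).length = 4 := by rw [Finset.length_sort, I.2]
  have hs : (I.1.sort (· ≤ ·)).Pairwise (· < ·) := (Finset.sortedLT_sort I.1).pairwise
  obtain ⟨x, y, z, w, h⟩ := List.length_eq_four.1 hlen
  rw [h] at hs
  simp at hs
  exact ⟨x, y, z, w, by tauto, by tauto, by tauto, h⟩

lemma majoranaMonomial_eq (c : Fin (2 * n) → FockMatrix n) {I : Interaction n}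
    {x y z w : Fin (2 * n)} (h : I.1.sort (· ≤ ·) = [x, y, z, w]) :
    majoranaMonomial c I.1 = -(c x * (c y * (c z * c w))) := by
  rw [majoranaMonomial, I.2, h]
  simp

lemma four_mul_self (hc : IsMajoranaSystem n c) {x y z w : Fin (2 * n)} (hxy : x ≠ y) (hxz : x ≠ z)
    (hxw : x ≠ w) (hyz : y ≠ z) (hyw : y ≠ w) (hzw : z ≠ w) :
    edgeOp c x y * edgeOp c z w * (edgeOp c x y * edgeOp c z w) = 1 := by
  rw [mul_assoc, ← mul_assoc (edgeOp c z w), ← (edgeOp_commute_edgeOp hc hxz hxw hyz hyw).eq,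
    mul_assoc, edgeOp_mul_self hc hzw, mul_one, edgeOp_mul_self hc hxy]

open scoped ComplexOrder in
-- From `X² = 1` follows `(1 ± X)² = 2 (1 ± X)`, so `1 ± X` is positive semidefinite.
lemma abs_trace_mul_le {X ρ : FockMatrix n} (hX : X.IsHermitian) (hXX : X * X = 1)
    (hρ : IsDensityMatrix ρ) : |(X * ρ).trace.re| ≤ 1 := by
  have key : ∀ s : ℝ, s * s = 1 → 0 ≤ 1 + s * (X * ρ).trace.re := by
    intro s hs
    set B : FockMatrix n := 1 + (s : ℂ) • X with hB
    have hBH : B.conjTranspose = B := by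
      rw [hB, Matrix.conjTranspose_add, Matrix.conjTranspose_smul, Matrix.conjTranspose_one, hX.eq]
      simp
    have hs' : (s : ℂ) * s = 1 := by exact_mod_cast hs
    have hBB : B * B = (2 : ℂ) • B := by
      rw [hB, add_mul, mul_add, mul_add, smul_mul_smul_comm, hXX, hs', one_mul, mul_one, one_mul,
        two_smul, one_smul]
      abel
    have h1 := (hρ.1.mul_mul_conjTranspose_same B).trace_nonneg
    rw [hBH, Matrix.trace_mul_comm, ← mul_assoc, hBB, smul_mul_assoc, Matrix.trace_smul, hB,
      add_mul, one_mul, Matrix.trace_add, hρ.2, smul_mul_assoc, Matrix.trace_smul] at h1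
    have h2 := (Complex.le_def.1 h1).1
    simp at h2
    linarith
  rw [abs_le]
  have h1 := key 1 (by norm_num)
  have h2 := key (-1) (by norm_num)
  constructor <;> linarith

lemma abs_trace_majoranaMonomial_le (hc : IsMajoranaSystem n c) (I : Interaction n)
    {ρ : FockMatrix n} (hρ : IsDensityMatrix ρ) : |(majoranaMonomial c I.1 * ρ).trace.re| ≤ 1 := by
  obtain ⟨x, y, z, w, hxy, hyz, hzw, h⟩ := exists_sort_eq I
  have hxz := hxy.trans hyz
  have hyw := hyz.trans hzw
  have hxw := hxz.trans hzw
  rw [majoranaMonomial_eq c h, ← edgeOp_mul_edgeOp]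
  refine abs_trace_mul_le ?_
    (four_mul_self hc hxy.ne hxz.ne hxw.ne hyz.ne hyw.ne hzw.ne) hρ
  exact ((edgeOp_isHermitian hc hxy.ne).commute_iff (edgeOp_isHermitian hc hzw.ne)).1
    (edgeOp_commute_edgeOp hc hxz.ne hxw.ne hyz.ne hyw.ne)

lemma trace_hamiltonian_mul (c : Fin (2 * n) → FockMatrix n) (h : Interaction n → ℝ)
    (ρ : FockMatrix n) :
    (hamiltonian c h * ρ).trace.re = ∑ I, h I * (majoranaMonomial c I.1 * ρ).trace.re := by
  rw [hamiltonian, Finset.sum_mul, Matrix.trace_sum, Complex.re_sum]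
  refine Finset.sum_congr rfl fun I _ => ?_
  rw [smul_mul_assoc, Matrix.trace_smul, smul_eq_mul, Complex.re_ofReal_mul]

lemma trace_hamiltonian_le (hc : IsMajoranaSystem n c) (h : Interaction n → ℝ)
    {ρ : FockMatrix n} (hρ : IsDensityMatrix ρ) :
    (hamiltonian c h * ρ).trace.re ≤ ∑ I, |h I| := by
  rw [trace_hamiltonian_mul]
  refine Finset.sum_le_sum fun I _ => ?_
  calc _ ≤ |h I * (majoranaMonomial c I.1 * ρ).trace.re| := le_abs_self _
    _ ≤ |h I| * 1 := by
      rw [abs_mul]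
      exact mul_le_mul_of_nonneg_left (abs_trace_majoranaMonomial_le hc I hρ) (abs_nonneg _)
    _ = |h I| := mul_one _

/-- The state `ρ` only serves to make the set under the supremum nonempty. -/
lemma lambdaMax_le (hc : IsMajoranaSystem n c) (h : Interaction n → ℝ)
    {ρ : FockMatrix n} (hρ : IsDensityMatrix ρ) : lambdaMax (hamiltonian c h) ≤ ∑ I, |h I| := by
  refine csSup_le ⟨_, ρ, hρ, rfl⟩ ?_
  rintro x ⟨ρ', hρ', rfl⟩
  exact trace_hamiltonian_le hc h hρ'

lemma le_lambdaMax (hc : IsMajoranaSystem n c) (h : Interaction n → ℝ)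
    {ρ : FockMatrix n} (hρ : IsDensityMatrix ρ) :
    (hamiltonian c h * ρ).trace.re ≤ lambdaMax (hamiltonian c h) := by
  refine le_csSup ⟨∑ I, |h I|, ?_⟩ ⟨ρ, hρ, rfl⟩
  rintro x ⟨ρ', hρ', rfl⟩
  exact trace_hamiltonian_le hc h hρ'

end Gaussian

/-! ### Correlation matrices of lists of weighted edges -/

section EdgeList

/-- The antisymmetric matrix with entry `e.2.2` at `(e.1, e.2.1)`. -/
def edgeMat (e : ℕ × ℕ × ℝ) (x y : ℕ) : ℝ :=
  e.2.2 * ((if x = e.1 ∧ y = e.2.1 then 1 else 0) - (if x = e.2.1 ∧ y = e.1 then 1 else 0))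

/-- The sum of the matrices of weighted edges. -/
def listCorr (es : List (ℕ × ℕ × ℝ)) (x y : ℕ) : ℝ := (es.map fun e => edgeMat e x y).sum

/-- The end points of edges. -/
def endpoints (es : List (ℕ × ℕ × ℝ)) : List ℕ := es.flatMap fun e => [e.1, e.2.1]

@[simp] lemma endpoints_cons (e : ℕ × ℕ × ℝ) (es : List (ℕ × ℕ × ℝ)) :
    endpoints (e :: es) = e.1 :: e.2.1 :: endpoints es := rfl

@[simp] lemma listCorr_cons (e : ℕ × ℕ × ℝ) (es : List (ℕ × ℕ × ℝ)) (x y : ℕ) :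
    listCorr (e :: es) x y = edgeMat e x y + listCorr es x y := by
  simp [listCorr]

lemma listCorr_eq_zero {es : List (ℕ × ℕ × ℝ)} {x : ℕ} (hx : x ∉ endpoints es) (y : ℕ) :
    listCorr es x y = 0 := by
  induction es with
  | nil => simp [listCorr]
  | cons e es ih =>
    simp only [endpoints_cons, List.mem_cons, not_or] at hx
    rw [listCorr_cons, ih hx.2.2, edgeMat]
    simp [hx.1, hx.2.1]

/-- With distinct end points at most one edge contributes to an entry, so entries are `0` or `±1`.
This justifies that the program multiplies by signs of entries instead of by the entries. -/
lemma sign_listCorr {es : List (ℕ × ℕ × ℝ)} (hes : (endpoints es).Nodup)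
    (hw : ∀ e ∈ es, e.2.2 = 1 ∨ e.2.2 = -1) (x y : ℕ) :
    Real.sign (listCorr es x y) = listCorr es x y := by
  induction es with
  | nil => simp [listCorr]
  | cons e es ih =>
    simp only [endpoints_cons, List.nodup_cons, List.mem_cons, not_or] at hes
    rw [listCorr_cons]
    by_cases hx : x = e.1 ∨ x = e.2.1
    · have h0 : listCorr es x y = 0 := by
        rcases hx with rfl | rfl
        · exact listCorr_eq_zero hes.1.2 y
        · exact listCorr_eq_zero hes.2.1 y
      have hne := hes.1.1
      rw [h0, add_zero, edgeMat]
      have hw' : Real.sign e.2.2 = e.2.2 ∧ Real.sign (-e.2.2) = -e.2.2 := by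
        rcases hw e (by simp) with h | h <;> simp [h, Real.sign_neg]
      by_cases hA : x = e.1 ∧ y = e.2.1
      · have hB : ¬ (x = e.2.1 ∧ y = e.1) := fun hB => hne (hA.1.symm.trans hB.1)
        rw [if_pos hA, if_neg hB, sub_zero, mul_one, hw'.1]
      · by_cases hB : x = e.2.1 ∧ y = e.1
        · rw [if_neg hA, if_pos hB, zero_sub, mul_neg, mul_one, hw'.2]
        · simp [if_neg hA, if_neg hB]
    · rw [not_or] at hx
      have h0 : edgeMat e x y = 0 := by simp [edgeMat, hx.1, hx.2]
      rw [h0, zero_add]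
      exact ih hes.2.2 fun e' he' => hw e' (by simp [he'])

lemma length_endpoints (es : List (ℕ × ℕ × ℝ)) : (endpoints es).length = 2 * es.length := by
  induction es with
  | nil => rfl
  | cons e es ih => simp [ih]; ring

lemma endpoints_getElem? (es : List (ℕ × ℕ × ℝ)) (j : ℕ) :
    (endpoints es)[2 * j]? = es[j]?.map (fun e => e.1) ∧
      (endpoints es)[2 * j + 1]? = es[j]?.map (fun e => e.2.1) := by
  induction es generalizing j with
  | nil => simp [endpoints]
  | cons e es ih =>
    cases j with
    | zero => simp
    | succ j =>
      have := ih j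
      rw [show 2 * (j + 1) = 2 * j + 1 + 1 by ring]
      simpa using this

lemma sum_range_getElem? (es : List (ℕ × ℕ × ℝ)) (f : ℕ × ℕ × ℝ → ℝ) {N : ℕ}
    (hN : es.length ≤ N) : ∑ j ∈ Finset.range N, es[j]?.elim 0 f = (es.map f).sum := by
  induction es generalizing N with
  | nil => simp
  | cons e es ih =>
    obtain ⟨M, rfl⟩ : ∃ M, N = M + 1 := ⟨N - 1, by simp at hN; omega⟩
    rw [Finset.sum_range_succ', List.map_cons, List.sum_cons, ← ih (by simpa using hN)]
    simp [add_comm]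

/-- The end points fill the first positions `0, 1, 2, …` injectively, and this partial map extends
to a permutation. The pairs beyond the list get weight `0`: these modes are maximally mixed. -/
lemma exists_matchingCorr_eq {n : ℕ} {es : List (ℕ × ℕ × ℝ)} (hes : (endpoints es).Nodup)
    (hlt : ∀ v ∈ endpoints es, v < 2 * n) (hw : ∀ e ∈ es, e.2.2 = 1 ∨ e.2.2 = -1) :
    ∃ (σ : Equiv.Perm (Fin (2 * n))) (l : Fin n → ℝ), (∀ j, l j ∈ Set.Icc (-1 : ℝ) 1) ∧
      ∀ x y : Fin (2 * n), matchingCorr σ l x y = listCorr es x y := by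
  have hlen := length_endpoints es
  have hle : es.length ≤ n := by
    have h1 : (endpoints es).toFinset ⊆ Finset.range (2 * n) := fun v hv => by
      simpa using hlt v (by simpa using hv)
    have h2 := Finset.card_le_card h1
    rw [List.toFinset_card_of_nodup hes, Finset.card_range] at h2
    omega
  let g : {i : Fin (2 * n) // i.val < 2 * es.length} → Fin (2 * n) := fun i =>
    ⟨(endpoints es)[i.1.val]'(by rw [hlen]; exact i.2), hlt _ (List.getElem_mem _)⟩
  have hg : Function.Injective g := by
    intro i j hij
    have := (List.Nodup.getElem_inj_iff hes).1 (congrArg Fin.val hij)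
    exact Subtype.ext (Fin.ext this)
  classical
  let σ : Equiv.Perm (Fin (2 * n)) := (Equiv.ofInjective g hg).extendSubtype
  have hσ : ∀ (i : Fin (2 * n)) (hi : i.val < 2 * es.length),
      (σ i).val = (endpoints es)[i.val]'(by rw [hlen]; exact hi) := by
    intro i hi
    have := Equiv.extendSubtype_apply_of_mem (Equiv.ofInjective g hg) i hi
    change ((Equiv.ofInjective g hg).extendSubtype i).val = _
    rw [this]
    rfl
  refine ⟨σ, fun j => es[j.val]?.elim 0 fun e => e.2.2, fun j => ?_, fun x y => ?_⟩
  · change es[j.val]?.elim 0 (fun e => e.2.2) ∈ _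
    rcases h : es[j.val]? with _ | e
    · simp
    · rcases hw e (List.mem_of_getElem? h) with h' | h' <;> simp [h']
  · rw [listCorr, ← sum_range_getElem? es _ hle, ← Fin.sum_univ_eq_sum_range
      (fun j => es[j]?.elim 0 fun e => edgeMat e x y), matchingCorr]
    refine Finset.sum_congr rfl fun j _ => ?_
    rcases h : es[j.val]? with _ | e
    · simp
    · have hj : j.val < es.length := (List.getElem?_eq_some_iff.1 h).1
      have h1 : (σ (evenIdx j)).val = e.1 := by
        rw [hσ _ (by simp only [evenIdx]; omega)]
        have := (endpoints_getElem? es j.val).1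
        rw [h, List.getElem?_eq_getElem (by omega)] at this
        simpa [evenIdx] using this
      have h2 : (σ (oddIdx j)).val = e.2.1 := by
        rw [hσ _ (by simp only [oddIdx]; omega)]
        have := (endpoints_getElem? es j.val).2
        rw [h, List.getElem?_eq_getElem (by omega)] at this
        simpa [oddIdx] using this
      simp only [Option.elim_some, edgeMat, Fin.ext_iff, h1, h2]

end EdgeList

/-! ### The energy of a correlation matrix -/

section Energy

/-- The energy `∑ h_{xyzw} Pf_{xyzw}(Γ)`. -/
def energy (N : ℕ) (h : Quad → ℝ) (Γ : ℕ → ℕ → ℝ) : ℝ :=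
  ∑ x ∈ Finset.range N, ∑ y ∈ Finset.range N, ∑ z ∈ Finset.range N, ∑ w ∈ Finset.range N,
    h (x, y, z, w) * pf Γ x y z w

/-- The `4 × 4` Pfaffian is a quadratic form in the matrix, so its linear combinations obey the
parallelogram law. -/
lemma energy_add_add_energy_sub (N : ℕ) (h : Quad → ℝ) (Γ Δ : ℕ → ℕ → ℝ) :
    energy N h (fun x y => Γ x y + Δ x y) + energy N h (fun x y => Γ x y - Δ x y) =
      2 * energy N h Γ + 2 * energy N h Δ := by
  simp only [energy, Finset.mul_sum, ← Finset.sum_add_distrib]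
  refine Finset.sum_congr rfl fun x _ => Finset.sum_congr rfl fun y _ =>
    Finset.sum_congr rfl fun z _ => Finset.sum_congr rfl fun w _ => ?_
  simp only [pf]
  ring

/-- For an increasing quadruple, the second and third Pfaffian terms need two crossing or nested
edges, but the edges `ia` and `bc` span disjoint intervals. The first term survives only at `(i, a,
b, c)` itself. -/
lemma energy_two_edges {N : ℕ} {h : Quad → ℝ}
    (hh : ∀ x y z w, h (x, y, z, w) ≠ 0 → x < y ∧ y < z ∧ z < w) {i a b c : ℕ} (hia : i < a)
    (hab : a < b) (hbc : b < c) (hcN : c < N) (ε : ℝ) :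
    energy N h (fun x y => edgeMat (i, a, 1) x y + edgeMat (b, c, ε) x y) = h (i, a, b, c) * ε := by
  set Δ : ℕ → ℕ → ℝ := fun x y => edgeMat (i, a, 1) x y + edgeMat (b, c, ε) x y with hΔ
  have h3 : ∀ u v, u < v → Δ u v = 0 ∧ ¬ (u = i ∧ v = a) ∧ ¬ (u = b ∧ v = c) ∨
      (u = i ∧ v = a ∧ Δ u v = 1) ∨ (u = b ∧ v = c ∧ Δ u v = ε) := by
    intro u v huv
    have e1 : ¬ (u = a ∧ v = i) := by omega
    have e2 : ¬ (u = c ∧ v = b) := by omega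
    by_cases h1 : u = i ∧ v = a
    · have h2 : ¬ (u = b ∧ v = c) := by omega
      right; left
      refine ⟨h1.1, h1.2, ?_⟩
      simp only [hΔ, edgeMat, if_pos h1, if_neg h2, if_neg e1, if_neg e2]; ring
    · by_cases h2 : u = b ∧ v = c
      · right; right
        refine ⟨h2.1, h2.2, ?_⟩
        simp only [hΔ, edgeMat, if_neg h1, if_pos h2, if_neg e1, if_neg e2]; ring
      · left
        refine ⟨?_, h1, h2⟩
        simp only [hΔ, edgeMat, if_neg h1, if_neg h2, if_neg e1, if_neg e2]; ring
  have key : ∀ x y z w, h (x, y, z, w) * pf Δ x y z w =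
      if x = i then if y = a then if z = b then if w = c then h (i, a, b, c) * ε
        else 0 else 0 else 0 else 0 := by
    intro x y z w
    by_cases h0 : h (x, y, z, w) = 0
    · rw [h0, zero_mul]
      split_ifs with e1 e2 e3 e4
      · subst e1 e2 e3 e4; rw [h0, zero_mul]
      all_goals rfl
    · obtain ⟨hxy, hyz, hzw⟩ := hh x y z w h0
      have t2 : Δ x z * Δ y w = 0 := by
        rcases h3 x z (by omega) with h1 | h1 | h1 <;> rcases h3 y w (by omega) with h2 | h2 | h2
        all_goals first
          | (rw [h1.1, zero_mul])
          | (rw [h2.1, mul_zero])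
          | omega
      have t3 : Δ x w * Δ y z = 0 := by
        rcases h3 x w (by omega) with h1 | h1 | h1 <;> rcases h3 y z (by omega) with h2 | h2 | h2
        all_goals first
          | (rw [h1.1, zero_mul])
          | (rw [h2.1, mul_zero])
          | omega
      rw [pf, t2, t3, sub_zero, add_zero]
      by_cases hq : x = i ∧ y = a ∧ z = b ∧ w = c
      · obtain ⟨rfl, rfl, rfl, rfl⟩ := hq
        have e1 : Δ x y = 1 := by
          rcases h3 x y hxy with h1 | h1 | h1
          · exact absurd ⟨rfl, rfl⟩ h1.2.1
          · exact h1.2.2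
          · omega
        have e2 : Δ z w = ε := by
          rcases h3 z w hzw with h1 | h1 | h1
          · exact absurd ⟨rfl, rfl⟩ h1.2.2
          · omega
          · exact h1.2.2
        simp [e1, e2]
      · have t1 : Δ x y * Δ z w = 0 := by
          rcases h3 x y (by omega) with h1 | h1 | h1 <;> rcases h3 z w (by omega) with h2 | h2 | h2
          all_goals first
            | (rw [h1.1, zero_mul])
            | (rw [h2.1, mul_zero])
            | omega
        rw [t1, mul_zero]
        split_ifs with e1 e2 e3 e4
        · exact absurd ⟨e1, e2, e3, e4⟩ hq
        all_goals rfl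
  simp only [energy, key]
  have hi : i < N := by omega
  have ha : a < N := by omega
  have hb : b < N := by omega
  simp [Finset.sum_ite_irrel, hi, ha, hb, hcN]

end Energy

/-! ### Coefficients as a function of quadruples -/

section Coefficients

variable {n : ℕ}

/-- The quadruple of the elements of an interaction in increasing order. -/
def quadOf (I : Interaction n) : Quad :=
  match (I.1.sort (· ≤ ·)).map Fin.val with
  | [x, y, z, w] => (x, y, z, w)
  | _ => (0, 0, 0, 0)

lemma quadOf_eq {I : Interaction n} {x y z w : Fin (2 * n)}
    (h : I.1.sort (· ≤ ·) = [x, y, z, w]) : quadOf I = (x.val, y.val, z.val, w.val) := by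
  simp [quadOf, h]

lemma map_sort_eq_iff (I : Interaction n) (x y z w : ℕ) :
    (I.1.sort (· ≤ ·)).map Fin.val = [x, y, z, w] ↔ quadOf I = (x, y, z, w) := by
  obtain ⟨a, b, c, d, -, -, -, h⟩ := exists_sort_eq I
  rw [quadOf_eq h, h]
  simp

lemma quadOf_injective : Function.Injective (quadOf (n := n)) := by
  intro I I' h
  obtain ⟨a, b, c, d, -, -, -, hI⟩ := exists_sort_eq I
  obtain ⟨a', b', c', d', -, -, -, hI'⟩ := exists_sort_eq I'
  rw [quadOf_eq hI, quadOf_eq hI'] at h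
  simp only [Prod.mk.injEq, Fin.val_inj] at h
  obtain ⟨rfl, rfl, rfl, rfl⟩ := h
  apply Subtype.ext
  rw [← Finset.sort_toFinset I.1 (· ≤ ·), ← Finset.sort_toFinset I'.1 (· ≤ ·), hI, hI']

lemma exists_quadOf_eq {x y z w : ℕ} (hxy : x < y) (hyz : y < z) (hzw : z < w) (hw : w < 2 * n) :
    ∃ I : Interaction n, quadOf I = (x, y, z, w) := by
  let X : Fin (2 * n) := ⟨x, by omega⟩
  let Y : Fin (2 * n) := ⟨y, by omega⟩
  let Z : Fin (2 * n) := ⟨z, by omega⟩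
  let W : Fin (2 * n) := ⟨w, hw⟩
  have hs : [X, Y, Z, W].Pairwise (· < ·) := by
    simp [X, Y, Z, W]; omega
  have hnd : [X, Y, Z, W].Nodup := hs.imp fun h => h.ne
  refine ⟨⟨[X, Y, Z, W].toFinset, by rw [List.toFinset_card_of_nodup hnd]; rfl⟩, ?_⟩
  have : [X, Y, Z, W].toFinset.sort (· ≤ ·) = [X, Y, Z, W] :=
    (List.toFinset_sort (· ≤ ·) hnd).2 (hs.imp fun h => h.le)
  exact quadOf_eq (I := ⟨[X, Y, Z, W].toFinset, _⟩) this

/-- The coefficient of a quadruple, `0` if it is not increasing. -/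
noncomputable def quadCoeff (h : Interaction n → ℝ) (q : Quad) : ℝ :=
  ∑ I, if quadOf I = q then h I else 0

lemma inputState_real_one (k : ℝ) (h : Interaction n → ℝ) (x y z w : ℕ) :
    (inputState n k h).real 1 [x, y, z, w] = quadCoeff h (x, y, z, w) := by
  simp only [inputState, quadCoeff, map_sort_eq_iff]
  simp

lemma quadCoeff_quadOf (h : Interaction n → ℝ) (I : Interaction n) :
    quadCoeff h (quadOf I) = h I := by
  rw [quadCoeff, Finset.sum_eq_single I]
  · simp
  · intro J _ hJ
    rw [if_neg fun e => hJ (quadOf_injective e)]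
  · simp

lemma exists_of_quadCoeff_ne_zero {h : Interaction n → ℝ} {q : Quad} (hq : quadCoeff h q ≠ 0) :
    ∃ I, quadOf I = q ∧ h I ≠ 0 := by
  obtain ⟨I, -, hI⟩ := Finset.exists_ne_zero_of_sum_ne_zero hq
  by_cases hIq : quadOf I = q
  · exact ⟨I, hIq, by simpa [hIq] using hI⟩
  · simp [hIq] at hI

lemma quadOf_lt (I : Interaction n) : (quadOf I).1 < (quadOf I).2.1 ∧
    (quadOf I).2.1 < (quadOf I).2.2.1 ∧ (quadOf I).2.2.1 < (quadOf I).2.2.2 ∧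
    (quadOf I).2.2.2 < 2 * n := by
  obtain ⟨a, b, c, d, h1, h2, h3, h⟩ := exists_sort_eq I
  rw [quadOf_eq h]
  exact ⟨h1, h2, h3, d.isLt⟩

lemma energy_quadCoeff (h : Interaction n → ℝ) (Γ : ℕ → ℕ → ℝ) :
    energy (2 * n) (quadCoeff h) Γ = ∑ I, h I *
      pf Γ (quadOf I).1 (quadOf I).2.1 (quadOf I).2.2.1 (quadOf I).2.2.2 := by
  simp only [energy, quadCoeff, Finset.sum_mul]
  simp only [Finset.sum_comm (t := (Finset.univ : Finset (Interaction n)))]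
  refine Finset.sum_congr rfl fun I _ => ?_
  obtain ⟨h1, h2, h3, h4⟩ := quadOf_lt I
  generalize quadOf I = q at h1 h2 h3 h4 ⊢
  obtain ⟨a, b, c, d⟩ := q
  simp only at h1 h2 h3 h4
  have key : ∀ x y z w, (if (a, b, c, d) = (x, y, z, w) then h I else 0) * pf Γ x y z w =
      if a = x then if b = y then if c = z then if d = w then h I * pf Γ a b c d
        else 0 else 0 else 0 else 0 := by
    intro x y z w
    simp only [Prod.mk.injEq]
    by_cases e1 : a = x <;> by_cases e2 : b = y <;> by_cases e3 : c = z <;> by_cases e4 : d = w <;>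
      simp [e1, e2, e3, e4]
  simp only [key]
  have ha : a < 2 * n := by omega
  have hb : b < 2 * n := by omega
  have hc : c < 2 * n := by omega
  simp [Finset.sum_ite_irrel, ha, hb, hc, h4]

lemma trace_hamiltonian_matchingState {c : Fin (2 * n) → FockMatrix n}
    (hc : IsMajoranaSystem n c) (h : Interaction n → ℝ) (σ : Equiv.Perm (Fin (2 * n)))
    (l : Fin n → ℝ) {Γ : ℕ → ℕ → ℝ} (hΓ : ∀ x y : Fin (2 * n), matchingCorr σ l x y = Γ x y) :
    (hamiltonian c h * matchingState c σ l).trace.re = energy (2 * n) (quadCoeff h) Γ := by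
  rw [trace_hamiltonian_mul, energy_quadCoeff]
  refine Finset.sum_congr rfl fun I _ => ?_
  obtain ⟨x, y, z, w, hxy, hyz, hzw, hs⟩ := exists_sort_eq I
  have hxz := hxy.trans hyz
  have hyw := hyz.trans hzw
  have hxw := hxz.trans hzw
  rw [majoranaMonomial_eq c hs, Matrix.trace_mul_comm,
    trace_matchingState_four hc σ l hxy.ne hxz.ne hxw.ne hyz.ne hyw.ne hzw.ne, quadOf_eq hs,
    Complex.ofReal_re]
  simp only [pf, hΓ]

end Coefficients

/-! ### Frames and running times of programs -/

namespace Program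

/-- The program does not write to the natural array `a`. -/
def NatFree (a : ℕ) : Program → Prop
  | skip => True
  | natSet b _ _ => b ≠ a
  | realSet _ _ _ => True
  | seq p q => p.NatFree a ∧ q.NatFree a
  | ite _ p q => p.NatFree a ∧ q.NatFree a
  | loop x _ p => x ≠ a ∧ p.NatFree a

/-- The program does not write to the real array `a`. -/
def RealFree (a : ℕ) : Program → Prop
  | skip => True
  | natSet _ _ _ => True
  | realSet b _ _ => b ≠ a
  | seq p q => p.RealFree a ∧ q.RealFree a
  | ite _ p q => p.RealFree a ∧ q.RealFree a
  | loop _ _ p => p.RealFree a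

/-- The state and the number of steps after `m` rounds of the loop body `p`, starting from `r`. -/
noncomputable def iterate (x : ℕ) (p : Program) (r : State × ℕ) (m : ℕ) : State × ℕ :=
  Nat.rec (motive := fun _ => State × ℕ) r
    (fun i r => ((p.exec (r.1.setNat x [] i)).1, r.2 + 1 + (p.exec (r.1.setNat x [] i)).2)) m

lemma exec_loop (x : ℕ) (e : NatExpr) (p : Program) (s : State) :
    (loop x e p).exec s = iterate x p (s, 1 + e.cost) (e.eval s) := rfl

lemma iterate_succ (x : ℕ) (p : Program) (r : State × ℕ) (m : ℕ) :
    iterate x p r (m + 1) = ((p.exec ((iterate x p r m).1.setNat x [] m)).1,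
      (iterate x p r m).2 + 1 + (p.exec ((iterate x p r m).1.setNat x [] m)).2) := rfl

lemma exec_loop_induction {x : ℕ} {e : NatExpr} {p : Program} {s : State} (P : ℕ → State → Prop)
    (h0 : P 0 s) (hs : ∀ i < e.eval s, ∀ s', P i s' → P (i + 1) (p.exec (s'.setNat x [] i)).1) :
    P (e.eval s) ((loop x e p).exec s).1 := by
  rw [exec_loop]
  have key : ∀ m ≤ e.eval s, P m (iterate x p (s, 1 + e.cost) m).1 := by
    intro m
    induction m with
    | zero => intro _; exact h0
    | succ m ih => intro hm; exact hs m hm _ (ih (by omega))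
  exact key _ le_rfl

lemma NatFree.exec {a : ℕ} {p : Program} (hp : p.NatFree a) (s : State) :
    (p.exec s).1.nat a = s.nat a := by
  induction p generalizing s with
  | skip => rfl
  | natSet b xs e =>
    ext j
    simp [Program.exec, State.setNat, Ne.symm hp]
  | realSet b xs e => rfl
  | seq p q ihp ihq => exact (ihq hp.2 _).trans (ihp hp.1 s)
  | ite t p q ihp ihq =>
    by_cases h : t.Holds s
    · simpa [Program.exec, h] using ihp hp.1 s
    · simpa [Program.exec, h] using ihq hp.2 s
  | loop x e p ih =>
    refine exec_loop_induction (P := fun _ s' => s'.nat a = s.nat a) rfl fun i _ s' hs' => ?_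
    rw [ih hp.2, ← hs']
    ext j
    simp [State.setNat, Ne.symm hp.1]

lemma RealFree.exec {a : ℕ} {p : Program} (hp : p.RealFree a) (s : State) :
    (p.exec s).1.real a = s.real a := by
  induction p generalizing s with
  | skip => rfl
  | natSet b xs e => rfl
  | realSet b xs e =>
    ext j
    simp [Program.exec, State.setReal, Ne.symm hp]
  | seq p q ihp ihq => exact (ihq hp.2 _).trans (ihp hp.1 s)
  | ite t p q ihp ihq =>
    by_cases h : t.Holds s
    · simpa [Program.exec, h] using ihp hp.1 s
    · simpa [Program.exec, h] using ihq hp.2 s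
  | loop x e p ih =>
    refine exec_loop_induction (P := fun _ s' => s'.real a = s.real a) rfl fun i _ s' hs' => ?_
    rw [ih hp, ← hs']
    rfl

end Program

/-- The number `2 n` of Majorana operators. -/
def twoN : NatExpr := .add (.get 0 []) (.get 0 [])

lemma twoN_eval (s : State) : twoN.eval s = 2 * s.nat 0 [] := by
  simp [twoN, NatExpr.eval, State.index, two_mul]

namespace Program

/-- All loops of the program run over the Majorana operators. -/
def LoopsBounded : Program → Prop
  | skip => True
  | natSet _ _ _ => True
  | realSet _ _ _ => True
  | seq p q => p.LoopsBounded ∧ q.LoopsBounded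
  | ite _ p q => p.LoopsBounded ∧ q.LoopsBounded
  | loop _ e p => e = twoN ∧ p.LoopsBounded

/-- A bound on the number of steps of a program with bounded loops. -/
noncomputable def costPoly : Program → Polynomial ℕ
  | skip => 1
  | natSet _ xs e => .C (1 + xs.length + e.cost)
  | realSet _ xs e => .C (1 + xs.length + e.cost)
  | seq p q => p.costPoly + q.costPoly
  | ite t p q => .C (1 + t.cost) + p.costPoly + q.costPoly
  | loop _ e p => .C (1 + e.cost) + 2 * .X * (1 + p.costPoly)

/-- The scalar `n` is never overwritten, so every loop, however deeply nested, has exactly `2 n`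
rounds; the rest is structural induction. -/
lemma exec_snd_le {p : Program} (hp : p.LoopsBounded) (h0 : p.NatFree 0) (s : State) :
    (p.exec s).2 ≤ p.costPoly.eval (s.nat 0 []) := by
  induction p generalizing s with
  | skip => simp [Program.exec, costPoly]
  | natSet b xs e => simp [Program.exec, costPoly]
  | realSet b xs e => simp [Program.exec, costPoly]
  | seq p q ihp ihq =>
    have h1 := ihp hp.1 h0.1 s
    have h2 := ihq hp.2 h0.2 (p.exec s).1
    rw [h0.1.exec s] at h2
    simpa [Program.exec, costPoly] using add_le_add h1 h2
  | ite t p q ihp ihq =>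
    have h1 := ihp hp.1 h0.1 s
    have h2 := ihq hp.2 h0.2 s
    by_cases h : t.Holds s
    · simp only [Program.exec, costPoly, h, if_true, Polynomial.eval_add, Polynomial.eval_C]
      omega
    · simp only [Program.exec, costPoly, h, if_false, Polynomial.eval_add, Polynomial.eval_C]
      omega
  | loop x e p ih =>
    obtain ⟨rfl, hp⟩ := hp
    rw [exec_loop]
    have key : ∀ m, (iterate x p (s, 1 + twoN.cost) m).1.nat 0 [] = s.nat 0 [] ∧
        (iterate x p (s, 1 + twoN.cost) m).2 ≤
          1 + twoN.cost + m * (1 + p.costPoly.eval (s.nat 0 [])) := by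
      intro m
      induction m with
      | zero => exact ⟨rfl, by simp [iterate]⟩
      | succ m ihm =>
        rw [iterate_succ]
        have hn : ((iterate x p (s, 1 + twoN.cost) m).1.setNat x [] m).nat 0 [] = s.nat 0 [] := by
          rw [← ihm.1]
          simp [State.setNat, Ne.symm h0.1]
        refine ⟨?_, ?_⟩
        · rw [h0.2.exec, hn]
        · have := ih hp h0.2 ((iterate x p (s, 1 + twoN.cost) m).1.setNat x [] m)
          rw [hn] at this
          have h2 := ihm.2
          rw [add_mul, one_mul]
          simp only
          omega
    have := (key (twoN.eval s)).2
    rw [twoN_eval] at this ⊢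
    simpa [costPoly] using this

end Program

/-! ### The program -/

/-- The real number `0`. -/
def realZero : RealExpr := .ofNat (.const 0)

/-- Set the real scalar `5` to `e` times the sign of `y`. -/
def signMul (e y : RealExpr) : Program :=
  .ite (.realLt realZero y) (.realSet 5 [] e)
    (.ite (.realLt y realZero) (.realSet 5 [] (.sub realZero e)) (.realSet 5 [] realZero))

/-- Replaces multiplication, which the machine does not have, when one factor is known to be `0` or
`±1`. -/
lemma exec_signMul (e y : RealExpr) (s : State) :
    ((signMul e y).exec s).1 = s.setReal 5 [] (e.eval s * Real.sign (y.eval s)) := by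
  simp only [signMul, Program.exec, Test.Holds, realZero, RealExpr.eval, NatExpr.eval,
    Nat.cast_zero, State.index, List.map_nil, zero_sub]
  rcases lt_trichotomy (y.eval s) 0 with h | h | h
  · rw [if_neg h.not_gt, if_pos h, Real.sign_of_neg h, mul_neg_one]
  · rw [h, if_neg (lt_irrefl _), if_neg (lt_irrefl _), Real.sign_zero, mul_zero]
  · rw [if_pos h, Real.sign_of_pos h, mul_one]

/-- Add the energy of one quadruple to the real scalar `3`. -/
def energyTerm : Program :=
  .seq (signMul (.get 1 [6, 7, 8, 9]) (.get 2 [6, 7])) <|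
  .seq (signMul (.get 5 []) (.get 2 [8, 9])) <|
  .seq (.realSet 3 [] (.add (.get 3 []) (.get 5 []))) <|
  .seq (signMul (.get 1 [6, 7, 8, 9]) (.get 2 [6, 8])) <|
  .seq (signMul (.get 5 []) (.get 2 [7, 9])) <|
  .seq (.realSet 3 [] (.sub (.get 3 []) (.get 5 []))) <|
  .seq (signMul (.get 1 [6, 7, 8, 9]) (.get 2 [6, 9])) <|
  .seq (signMul (.get 5 []) (.get 2 [7, 8])) <|
  .realSet 3 [] (.add (.get 3 []) (.get 5 []))

/-- Compute the energy of the matrix in the real array `2` in the real scalar `3`. -/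
def energyProg : Program :=
  .seq (.realSet 3 [] realZero) <|
    .loop 6 twoN <| .loop 7 twoN <| .loop 8 twoN <| .loop 9 twoN energyTerm

/-- The coefficients stored in the memory. -/
noncomputable def State.coeff (s : State) (q : Quad) : ℝ := s.real 1 [q.1, q.2.1, q.2.2.1, q.2.2.2]

/-- The matrix stored in the memory. -/
noncomputable def State.corr (s : State) (x y : ℕ) : ℝ := s.real 2 [x, y]

/-- The entrywise signs of the matrix stored in the memory. -/
noncomputable def State.signCorr (s : State) (x y : ℕ) : ℝ := Real.sign (s.corr x y)

lemma exec_energyTerm (s : State) : (energyTerm.exec s).1.real 3 [] = s.real 3 [] +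
    s.coeff (s.nat 6 [], s.nat 7 [], s.nat 8 [], s.nat 9 []) *
      pf s.signCorr (s.nat 6 []) (s.nat 7 []) (s.nat 8 []) (s.nat 9 []) := by
  simp only [energyTerm, Program.exec, exec_signMul, RealExpr.eval, State.setReal, State.index,
    List.map_cons, List.map_nil, State.coeff, State.signCorr, State.corr, pf]
  simp
  ring

/-- The states agree on the real arrays `1` and `2` and on the natural scalars below `x`. -/
def SameBelow (x : ℕ) (s s' : State) : Prop :=
  s'.real 1 = s.real 1 ∧ s'.real 2 = s.real 2 ∧ ∀ a < x, s'.nat a [] = s.nat a []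

/-- The increment `G` depends only on the real arrays `1`, `2` and the counters up to `x`, none of
which the body changes; so the rounds simply add up. Applied from the inside out, this gives the
fourfold sum of the energy. -/
lemma exec_loop_sum {x : ℕ} {p : Program} (hN : ∀ a < x + 1, p.NatFree a) (h1 : p.RealFree 1)
    (h2 : p.RealFree 2) {G : State → ℝ}
    (hp : ∀ s, (p.exec s).1.real 3 [] = s.real 3 [] + G s)
    (hG : ∀ s s', SameBelow (x + 1) s s' → G s' = G s) (s : State) :
    ((Program.loop x twoN p).exec s).1.real 3 [] =
      s.real 3 [] + ∑ i ∈ Finset.range (2 * s.nat 0 []), G (s.setNat x [] i) := by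
  rw [← twoN_eval]
  refine (Program.exec_loop_induction (P := fun m s' => SameBelow x s s' ∧
    s'.real 3 [] = s.real 3 [] + ∑ i ∈ Finset.range m, G (s.setNat x [] i)) ?_ ?_).2
  · exact ⟨⟨rfl, rfl, fun _ _ => rfl⟩, by simp⟩
  · rintro i _ s' ⟨⟨e1, e2, e3⟩, e4⟩
    refine ⟨⟨?_, ?_, fun a ha => ?_⟩, ?_⟩
    · rw [h1.exec]; exact e1
    · rw [h2.exec]; exact e2
    · rw [(hN a (by omega)).exec, ← e3 a ha]
      simp [State.setNat, ha.ne]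
    · rw [hp, Finset.sum_range_succ, ← add_assoc, ← e4]
      congr 1
      refine hG _ _ ⟨e1, e2, fun a ha => ?_⟩
      by_cases hax : a = x
      · simp [State.setNat, hax]
      · simp only [State.setNat, hax, false_and, if_false]
        exact e3 a (by omega)

lemma SameBelow.coeff {x : ℕ} {s s' : State} (h : SameBelow x s s') : s'.coeff = s.coeff := by
  funext q; simp [State.coeff, h.1]

lemma SameBelow.signCorr {x : ℕ} {s s' : State} (h : SameBelow x s s') :
    s'.signCorr = s.signCorr := by
  funext u v; simp [State.signCorr, State.corr, h.2.1]

lemma exec_energyProg (s : State) : (energyProg.exec s).1.real 3 [] =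
    energy (2 * s.nat 0 []) s.coeff s.signCorr := by
  have nf : ∀ a < 10, energyTerm.NatFree a := fun a _ => by
    simp [energyTerm, signMul, Program.NatFree]
  have r1 : energyTerm.RealFree 1 := by simp [energyTerm, signMul, Program.RealFree]
  have r2 : energyTerm.RealFree 2 := by simp [energyTerm, signMul, Program.RealFree]
  have l9 := exec_loop_sum (x := 9) nf r1 r2 exec_energyTerm fun s s' h => by
    rw [h.coeff, h.signCorr, h.2.2 6 (by norm_num), h.2.2 7 (by norm_num), h.2.2 8 (by norm_num),
      h.2.2 9 (by norm_num)]
  have l8 := exec_loop_sum (x := 8) (p := .loop 9 twoN energyTerm)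
    (fun a ha => ⟨by omega, nf a (by omega)⟩) r1 r2 l9 fun s s' h => by
      simp only [State.setNat, State.coeff, State.signCorr, State.corr, h.1, h.2.1, pf]
      simp [h.2.2]
  have l7 := exec_loop_sum (x := 7) (p := .loop 8 twoN (.loop 9 twoN energyTerm))
    (fun a ha => ⟨by omega, by omega, nf a (by omega)⟩) r1 r2 l8 fun s s' h => by
      simp only [State.setNat, State.coeff, State.signCorr, State.corr, h.1, h.2.1, pf]
      simp [h.2.2]
  have l6 := exec_loop_sum (x := 6) (p := .loop 7 twoN (.loop 8 twoN (.loop 9 twoN energyTerm)))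
    (fun a ha => ⟨by omega, by omega, by omega, nf a (by omega)⟩) r1 r2 l7
    fun s s' h => by
      simp only [State.setNat, State.coeff, State.signCorr, State.corr, h.1, h.2.1, pf]
      simp [h.2.2]
  have := l6 (s.setReal 3 [] 0)
  simp only [energyProg, Program.exec.eq_4, Program.exec.eq_3, realZero, RealExpr.eval,
    NatExpr.eval, Nat.cast_zero, State.index, List.map_nil] at this ⊢
  rw [this]
  simp [State.setNat, State.setReal, energy, State.coeff, State.signCorr, State.corr, pf]

/-- Add `e` times an antisymmetric unit matrix to the matrix in the real array `2`. -/
def addEdge (x y : ℕ) (e : RealExpr) : Program :=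
  .seq (.realSet 2 [x, y] (.add (.get 2 [x, y]) e)) (.realSet 2 [y, x] (.sub (.get 2 [y, x]) e))

/-- The hypothesis `he` is needed because `e` is evaluated a second time after the first write to
the matrix. -/
lemma exec_addEdge {x y : ℕ} {e : RealExpr} {s : State} (hne : s.nat x [] ≠ s.nat y [])
    (he : ∀ idx v, e.eval (s.setReal 2 idx v) = e.eval s) (u v : ℕ) :
    ((addEdge x y e).exec s).1.corr u v =
      s.corr u v + edgeMat (s.nat x [], s.nat y [], e.eval s) u v := by
  simp only [addEdge, Program.exec, RealExpr.eval, State.corr, he, edgeMat]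
  by_cases h1 : u = s.nat x [] ∧ v = s.nat y []
  · obtain ⟨rfl, rfl⟩ := h1
    simp [State.setReal, State.index, hne]
  · by_cases h2 : u = s.nat y [] ∧ v = s.nat x []
    · obtain ⟨rfl, rfl⟩ := h2
      simp [State.setReal, State.index, hne, hne.symm, sub_eq_add_neg]
    · simp [State.setReal, State.index, h1, h2]

/-- Mark the vertices of the current quadruple as used. -/
def markProg : Program :=
  .seq (.natSet 1 [2] (.const 1)) <| .seq (.natSet 1 [3] (.const 1)) <|
    .seq (.natSet 1 [4] (.const 1)) (.natSet 1 [5] (.const 1))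

/-- Set the real scalar `4` to the sign of the current coefficient. -/
def signProg : Program :=
  .ite (.realLt realZero (.get 1 [2, 3, 4, 5])) (.realSet 4 [] (.ofNat (.const 1)))
    (.realSet 4 [] (.sub realZero (.ofNat (.const 1))))

/-- Add the two edges of the current quadruple with weights `e` and `f`. -/
def addPair (e f : RealExpr) : Program := .seq (addEdge 2 3 e) (addEdge 4 5 f)

/-- Pick the current quadruple: add its two edges with the better one of the two possible
orientations. -/
def pickProg : Program :=
  .seq markProg <| .seq signProg <|
  .seq (addPair (.ofNat (.const 1)) (.get 4 [])) <| .seq energyProg <|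
  .seq (.realSet 6 [] (.get 3 [])) <|
  .seq (addPair (.sub realZero (.ofNat (.const 2)))
    (.sub (.sub realZero (.get 4 [])) (.get 4 []))) <|
  .seq energyProg <|
  .ite (.realLt (.get 3 []) (.get 6 []))
    (addPair (.ofNat (.const 2)) (.add (.get 4 []) (.get 4 []))) .skip

lemma Program.exec_seq (p q : Program) (s : State) :
    ((Program.seq p q).exec s).1 = (q.exec (p.exec s).1).1 := rfl

lemma exec_markProg (s : State) (v : ℕ) : (markProg.exec s).1.nat 1 [v] =
    if v ∈ quadVerts (s.nat 2 [], s.nat 3 [], s.nat 4 [], s.nat 5 []) then 1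
    else s.nat 1 [v] := by
  simp only [markProg, Program.exec, State.setNat, State.index, NatExpr.eval, quadVerts]
  simp only [Finset.mem_insert, Finset.mem_singleton]
  simp
  split_ifs <;> simp_all

/-- The value `-1` at coefficient `0` is harmless: `pickTest` admits only nonzero coefficients. -/
lemma exec_signProg (s : State) : (signProg.exec s).1.real 4 [] =
    if 0 < s.coeff (s.nat 2 [], s.nat 3 [], s.nat 4 [], s.nat 5 []) then 1 else -1 := by
  simp only [signProg, Program.exec, Test.Holds, RealExpr.eval, realZero, NatExpr.eval,
    State.index, State.coeff, List.map_cons, List.map_nil, Nat.cast_zero]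
  by_cases h : 0 < s.real 1 [s.nat 2 [], s.nat 3 [], s.nat 4 [], s.nat 5 []] <;>
    simp [h, State.setReal]

lemma exec_addPair {e f : RealExpr} {s : State} (h23 : s.nat 2 [] ≠ s.nat 3 [])
    (h45 : s.nat 4 [] ≠ s.nat 5 [])
    (he : ∀ s' : State, s'.real 4 = s.real 4 → e.eval s' = e.eval s)
    (hf : ∀ s' : State, s'.real 4 = s.real 4 → f.eval s' = f.eval s) (u v : ℕ) :
    ((addPair e f).exec s).1.corr u v = s.corr u v +
      (edgeMat (s.nat 2 [], s.nat 3 [], e.eval s) u v +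
        edgeMat (s.nat 4 [], s.nat 5 [], f.eval s) u v) := by
  have hfr : ((addEdge 2 3 e).exec s).1.real 4 = s.real 4 :=
    Program.RealFree.exec (by simp [addEdge, Program.RealFree]) s
  have hn : ∀ a, ((addEdge 2 3 e).exec s).1.nat a = s.nat a := fun a =>
    Program.NatFree.exec (by simp [addEdge, Program.NatFree]) s
  have h1 := exec_addEdge h23 (fun idx v => he _ (by simp [State.setReal])) u v
  have h2 := exec_addEdge (x := 4) (y := 5) (e := f) (s := ((addEdge 2 3 e).exec s).1)
    (by simpa [hn] using h45)
    (fun idx v => (hf _ (by simpa [State.setReal] using hfr)).trans (hf _ hfr).symm) u v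
  rw [addPair, Program.exec_seq, h2, h1, hn, hn, hf _ hfr, add_assoc]

/-- The program evaluates `Γ + Δ`, passes to `Γ - Δ` by adding `-2Δ`, evaluates again, and adds `2Δ`
if this was worse. The hypotheses `hs1` and `hs2` ensure that the energies computed from entrywise
signs are those of the two matrices themselves. -/
lemma exec_pickProg {s : State} {n i a b c : ℕ} (hn : s.nat 0 [] = n) (h2 : s.nat 2 [] = i)
    (h3 : s.nat 3 [] = a) (h4 : s.nat 4 [] = b) (h5 : s.nat 5 [] = c) (hia : i ≠ a) (hbc : b ≠ c)
    {ε : ℝ} (hε : ε = if 0 < s.coeff (i, a, b, c) then 1 else -1) {Δ : ℕ → ℕ → ℝ}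
    (hΔ : ∀ u v, Δ u v = edgeMat (i, a, 1) u v + edgeMat (b, c, ε) u v)
    (hs1 : ∀ u v, Real.sign (s.corr u v + Δ u v) = s.corr u v + Δ u v)
    (hs2 : ∀ u v, Real.sign (s.corr u v - Δ u v) = s.corr u v - Δ u v) :
    (∀ v, (pickProg.exec s).1.nat 1 [v] =
      if v ∈ quadVerts (i, a, b, c) then 1 else s.nat 1 [v]) ∧
    ∃ t : ℝ, (t = 1 ∨ t = -1) ∧ (∀ u v, (pickProg.exec s).1.corr u v = s.corr u v + t * Δ u v) ∧
      energy (2 * n) s.coeff (fun u v => s.corr u v + Δ u v) ≤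
        energy (2 * n) s.coeff (pickProg.exec s).1.corr ∧
      energy (2 * n) s.coeff (fun u v => s.corr u v - Δ u v) ≤
        energy (2 * n) s.coeff (pickProg.exec s).1.corr := by
  have nfE : ∀ a < 6, energyProg.NatFree a := fun a ha => by
    simp [energyProg, energyTerm, signMul, Program.NatFree]; omega
  have nfP : ∀ a e f, (addPair e f).NatFree a := fun a e f => by
    simp [addPair, addEdge, Program.NatFree]
  have rfP : ∀ a e f, a ≠ 2 → (addPair e f).RealFree a := fun a e f ha => by
    simp [addPair, addEdge, Program.RealFree, ha.symm]
  have rfE : ∀ a, a ≠ 3 → a ≠ 5 → energyProg.RealFree a := fun a h3 h5 => by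
    simp [energyProg, energyTerm, signMul, Program.RealFree, h3.symm, h5.symm]
  obtain ⟨s1, e1⟩ : ∃ s1, s1 = (markProg.exec s).1 := ⟨_, rfl⟩
  have n1 : ∀ a, a ≠ 1 → s1.nat a = s.nat a := fun a ha => by
    rw [e1, Program.NatFree.exec (by simp [markProg, Program.NatFree, ha.symm])]
  have r1 : s1.real = s.real := by rw [e1]; rfl
  have u1 := exec_markProg s
  rw [← e1, h2, h3, h4, h5] at u1
  obtain ⟨s2, e2⟩ : ∃ s2, s2 = (signProg.exec s1).1 := ⟨_, rfl⟩
  have n2 : ∀ a, s2.nat a = s1.nat a := fun a => by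
    rw [e2, Program.NatFree.exec (by simp [signProg, Program.NatFree])]
  have r2 : ∀ a, a ≠ 4 → s2.real a = s.real a := fun a ha => by
    rw [e2, Program.RealFree.exec (by simp [signProg, Program.RealFree, ha.symm]), r1]
  have ε2 : s2.real 4 [] = ε := by
    rw [e2, exec_signProg, n1 2 (by norm_num), n1 3 (by norm_num), n1 4 (by norm_num),
      n1 5 (by norm_num), h2, h3, h4, h5, hε]
    simp only [State.coeff, r1]
    by_cases h : 0 < s.real 1 [i, a, b, c] <;> simp [h]
  have N2 : s2.nat 2 [] = i ∧ s2.nat 3 [] = a ∧ s2.nat 4 [] = b ∧ s2.nat 5 [] = c ∧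
      s2.nat 0 [] = n := by
    simp [n2, n1, h2, h3, h4, h5, hn]
  have pair : ∀ (s' : State) (e f : RealExpr), (∀ a < 6, s'.nat a = s2.nat a) →
      (∀ t : State, t.real 4 = s'.real 4 → e.eval t = e.eval s') →
      (∀ t : State, t.real 4 = s'.real 4 → f.eval t = f.eval s') → ∀ r : ℝ, e.eval s' = r →
      f.eval s' = r * ε → ∀ u v, ((addPair e f).exec s').1.corr u v = s'.corr u v + r * Δ u v := by
    intro s' e f hs' he hf r hr hrε u v
    rw [exec_addPair (by simpa [hs', N2] using hia) (by simpa [hs', N2] using hbc) he hf,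
      hs' 2 (by norm_num), hs' 3 (by norm_num), hs' 4 (by norm_num), hs' 5 (by norm_num),
      N2.1, N2.2.1, N2.2.2.1, N2.2.2.2.1, hr, hrε, hΔ]
    simp only [edgeMat]
    ring
  obtain ⟨s3, e3⟩ : ∃ s3, s3 = ((addPair (.ofNat (.const 1)) (.get 4 [])).exec s2).1 := ⟨_, rfl⟩
  have n3 : ∀ a, s3.nat a = s2.nat a := fun a => by rw [e3, (nfP a _ _).exec]
  have r3 : ∀ a, a ≠ 2 → s3.real a = s2.real a := fun a ha => by rw [e3, (rfP a _ _ ha).exec]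
  have c2 : s2.corr = s.corr := by funext u v; simp only [State.corr, r2 2 (by norm_num)]
  have c3 : s3.corr = fun u v => s.corr u v + Δ u v := by
    funext u v
    rw [e3, pair s2 _ _ (fun _ _ => rfl) (fun t ht => by simp [RealExpr.eval, NatExpr.eval])
      (fun t ht => by simp [RealExpr.eval, State.index, ht]) 1
      (by simp [RealExpr.eval, NatExpr.eval]) (by simp [RealExpr.eval, State.index, ε2]), c2,
      one_mul]
  obtain ⟨s4, e4⟩ : ∃ s4, s4 = (energyProg.exec s3).1 := ⟨_, rfl⟩
  have n4 : ∀ a < 6, s4.nat a = s2.nat a := fun a ha => by rw [e4, (nfE a ha).exec, n3]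
  have r4 : ∀ a, a ≠ 3 → a ≠ 5 → s4.real a = s3.real a := fun a h h' => by
    rw [e4, (rfE a h h').exec]
  have k3 : s3.coeff = s.coeff := by
    funext q; simp only [State.coeff, r3 1 (by norm_num), r2 1 (by norm_num)]
  have E4 : s4.real 3 [] = energy (2 * n) s.coeff (fun u v => s.corr u v + Δ u v) := by
    rw [e4, exec_energyProg, n3, N2.2.2.2.2, k3]
    congr 1
    funext u v
    rw [State.signCorr, c3, hs1]
  obtain ⟨s5, e5⟩ : ∃ s5, s5 = ((Program.realSet 6 [] (.get 3 [])).exec s4).1 := ⟨_, rfl⟩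
  have n5 : s5.nat = s4.nat := by rw [e5]; rfl
  have r5 : ∀ a, a ≠ 6 → s5.real a = s4.real a := fun a ha => by
    rw [e5, Program.RealFree.exec (by simpa [Program.RealFree] using ha.symm)]
  have E5 : s5.real 6 [] = s4.real 3 [] := by
    rw [e5]; simp [Program.exec, RealExpr.eval, State.setReal, State.index]
  have ε5 : s5.real 4 [] = ε := by
    rw [r5 4 (by norm_num), r4 4 (by norm_num) (by norm_num), r3 4 (by norm_num), ε2]
  obtain ⟨s6, e6⟩ : ∃ s6, s6 = ((addPair (.sub realZero (.ofNat (.const 2)))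
    (.sub (.sub realZero (.get 4 [])) (.get 4 []))).exec s5).1 := ⟨_, rfl⟩
  have n6 : ∀ a < 6, s6.nat a = s2.nat a := fun a ha => by rw [e6, (nfP a _ _).exec, n5, n4 a ha]
  have r6 : ∀ a, a ≠ 2 → s6.real a = s5.real a := fun a ha => by rw [e6, (rfP a _ _ ha).exec]
  have c5 : s5.corr = s3.corr := by
    funext u v; simp only [State.corr, r5 2 (by norm_num), r4 2 (by norm_num) (by norm_num)]
  have c6 : s6.corr = fun u v => s.corr u v - Δ u v := by
    funext u v
    rw [e6, pair s5 _ _ (fun a ha => by rw [n5, n4 a ha])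
      (fun t ht => by simp [RealExpr.eval, NatExpr.eval, realZero])
      (fun t ht => by simp [RealExpr.eval, NatExpr.eval, State.index, ht, realZero]) (-2)
      (by simp [RealExpr.eval, NatExpr.eval, realZero])
      (by simp [RealExpr.eval, NatExpr.eval, State.index, ε5, realZero]; ring), c5, c3]
    ring
  obtain ⟨s7, e7⟩ : ∃ s7, s7 = (energyProg.exec s6).1 := ⟨_, rfl⟩
  have n7 : ∀ a < 6, s7.nat a = s2.nat a := fun a ha => by rw [e7, (nfE a ha).exec, n6 a ha]
  have r7 : ∀ a, a ≠ 3 → a ≠ 5 → s7.real a = s6.real a := fun a h h' => by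
    rw [e7, (rfE a h h').exec]
  have k6 : s6.coeff = s.coeff := by
    rw [← k3]; funext q
    simp only [State.coeff, r6 1 (by norm_num), r5 1 (by norm_num),
      r4 1 (by norm_num) (by norm_num)]
  have E7 : s7.real 3 [] = energy (2 * n) s.coeff (fun u v => s.corr u v - Δ u v) := by
    rw [e7, exec_energyProg, n6 0 (by norm_num), N2.2.2.2.2, k6]
    congr 1
    funext u v
    rw [State.signCorr, c6, hs2]
  have c7 : s7.corr = s6.corr := by
    funext u v; simp only [State.corr, r7 2 (by norm_num) (by norm_num)]
  have E7' : s7.real 6 [] = s4.real 3 [] := by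
    rw [r7 6 (by norm_num) (by norm_num), r6 6 (by norm_num), E5]
  have ε7 : s7.real 4 [] = ε := by
    rw [r7 4 (by norm_num) (by norm_num), r6 4 (by norm_num), ε5]
  have hfin : (pickProg.exec s).1 = ((Program.ite (.realLt (.get 3 []) (.get 6 []))
      (addPair (.ofNat (.const 2)) (.add (.get 4 []) (.get 4 []))) .skip).exec s7).1 := by
    rw [e7, e6, e5, e4, e3, e2, e1]; rfl
  have u7 : s7.nat 1 = s1.nat 1 := by rw [n7 1 (by norm_num), n2]
  rw [hfin]
  by_cases hlt : s7.real 3 [] < s7.real 6 []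
  · have hb : ((Program.ite (.realLt (.get 3 []) (.get 6 []))
        (addPair (.ofNat (.const 2)) (.add (.get 4 []) (.get 4 []))) .skip).exec s7).1 =
        ((addPair (.ofNat (.const 2)) (.add (.get 4 []) (.get 4 []))).exec s7).1 := by
      rw [Program.exec]
      simp [Test.Holds, RealExpr.eval, State.index, hlt]
    have c8 : ((addPair (.ofNat (.const 2)) (.add (.get 4 []) (.get 4 []))).exec s7).1.corr =
        fun u v => s.corr u v + Δ u v := by
      funext u v
      rw [pair s7 _ _ n7 (fun t ht => by simp [RealExpr.eval, NatExpr.eval])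
        (fun t ht => by simp [RealExpr.eval, State.index, ht]) 2
        (by simp [RealExpr.eval, NatExpr.eval])
        (by simp [RealExpr.eval, State.index, ε7]; ring), c7, c6]
      ring
    rw [hb, c8]
    refine ⟨fun v => ?_, 1, Or.inl rfl, fun u v => by rw [one_mul], le_rfl, ?_⟩
    · rw [(nfP 1 _ _).exec, u7, u1]
    · rw [← E7, ← E4, ← E7']; exact hlt.le
  · have hb : ((Program.ite (.realLt (.get 3 []) (.get 6 []))
        (addPair (.ofNat (.const 2)) (.add (.get 4 []) (.get 4 []))) .skip).exec s7).1 = s7 := by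
      rw [Program.exec]
      simp [Test.Holds, RealExpr.eval, State.index, hlt, Program.exec]
    rw [hb, c7, c6]
    refine ⟨fun v => by rw [u7, u1], -1, Or.inr rfl, fun u v => by ring, ?_, le_rfl⟩
    rw [← E7, ← E4, ← E7']; exact not_lt.1 hlt

/-- Eight times a natural number. -/
def eightTimes (e : NatExpr) : NatExpr :=
  .add (.add (.add e e) (.add e e)) (.add (.add e e) (.add e e))

/-- The current quadruple has the right form and a nonzero coefficient, and its vertices are
unused. -/
def pickTest : Test :=
  .and (.natLt (eightTimes (.get 2 [])) (.get 0 [])) <|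
  .and (.not (.natLt (eightTimes (.get 3 [])) (.get 0 []))) <|
  .and (.not (.and (.not (.realLt realZero (.get 1 [2, 3, 4, 5])))
    (.not (.realLt (.get 1 [2, 3, 4, 5]) realZero)))) <|
  .and (.natEq (.get 1 [2]) (.const 0)) <| .and (.natEq (.get 1 [3]) (.const 0)) <|
  .and (.natEq (.get 1 [4]) (.const 0)) (.natEq (.get 1 [5]) (.const 0))

/-- Pick the current quadruple if possible. -/
def bodyProg : Program := .ite pickTest pickProg .skip

/-- The algorithm. -/
def algorithm : Program :=
  .loop 2 twoN <| .loop 3 twoN <| .loop 4 twoN <| .loop 5 twoN bodyProg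

lemma pickTest_holds (s : State) : pickTest.Holds s ↔
    8 * s.nat 2 [] < s.nat 0 [] ∧ s.nat 0 [] ≤ 8 * s.nat 3 [] ∧
    s.coeff (s.nat 2 [], s.nat 3 [], s.nat 4 [], s.nat 5 []) ≠ 0 ∧
    s.nat 1 [s.nat 2 []] = 0 ∧ s.nat 1 [s.nat 3 []] = 0 ∧ s.nat 1 [s.nat 4 []] = 0 ∧
    s.nat 1 [s.nat 5 []] = 0 := by
  have h8 : ∀ m : ℕ, m + m + (m + m) + (m + m + (m + m)) = 8 * m := fun m => by ring
  have hr : ∀ r : ℝ, ¬ (r ≤ 0 ∧ 0 ≤ r) ↔ r ≠ 0 := fun r => not_congr le_antisymm_iff.symm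
  simp only [pickTest, Test.Holds, eightTimes, NatExpr.eval, RealExpr.eval, realZero, State.index,
    List.map_cons, List.map_nil, State.coeff, Nat.cast_zero, h8, not_lt, hr]

/-! ### The loop invariant and the running time of the algorithm -/

variable {n : ℕ}

/-- The quadruples selected by the algorithm if their vertices are unused. -/
def Selects (h : Interaction n → ℝ) (q : Quad) : Prop :=
  8 * q.1 < n ∧ n ≤ 8 * q.2.1 ∧ quadCoeff h q ≠ 0

/-- The quadruples in `L` that the algorithm picks. -/
noncomputable def picks (h : Interaction n → ℝ) (L : List Quad) : List Quad :=
  greedy quadVerts (Selects h) L ∅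

lemma quadCoeff_ne_zero_lt {h : Interaction n → ℝ} {q : Quad} (hq : quadCoeff h q ≠ 0) :
    q.1 < q.2.1 ∧ q.2.1 < q.2.2.1 ∧ q.2.2.1 < q.2.2.2 ∧ q.2.2.2 < 2 * n := by
  obtain ⟨I, rfl, -⟩ := exists_of_quadCoeff_ne_zero hq
  exact quadOf_lt I

/-- The invariant of the algorithm: the state of the memory after treating the quadruples in `L`. -/
def Invariant (h : Interaction n → ℝ) (L : List Quad) (s : State) : Prop :=
  s.nat 0 [] = n ∧ s.coeff = quadCoeff h ∧
  (∀ v, s.nat 1 [v] = if v ∈ cover quadVerts (picks h L) then 1 else 0) ∧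
  ∃ es, (∀ x y, s.corr x y = listCorr es x y) ∧ (endpoints es).Nodup ∧
    (∀ v, v ∈ endpoints es ↔ v ∈ cover quadVerts (picks h L)) ∧
    (∀ e ∈ es, e.2.2 = 1 ∨ e.2.2 = -1) ∧
    ((picks h L).map fun q => |quadCoeff h q|).sum ≤ energy (2 * n) (quadCoeff h) s.corr

lemma invariant_setNat {h : Interaction n → ℝ} {L : List Quad} {s : State} (hs : Invariant h L s)
    {x : ℕ} (hx : 2 ≤ x) (i : ℕ) : Invariant h L (s.setNat x [] i) := by
  obtain ⟨h1, h2, h3, h4⟩ := hs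
  refine ⟨?_, h2, fun v => ?_, h4⟩
  · simp only [State.setNat]
    rw [if_neg (by omega)]; exact h1
  · simp only [State.setNat]
    rw [if_neg (by simp)]; exact h3 v

lemma invariant_bodyProg {h : Interaction n → ℝ} {L : List Quad} {s : State}
    (hs : Invariant h L s) {i a b c : ℕ} (h2 : s.nat 2 [] = i) (h3 : s.nat 3 [] = a)
    (h4 : s.nat 4 [] = b) (h5 : s.nat 5 [] = c) :
    Invariant h (L ++ [(i, a, b, c)]) (bodyProg.exec s).1 := by
  classical
  obtain ⟨h0, hk, hu, es, hcorr, hnd, hmem, hw, hE⟩ := hs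
  have hu0 : ∀ v, s.nat 1 [v] = 0 ↔ v ∉ cover quadVerts (picks h L) := fun v => by
    rw [hu]; split_ifs with hv <;> simp [hv]
  have htest : pickTest.Holds s ↔ Selects h (i, a, b, c) ∧
      Disjoint (quadVerts (i, a, b, c)) (∅ ∪ cover quadVerts (picks h L)) := by
    rw [pickTest_holds, h0, h2, h3, h4, h5, hk, hu0, hu0, hu0, hu0, Finset.empty_union]
    simp only [Selects, quadVerts, Finset.disjoint_insert_left, Finset.disjoint_singleton_left,
      and_assoc]
  have happ := greedy_append_singleton quadVerts (Selects h) L (i, a, b, c) ∅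
  rw [← picks, ← picks] at happ
  by_cases ht : pickTest.Holds s
  · have hpick : picks h (L ++ [(i, a, b, c)]) = picks h L ++ [(i, a, b, c)] := by
      rw [happ, if_pos (htest.1 ht)]
    obtain ⟨⟨-, -, hne⟩, hdis⟩ := htest.1 ht
    obtain ⟨hia, hab, hbc, hcn⟩ := quadCoeff_ne_zero_lt hne
    simp only at hia hab hbc hcn
    have hexec : (bodyProg.exec s).1 = (pickProg.exec s).1 := by
      rw [bodyProg, Program.exec, if_pos ht]
    rw [hexec]
    set ε : ℝ := if 0 < s.coeff (i, a, b, c) then 1 else -1 with hε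
    have hε1 : ε = 1 ∨ ε = -1 := by rw [hε]; split_ifs <;> simp
    set Δ : ℕ → ℕ → ℝ := fun u v => edgeMat (i, a, 1) u v + edgeMat (b, c, ε) u v with hΔ
    have hEΔ : energy (2 * n) (quadCoeff h) Δ = |quadCoeff h (i, a, b, c)| := by
      rw [energy_two_edges (fun x y z w hq => ?_) hia hab hbc hcn, hε, hk]
      · split_ifs with hpos
        · rw [mul_one, abs_of_pos hpos]
        · rw [mul_neg_one, abs_of_nonpos (not_lt.1 hpos)]
      · have := quadCoeff_ne_zero_lt hq
        exact ⟨this.1, this.2.1, this.2.2.1⟩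
    -- The sign `t` flips both new edges together, so the product of their weights stays `ε`.
    set es' : ℝ → List (ℕ × ℕ × ℝ) := fun t => (i, a, t) :: (b, c, t * ε) :: es with hes'
    have hcorr' : ∀ t u v, s.corr u v + t * Δ u v = listCorr (es' t) u v := by
      intro t u v
      simp only [hes', hΔ, listCorr_cons, hcorr, edgeMat]
      ring
    have hfresh : i ∉ endpoints es ∧ a ∉ endpoints es ∧ b ∉ endpoints es ∧ c ∉ endpoints es := by
      simpa [quadVerts, hmem] using hdis
    have hnd' : ∀ t, (endpoints (es' t)).Nodup := by
      intro t
      simp only [hes', endpoints_cons, List.nodup_cons, List.mem_cons, not_or]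
      refine ⟨⟨by omega, by omega, by omega, hfresh.1⟩, ⟨by omega, by omega, hfresh.2.1⟩,
        ⟨by omega, hfresh.2.2.1⟩, hfresh.2.2.2, hnd⟩
    have hw' : ∀ t : ℝ, t = 1 ∨ t = -1 → ∀ e ∈ es' t, e.2.2 = 1 ∨ e.2.2 = -1 := by
      intro t ht e he
      simp only [hes', List.mem_cons] at he
      rcases he with rfl | rfl | he
      · exact ht
      · rcases ht with rfl | rfl <;> rcases hε1 with h | h <;> simp [h]
      · exact hw e he
    have hsign : ∀ t : ℝ, t = 1 ∨ t = -1 → ∀ u v,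
        Real.sign (s.corr u v + t * Δ u v) = s.corr u v + t * Δ u v := by
      intro t ht u v
      rw [hcorr', sign_listCorr (hnd' t) (hw' t ht)]
    obtain ⟨hused, t, ht1, hct, hE1, hE2⟩ := exec_pickProg h0 h2 h3 h4 h5 hia.ne hbc.ne hε
      (Δ := Δ) (fun _ _ => rfl)
      (fun u v => by simpa using hsign 1 (Or.inl rfl) u v)
      (fun u v => by simpa [← sub_eq_add_neg] using hsign (-1) (Or.inr rfl) u v)
    have hcover : cover quadVerts (picks h (L ++ [(i, a, b, c)])) =
        cover quadVerts (picks h L) ∪ quadVerts (i, a, b, c) := by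
      rw [hpick, cover_append]; simp
    refine ⟨?_, ?_, fun v => ?_, es' t, fun u v => by rw [hct, hcorr'], hnd' t, fun v => ?_,
      hw' t ht1, ?_⟩
    · rw [Program.NatFree.exec ?_, h0]
      simp [pickProg, markProg, signProg, addPair, addEdge, energyProg, energyTerm, signMul,
        Program.NatFree]
    · rw [← hk]
      funext q
      simp only [State.coeff]
      rw [Program.RealFree.exec ?_]
      simp [pickProg, markProg, signProg, addPair, addEdge, energyProg, energyTerm, signMul,
        Program.RealFree]
    · rw [hused, hu, hcover]
      by_cases hv : v ∈ quadVerts (i, a, b, c) <;> simp [hv]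
    · rw [hcover, Finset.mem_union, ← hmem]
      have hq : v ∈ quadVerts (i, a, b, c) ↔ v = i ∨ v = a ∨ v = b ∨ v = c := by
        simp [quadVerts]
      rw [hq, or_comm]
      simp only [hes', endpoints_cons, List.mem_cons, or_assoc]
    · rw [hpick, List.map_append, List.sum_append]
      -- The two trial energies add up to `2 E(Γ) + 2 |h|`, and the final energy is at least each of
      -- them, hence at least `E(Γ) + |h|`.
      have hpar := energy_add_add_energy_sub (2 * n) (quadCoeff h) s.corr Δ
      rw [hk] at hE1 hE2
      rw [hEΔ] at hpar
      simp only [List.map_cons, List.map_nil, List.sum_cons, List.sum_nil, add_zero]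
      linarith
  · have hpick : picks h (L ++ [(i, a, b, c)]) = picks h L := by
      rw [happ, if_neg fun h' => ht (htest.2 h'), List.append_nil]
    have hexec : (bodyProg.exec s).1 = s := by
      rw [bodyProg, Program.exec, if_neg ht, Program.exec]
    rw [hexec, Invariant, hpick]
    exact ⟨h0, hk, hu, es, hcorr, hnd, hmem, hw, hE⟩

/-- Round `i` treats the quadruples in `B i`. The third hypothesis on `s'` passes the values of the
outer counters down to the innermost body, which must know all four entries. -/
lemma invariant_loop {h : Interaction n → ℝ} {x : ℕ} (hx : 2 ≤ x) {p : Program} {s : State}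
    {L : List Quad} (hs : Invariant h L s) (B : ℕ → List Quad)
    (hp : ∀ i L (s' : State), Invariant h L s' → s'.nat x [] = i →
      (∀ a, p.NatFree a → a ≠ x → s'.nat a = s.nat a) → Invariant h (L ++ B i) (p.exec s').1) :
    Invariant h (L ++ (List.range (2 * n)).flatMap B) ((Program.loop x twoN p).exec s).1 := by
  have hN : twoN.eval s = 2 * n := by rw [twoN_eval, hs.1]
  rw [← hN]
  refine (Program.exec_loop_induction (P := fun m s' =>
    Invariant h (L ++ (List.range m).flatMap B) s' ∧
      ∀ a, p.NatFree a → a ≠ x → s'.nat a = s.nat a) ?_ ?_).1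
  · exact ⟨by simpa using hs, fun _ _ _ => rfl⟩
  · rintro i _ s' ⟨h1, h2⟩
    have h3 : ∀ a, p.NatFree a → a ≠ x → (s'.setNat x [] i).nat a = s.nat a := by
      intro a ha hax
      rw [← h2 a ha hax]
      ext j
      simp [State.setNat, hax]
    refine ⟨?_, fun a ha hax => by rw [ha.exec, h3 a ha hax]⟩
    rw [List.range_succ, List.flatMap_append, ← List.append_assoc]
    have := hp i _ _ (invariant_setNat h1 hx i) (by simp [State.setNat]) h3
    simpa using this

lemma natFree_bodyProg {a : ℕ} (h1 : a ≠ 1) (h6 : a < 6) : bodyProg.NatFree a := by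
  simp [bodyProg, pickProg, markProg, signProg, addPair, addEdge, energyProg, energyTerm, signMul,
    Program.NatFree]
  omega

lemma invariant_algorithm (k : ℝ) (h : Interaction n → ℝ) :
    Invariant h (quads n) (algorithm.exec (inputState n k h)).1 := by
  have hinit : Invariant h [] (inputState n k h) := by
    have hc : ∀ x y, (inputState n k h).corr x y = 0 := fun x y => by
      simp [State.corr, inputState]
    refine ⟨by simp [inputState], ?_, fun v => by simp [inputState, picks, greedy], [],
      fun x y => by simp [hc, listCorr], by simp [endpoints],
      fun v => by simp [endpoints, picks, greedy], by simp, ?_⟩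
    · funext q
      obtain ⟨x, y, z, w⟩ := q
      exact inputState_real_one k h x y z w
    · simp [picks, greedy, energy, pf, hc]
  have := invariant_loop (x := 2) le_rfl hinit (quadsFrom n)
    (p := .loop 3 twoN <| .loop 4 twoN <| .loop 5 twoN bodyProg) ?_
  · simpa [quads, algorithm] using this
  intro i L1 s1 hs1 e1 f1
  refine invariant_loop (x := 3) (by norm_num) hs1 _ ?_
  intro a L2 s2 hs2 e2 f2
  refine invariant_loop (x := 4) (by norm_num) hs2 _ ?_
  intro b L3 s3 hs3 e3 f3
  refine invariant_loop (x := 5) (by norm_num) hs3 _ ?_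
  intro c L4 s4 hs4 e4 f4
  have g43 : ∀ a, a ≠ 1 → a < 5 → s4.nat a = s3.nat a := fun a h1 h5 =>
    f4 a (natFree_bodyProg h1 (by omega)) (by omega)
  have g32 : ∀ a, a ≠ 1 → a < 4 → s3.nat a = s2.nat a := fun a h1 h5 =>
    f3 a ⟨by omega, natFree_bodyProg h1 (by omega)⟩ (by omega)
  have g21 : ∀ a, a ≠ 1 → a < 3 → s2.nat a = s1.nat a := fun a h1 h5 =>
    f2 a ⟨by omega, by omega, natFree_bodyProg h1 (by omega)⟩ (by omega)
  refine invariant_bodyProg hs4 ?_ ?_ ?_ e4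
  · rw [g43 2 (by norm_num) (by norm_num), g32 2 (by norm_num) (by norm_num),
      g21 2 (by norm_num) (by norm_num), e1]
  · rw [g43 3 (by norm_num) (by norm_num), g32 3 (by norm_num) (by norm_num), e2]
  · rw [g43 4 (by norm_num) (by norm_num), e3]

lemma runtime_algorithm_le (k : ℝ) (h : Interaction n → ℝ) :
    runtime algorithm n k h ≤ algorithm.costPoly.eval n := by
  have h1 : algorithm.LoopsBounded := by
    simp [algorithm, bodyProg, pickProg, markProg, signProg, addPair, addEdge, energyProg,
      energyTerm, signMul, Program.LoopsBounded]
  have h2 : algorithm.NatFree 0 := by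
    simp [algorithm, bodyProg, pickProg, markProg, signProg, addPair, addEdge, energyProg,
      energyTerm, signMul, Program.NatFree]
  have := Program.exec_snd_le h1 h2 (inputState n k h)
  simpa [inputState, runtime] using this

/-! ### The picked interactions as a function of the random set of present interactions -/

section PickedInteractions

variable {n : ℕ}

open Classical in
/-- The quadruples picked by the algorithm if the interactions in `A` are present. -/
noncomputable def pickedQuads (A : Finset (Interaction n)) : List Quad :=
  greedy quadVerts (fun q => IsCandidate n q ∧ q ∈ A.image quadOf) (quads n) ∅

open Classical in
/-- The interactions picked by the algorithm if the interactions in `A` are present. -/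
noncomputable def picked (A : Finset (Interaction n)) : Finset (Interaction n) :=
  Finset.univ.filter fun I => quadOf I ∈ pickedQuads A

lemma nodup_pickedQuads (A : Finset (Interaction n)) : (pickedQuads A).Nodup :=
  nodup_greedy quadVerts_nonempty _ _ _

open Classical in
lemma image_picked (A : Finset (Interaction n)) :
    (picked A).image quadOf = (pickedQuads A).toFinset := by
  ext q
  simp only [picked, Finset.mem_image, Finset.mem_filter, Finset.mem_univ, true_and,
    List.mem_toFinset]
  constructor
  · rintro ⟨I, hI, rfl⟩
    exact hI
  · intro hq
    obtain ⟨I, -, rfl⟩ := Finset.mem_image.1 (mem_of_mem_greedy hq).1.2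
    exact ⟨I, hq, rfl⟩

lemma picked_subset (A : Finset (Interaction n)) : picked A ⊆ A := by
  classical
  intro I hI
  have hq : quadOf I ∈ pickedQuads A := (Finset.mem_filter.1 hI).2
  obtain ⟨I', hI', he⟩ := Finset.mem_image.1 (mem_of_mem_greedy hq).1.2
  rwa [← quadOf_injective he]

lemma card_picked (A : Finset (Interaction n)) : (picked A).card = (pickedQuads A).length := by
  classical
  rw [← List.toFinset_card_of_nodup (nodup_pickedQuads A), ← image_picked,
    Finset.card_image_of_injective _ quadOf_injective]

open Classical in
-- Every candidate is the quadruple of an interaction, so the random set can be transported to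
-- quadruples; those that are not candidates never influence the selection and are averaged out.
lemma subsetExp_picked (p φ : ℝ) :
    subsetExp p Finset.univ (fun A : Finset (Interaction n) => φ ^ (picked A).card) =
      greedyVal quadVerts p φ ((quads n).filter fun q => IsCandidate n q) ∅ := by
  set L := (quads n).filter fun q => IsCandidate n q with hL
  have hsub : L.toFinset ⊆ (Finset.univ : Finset (Interaction n)).image quadOf := by
    rintro ⟨x, y, z, w⟩ hq
    simp only [hL, List.mem_toFinset, List.mem_filter, decide_eq_true_eq] at hq
    obtain ⟨-, h1, h2, h3, h4, h5⟩ := hq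
    simp only at h1 h2 h3 h4 h5
    obtain ⟨I, hI⟩ := exists_quadOf_eq (n := n) (x := x) (y := y) (z := z) (w := w) (by omega)
      (by omega) (by omega) (by omega)
    exact Finset.mem_image.2 ⟨I, Finset.mem_univ _, hI⟩
  rw [← subsetExp_greedy quadVerts p φ ((nodup_quads n).filter _), ← subsetExp_mono_set p hsub,
    subsetExp_image p _ quadOf_injective]
  · refine subsetExp_congr p fun A _ => ?_
    rw [card_picked, pickedQuads, greedy_and]
  · intro a ha A
    have hne : ∀ r ∈ L, r ≠ a := by
      rintro r hr rfl
      exact ha (List.mem_toFinset.2 hr)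
    congr 2
    exact greedy_congr _ fun r hr => by simp [hne r hr]

variable {k : ℝ} {A : Finset (Interaction n)} {J : Interaction n → ℝ}

open Classical in
lemma abs_ssykCoeff (A : Finset (Interaction n)) (J : Interaction n → ℝ) (I : Interaction n) :
    |ssykCoeff k (presence A, J) I| =
      if I ∈ A then 1 / √(2 * k * n) * |J I| else 0 := by
  rw [ssykCoeff]
  by_cases hI : I ∈ A
  · simp only [presence, hI, if_true, one_mul, abs_mul]
    rw [abs_of_nonneg (by positivity)]
  · simp [presence, hI]

open Classical in
-- If no coupling vanishes, a coefficient is nonzero exactly when its interaction is present. The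
-- picks thus do not depend on the values of the couplings, which is what the probability estimate
-- relies on.
lemma picks_ssykCoeff (hk : 0 < k) (hn : 0 < n) (hJ : ∀ I, J I ≠ 0) :
    picks (ssykCoeff k (presence A, J)) (quads n) = pickedQuads A := by
  have hν : 0 < 1 / √(2 * k * n) := by positivity
  refine greedy_congr _ fun q _ => ?_
  rw [Selects]
  constructor
  · rintro ⟨h1, h2, h3⟩
    obtain ⟨I, rfl, hI⟩ := exists_of_quadCoeff_ne_zero h3
    obtain ⟨-, e2, e3, e4⟩ := quadOf_lt I
    refine ⟨⟨h1, h2, e2, e3, e4⟩, Finset.mem_image.2 ⟨I, ?_, rfl⟩⟩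
    by_contra hIA
    rw [← abs_pos, abs_ssykCoeff, if_neg hIA] at hI
    exact lt_irrefl _ hI
  · rintro ⟨h1, h2⟩
    obtain ⟨I, hI, rfl⟩ := Finset.mem_image.1 h2
    refine ⟨h1.1, h1.2.1, ?_⟩
    rw [quadCoeff_quadOf, ← abs_pos, abs_ssykCoeff, if_pos hI]
    exact mul_pos hν (abs_pos.2 (hJ I))

open Classical in
lemma sum_picks_ssykCoeff (hk : 0 < k) (hn : 0 < n) (hJ : ∀ I, J I ≠ 0) :
    ((picks (ssykCoeff k (presence A, J)) (quads n)).map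
      fun q => |quadCoeff (ssykCoeff k (presence A, J)) q|).sum =
        1 / √(2 * k * n) * ∑ I ∈ picked A, |J I| := by
  rw [picks_ssykCoeff hk hn hJ, ← List.sum_toFinset _ (nodup_pickedQuads A), ← image_picked,
    Finset.sum_image fun I _ I' _ h => quadOf_injective h, Finset.mul_sum]
  refine Finset.sum_congr rfl fun I hI => ?_
  rw [quadCoeff_quadOf, abs_ssykCoeff, if_pos (picked_subset A hI)]

open Classical in
lemma sum_abs_ssykCoeff (A : Finset (Interaction n)) (J : Interaction n → ℝ) :
    ∑ I, |ssykCoeff k (presence A, J) I| =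
      1 / √(2 * k * n) * ∑ I ∈ A, |J I| := by
  simp only [abs_ssykCoeff]
  rw [Finset.sum_ite_mem, Finset.univ_inter, Finset.mul_sum]

end PickedInteractions

/-- The algorithm outputs the correlation matrix of a Gaussian state whose energy is at least the
sum of the absolute values of the picked coefficients. -/
lemma exists_gaussianState_output {n : ℕ} {c : Fin (2 * n) → FockMatrix n}
    (hc : IsMajoranaSystem n c) (k : ℝ) (h : Interaction n → ℝ) :
    ∃ ρ : FockMatrix n, IsGaussianState c ρ ∧ IsDensityMatrix ρ ∧
      (∀ i j, ((output algorithm n k h i j : ℝ) : ℂ) = correlation c ρ i j) ∧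
      ((picks h (quads n)).map fun q => |quadCoeff h q|).sum ≤ (hamiltonian c h * ρ).trace.re := by
  obtain ⟨-, -, -, es, hcorr, hnd, hmem, hw, hE⟩ := invariant_algorithm k h
  have hlt : ∀ v ∈ endpoints es, v < 2 * n := by
    intro v hv
    rw [hmem] at hv
    have key : ∀ L : List Quad, (∀ q ∈ L, quadCoeff h q ≠ 0) → ∀ v ∈ cover quadVerts L,
        v < 2 * n := by
      intro L
      induction L with
      | nil => simp
      | cons q L ih =>
        intro hq v hv
        rcases Finset.mem_union.1 hv with hv | hv
        · have := quadCoeff_ne_zero_lt (hq q (by simp))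
          simp only [quadVerts, Finset.mem_insert, Finset.mem_singleton] at hv
          omega
        · exact ih (fun r hr => hq r (by simp [hr])) v hv
    exact key _ (fun q hq => (mem_of_mem_greedy hq).1.2.2) v hv
  obtain ⟨σ, l, hl, hσ⟩ := exists_matchingCorr_eq hnd hlt hw
  refine ⟨matchingState c σ l, isGaussianState_matchingState c σ hl,
    isDensityMatrix_matchingState hc σ hl, fun i j => ?_, ?_⟩
  · rw [correlation_matchingState hc, hσ, ← hcorr]
    rfl
  · rw [trace_hamiltonian_matchingState hc h σ l
      (Γ := (algorithm.exec (inputState n k h)).1.corr) fun x y => by rw [hσ, hcorr]]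
    exact hE

end SparseSYK

/-! ### The main theorem -/

open SparseSYK
theorem mainTheorem3 :
    -- one algorithm and one polynomial for all instances
    ∃ (algo : Program) (T : Polynomial ℕ),
      ∀ (n : ℕ) (k : ℝ), 0 < k → 120 * (k + 1) < (n : ℝ) →
        -- polynomial running time, for every strictly 4-local Hamiltonian
        (∀ h : Interaction n → ℝ, runtime algo n k h ≤ T.eval n) ∧
        -- with high probability, a good Gaussian state is found
        ∀ c : Fin (2 * n) → FockMatrix n, IsMajoranaSystem n c →
          ∃ E : Set ((Interaction n → ℝ) × (Interaction n → ℝ)),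
            MeasurableSet E ∧
            1 - 4 * Real.exp (-(Real.exp (-16 * (k + 1)) * k ^ 3 / (64 * (8 * k + 7)) * n)) ≤
              (ssykLaw n k).real E ∧
            ∀ ω ∈ E, ∃ ρ : FockMatrix n, IsGaussianState c ρ ∧
              (∀ i j, ((output algo n k (ssykCoeff k ω) i j : ℝ) : ℂ) = correlation c ρ i j) ∧
              0 < lambdaMax (hamiltonian c (ssykCoeff k ω)) ∧
              1 / (1236 + 2752 * k + 1536 * k ^ 2) ≤
                (hamiltonian c (ssykCoeff k ω) * ρ).trace.re /
                  lambdaMax (hamiltonian c (ssykCoeff k ω)) := by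
  classical
  refine ⟨algorithm, algorithm.costPoly, fun n k hk hn =>
    ⟨runtime_algorithm_le k, fun c hc => ?_⟩⟩
  have hn0 : 0 < n := by
    have : (0 : ℝ) < n := by linarith
    exact_mod_cast this
  have hnR : (0 : ℝ) < n := by exact_mod_cast hn0
  set D := 1236 + 2752 * k + 1536 * k ^ 2 with hD
  have hD0 : 0 < D := by positivity
  set x := 5 / 4 * (n * k) with hx
  have hx0 : 0 < x := by positivity
  -- The event is written as a finite union over the present set `A`, so measurability is needed
  -- only in the couplings for fixed `A`.
  refine ⟨jointEvent fun A => goodCouplings (x / D) x (picked A) A,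
    measurableSet_jointEvent fun A => measurableSet_goodCouplings _ _ _ _, ?_, ?_⟩
  · have hp := coe_selectionProb hk hn
    have h1 := le_measure_jointEvent (selectionProb n k) (x / D) x (picked (n := n))
    have h2 := upper_tail_le hk hn hp (absMgf_nonneg 1) absMgf_one_le
    have h3 := lower_tail_le hk hn hp (absMgf_nonneg (-2)) absMgf_neg_two_le rfl rfl
    have h4 := greedyVal_quads_le (selectionProb n k).2.1 (selectionProb n k).2.2
      (absMgf_nonneg (-2)) (absMgf_neg_two_le.trans (by norm_num)) (n := n) rfl
      (w := 2 * n + 3 - 4 * ((n + 7) / 8)) (by omega)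
    have hcard : Fintype.card (Interaction n) = (2 * n).choose 4 := by
      rw [Fintype.card_finset_len, Fintype.card_fin]
    rw [subsetExp_picked, hcard] at h1
    have h5 := mul_le_mul_of_nonneg_left h4 (Real.exp_pos (2 * (x / D))).le
    have h6 := Real.exp_pos
      (-(Real.exp (-16 * (k + 1)) * k ^ 3 / (64 * (8 * k + 7)) * n))
    rw [ssykLaw]
    -- The two tails cost two of the four exponentials in the claim; the others are slack.
    refine le_trans ?_ h1
    linarith
  · rintro ω hω
    obtain ⟨A, hA⟩ := Set.mem_iUnion.1 hω
    obtain ⟨X, J⟩ := ω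
    obtain ⟨rfl, hJ0, hJy, hJx⟩ := hA
    have hν : 0 < 1 / √(2 * k * n) := by positivity
    obtain ⟨ρ, hρG, hρ, hout, hE⟩ := exists_gaussianState_output hc k
      (ssykCoeff k (presence A, J))
    rw [sum_picks_ssykCoeff hk hn0 hJ0] at hE
    have h1 := le_lambdaMax hc (ssykCoeff k (presence A, J)) hρ
    have h2 := lambdaMax_le hc (ssykCoeff k (presence A, J)) hρ
    rw [sum_abs_ssykCoeff] at h2
    have h3 := mul_lt_mul_of_pos_left hJy hν
    have h4 := mul_lt_mul_of_pos_left hJx hν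
    have h5 : 0 < 1 / √(2 * k * n) * (x / D) := by positivity
    have hpos : 0 < lambdaMax (hamiltonian c
        (ssykCoeff k (presence A, J))) := by linarith
    refine ⟨ρ, hρG, hout, hpos, ?_⟩
    -- With `ν` the common normalization, the energy exceeds `ν x / D` and the maximum is below `ν
    -- x`, so `ν x` cancels.
    rw [div_le_div_iff₀ hD0 hpos, one_mul]
    have h6 : 1 / √(2 * k * n) * (x / D) * D = 1 / √(2 * k * n) * x := by
      field_simp
    have h7 := mul_le_mul_of_nonneg_right (h3.le.trans hE) hD0.le
    linarith
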